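/- For $n\ge 1$ let $\mathcal L_n$ be the combinatorial Laplacian on functions on $\mathbb Z/n\mathbb Z$, $\mathcal L_nu(k)=\frac{n^2}{4\pi^2}\bigl(2u(k)-u(k+1)-u(k-1)\bigr)$, and on real functions on $(\mathbb Z/n\mathbb Z)^2$ put $$\Delta_n=\mathcal L_n\otimes \mathrm{id}+\mathrm{id}\otimes\mathcal L_n,\qquad \widetilde\Delta_n=\Delta_n-\frac{2}{3}\frac{\pi^2}{n^2}\,\mathcal L_n\otimes\mathcal L_n$$ (the 5-point and 9-point star Laplacians). For a non-negative symmetric operator $T$ on a finite-dimensional real space let $\zeta(T,s)=\sum\mu^{-s}$, summed over the non-zero eigenvalues $\mu$ of $T$ with multiplicity. Let $\zeta(\Delta,s)$ be the spectral zeta function of the Laplace–Beltrami operator on $(\mathbb R/2\pi\mathbb Z)^2$, i.e. the analytic continuation to $\mathbb C\setminus\{1\}$ of $\sum_{k\in\mathbb Z^2\setminus\{0\}}(k_1^2+k_2^2)^{-s}$, $\mathrm{Re}(s)>1$. Let $V_2(s)=2\,\frac{\sin(\pi s)}{\pi}\,\frac{\Gamma(1-s)\Gamma(2)}{\Gamma(2-s)}$,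 and let $\mathrm{f.p.}\!\!\int_0^\infty$ denote the Hadamard regularized integral: the sum of the constant terms in the expansions of $\int_1^R$ as $R\to\infty$ and of $\int_\varepsilon^1$ as $\varepsilon\to0$ in terms $x^{\beta}\log^l x$. **Theorem.** There are functions $b_m,\widetilde b_m$ ($m=0,1,2,\dots$) of $s$ such that for every $s\in\mathbb C$ with $0<\mathrm{Re}(s)<1$ and every integer $M\ge 0$, as $n\to\infty$, $$\zeta(\Delta_n,s)=V_2(s)\Bigl(a(s)\,n^{2-2s}+\sum_{m=0}^{M-1}b_m(s)\,n^{-2m}\Bigr)+O(n^{-2M-2s+2}),$$ $$\zeta(\widetilde\Delta_n,s)=V_2(s)\Bigl(\widetilde a(s)\,n^{2-2s}+\sum_{m=0}^{M-1}\widetilde b_m(s)\,n^{-2m}\Bigr)+O(n^{-2M-2s+2}),$$ where the leading coefficients are the absolutely convergent integrals $$a(s)=\int_0^\infty z^{4-2s-1}\int_0^1\!\!\int_0^1\Bigl(\tfrac{\sin^2(\pi x)}{\pi^2}+\tfrac{\sin^2(\pi y)}{\pi^2}+z^2\Bigr)^{-2}dx\,dy\,dz,$$ $$\widetilde a(s)=\int_0^\infty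 z^{4-2s-1}\int_0^1\!\!\int_0^1\Bigl(\tfrac{\sin^2(\pi x)}{\pi^2}+\tfrac{\sin^2(\pi y)}{\pi^2}-\tfrac{2}{3\pi^2}\sin^2(\pi x)\sin^2(\pi y)+z^2\Bigr)^{-2}dx\,dy\,dz,$$ and the first coefficients are $$b_0(s)=\widetilde b_0(s)=V_2(s)^{-1}\zeta(\Delta,s),\qquad \widetilde b_1(s)=\frac{s\pi^2}{3}\,V_2(s)^{-1}\zeta(\Delta,s-1),$$ $$b_1(s)=\frac{s\pi^2}{3}\,V_2(s)^{-1}\zeta(\Delta,s-1)-\frac{4\pi^2}{2-s}\,\mathrm{f.p.}\!\!\int_0^\infty z^{4-2s+1}\sum_{k_1,k_2\in\mathbb Z}\frac{k_1^2k_2^2}{(k_1^2+k_2^2+z^2)^4}\,dz .$$ (The coefficients $b_m(s),\widetilde b_m(s)$ do not depend on $n$ or $M$; the $O$-constants may depend on $s$ and $M$; $|n^{-2M-2s+2}|=n^{-2M-2\mathrm{Re}(s)+2}$.) -/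

import Mathlib

open Filter Topology Asymptotics MeasureTheory Set

noncomputable section

namespace DiscreteTorus

/-! ### Spectral zeta function of an operator in finite dimension -/

/-- The spectral zeta function of an endomorphism `T` of a finite dimensional real vector space:
the sum of `μ ^ (-s)` over all non-zero eigenvalues `μ` of `T`, taken with their multiplicity
(as roots of the characteristic polynomial; for a symmetric `T` this is also the dimension of the
eigenspace). -/
def spectralZeta {V : Type*} [AddCommGroup V] [Module ℝ V] [Module.Finite ℝ V] [Module.Free ℝ V]
    (T : V →ₗ[ℝ] V) (s : ℂ) : ℂ :=
  ((T.charpoly.roots.filter (fun μ => μ ≠ 0)).map (fun μ : ℝ => (μ : ℂ) ^ (-s))).sum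

/-! ### Discrete Laplacians -/

/-- Real-valued functions on the two-dimensional discrete torus `(ℤ/nℤ)²`. -/
abbrev TorusFun (n : ℕ) : Type := ZMod n × ZMod n → ℝ

/-- `L ⊗ id`: the combinatorial Laplacian
`(L u)(k) = n² / (4π²) * (2 u(k) - u(k+1) - u(k-1))` of the discrete circle `ℤ/nℤ`, acting on the
first variable. -/
def lapFst (n : ℕ) : TorusFun n →ₗ[ℝ] TorusFun n where
  toFun u k := (n : ℝ) ^ 2 / (4 * Real.pi ^ 2) *
    (2 * u (k.1, k.2) - u (k.1 + 1, k.2) - u (k.1 - 1, k.2))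
  map_add' u v := by ext k; simp only [Pi.add_apply]; ring
  map_smul' c u := by ext k; simp only [Pi.smul_apply, smul_eq_mul, RingHom.id_apply]; ring

/-- `id ⊗ L`: the combinatorial Laplacian of the discrete circle, acting on the second variable. -/
def lapSnd (n : ℕ) : TorusFun n →ₗ[ℝ] TorusFun n where
  toFun u k := (n : ℝ) ^ 2 / (4 * Real.pi ^ 2) *
    (2 * u (k.1, k.2) - u (k.1, k.2 + 1) - u (k.1, k.2 - 1))
  map_add' u v := by ext k; simp only [Pi.add_apply]; ring
  map_smul' c u := by ext k; simp only [Pi.smul_apply, smul_eq_mul, RingHom.id_apply]; ring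

/-- The (normalized) 5-point star Laplacian `L ⊗ id + id ⊗ L`. -/
def laplacian5 (n : ℕ) : TorusFun n →ₗ[ℝ] TorusFun n :=
  lapFst n + lapSnd n

/-- The (normalized) 9-point star Laplacian
`L ⊗ id + id ⊗ L - (2/3) (π²/n²) (L ⊗ L)`, where `L ⊗ L = (L ⊗ id) ∘ (id ⊗ L)`. -/
def laplacian9 (n : ℕ) : TorusFun n →ₗ[ℝ] TorusFun n :=
  lapFst n + lapSnd n - (2 / 3 * (Real.pi ^ 2 / (n : ℝ) ^ 2)) • (lapFst n ∘ₗ lapSnd n)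

/-! ### Spectral zeta function of the Laplace–Beltrami operator on the torus -/

/-- `Z` is the continuation to `ℂ \ {1}` of the spectral zeta function of the
Laplace–Beltrami operator on the torus `(ℝ/2πℤ)²`, whose eigenvalues, with multiplicity, are
`k₁² + k₂²`, `k ∈ ℤ²`: it is holomorphic away from the point `1`, and for `Re s > 1` it is the sum
of `(k₁² + k₂²) ^ (-s)` over `k ≠ 0`. By the identity theorem these properties determine `Z` on
`ℂ \ {1}`. -/
def IsTorusZeta (Z : ℂ → ℂ) : Prop :=
  DifferentiableOn ℂ Z {1}ᶜ ∧
    ∀ s : ℂ, 1 < s.re →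
      HasSum (fun k : {k : ℤ × ℤ // k ≠ 0} =>
        ((k.1.1 : ℂ) ^ 2 + (k.1.2 : ℂ) ^ 2) ^ (-s)) (Z s)

/-- The theta function `∑ exp (-π t (k₁² + k₂²))` tends to `1` rapidly. -/
theorem theta_sq_sub_one_isBigO (r : ℝ) :
    (fun t : ℝ => ((HurwitzZeta.evenKernel 0 t : ℝ) : ℂ) ^ 2 - 1) =O[atTop] fun t : ℝ => t ^ r := by
  obtain ⟨p, hp, h⟩ := HurwitzZeta.isBigO_atTop_evenKernel_sub 0
  simp only [if_true] at h
  have h1 : (fun t : ℝ => HurwitzZeta.evenKernel 0 t - 1) =O[atTop] fun t : ℝ => t ^ r :=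
    h.trans (isLittleO_exp_neg_mul_rpow_atTop hp r).isBigO
  have h0 : (fun t : ℝ => HurwitzZeta.evenKernel 0 t - 1) =O[atTop] fun _ : ℝ => (1 : ℝ) := by
    simpa using h.trans (isLittleO_exp_neg_mul_rpow_atTop hp 0).isBigO
  have h2 : (fun t : ℝ => HurwitzZeta.evenKernel 0 t + 1) =O[atTop] fun _ : ℝ => (1 : ℝ) := by
    have := h0.add (isBigO_refl (fun _ : ℝ => (2 : ℝ)) atTop |>.trans
      (isBigO_const_const 2 one_ne_zero atTop))
    refine this.congr_left fun t => by ring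
  have h3 : (fun t : ℝ => HurwitzZeta.evenKernel 0 t ^ 2 - 1) =O[atTop] fun t : ℝ => t ^ r :=
    ((h1.mul h2).congr_left fun t => by ring).congr_right fun t => mul_one _
  have h4 := Complex.isBigO_ofReal_left.mpr h3
  refine h4.congr_left fun t => by push_cast; ring

/-- The theta function `∑ exp (-π t (k₁² + k₂²))` and its inversion formula. -/
def thetaPair : WeakFEPair ℂ where
  f t := ((HurwitzZeta.evenKernel 0 t : ℝ) : ℂ) ^ 2
  g t := ((HurwitzZeta.evenKernel 0 t : ℝ) : ℂ) ^ 2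
  k := 1
  ε := 1
  f₀ := 1
  g₀ := 1
  hf_int := by
    refine ContinuousOn.locallyIntegrableOn ?_ measurableSet_Ioi
    exact (Complex.continuous_ofReal.comp_continuousOn
      (HurwitzZeta.continuousOn_evenKernel 0)).pow 2
  hg_int := by
    refine ContinuousOn.locallyIntegrableOn ?_ measurableSet_Ioi
    exact (Complex.continuous_ofReal.comp_continuousOn
      (HurwitzZeta.continuousOn_evenKernel 0)).pow 2
  hk := one_pos
  hε := one_ne_zero
  h_feq x hx := by
    have hx' : (0 : ℝ) < x := hx
    have h := HurwitzZeta.evenKernel_functional_equation 0 (1 / x)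
    rw [← HurwitzZeta.evenKernel_eq_cosKernel_of_zero, one_div_one_div] at h
    have h2 : HurwitzZeta.evenKernel 0 (1 / x) ^ 2 = x * HurwitzZeta.evenKernel 0 x ^ 2 := by
      rw [h, mul_pow, div_pow, one_pow, ← Real.rpow_natCast, ← Real.rpow_mul (by positivity)]
      norm_num
    simp only [smul_eq_mul, one_mul, Real.rpow_one]
    exact_mod_cast h2
  hf_top := theta_sq_sub_one_isBigO
  hg_top := theta_sq_sub_one_isBigO

/-- Convergence of the lattice sum for real exponents `> 1`. -/
theorem summable_lattice {σ : ℝ} (hσ : 1 < σ) :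
    Summable fun k : ℤ × ℤ => 1 / (((k.1 : ℝ) ^ 2 + (k.2 : ℝ) ^ 2) ^ σ) := by
  have h := EisensteinSeries.summable_one_div_norm_rpow (k := 2 * σ) (by linarith)
  rw [← (finTwoArrowEquiv ℤ).symm.summable_iff] at h
  refine h.of_nonneg_of_le (fun k => by positivity) fun k => ?_
  simp only [finTwoArrowEquiv_symm_apply, Function.comp_apply]
  have hn : ‖(![k.1, k.2] : Fin 2 → ℤ)‖ ^ 2 ≤ (k.1 : ℝ) ^ 2 + (k.2 : ℝ) ^ 2 := by
    rw [EisensteinSeries.norm_eq_max_natAbs]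
    simp only [Matrix.cons_val_zero, Matrix.cons_val_one]
    rcases le_total k.1.natAbs k.2.natAbs with hle | hle
    · rw [max_eq_right hle]
      have : ((k.2.natAbs : ℕ) : ℝ) ^ 2 = (k.2 : ℝ) ^ 2 := by
        rw [Nat.cast_natAbs, Int.cast_abs, sq_abs]
      rw [this]; nlinarith [sq_nonneg (k.1 : ℝ)]
    · rw [max_eq_left hle]
      have : ((k.1.natAbs : ℕ) : ℝ) ^ 2 = (k.1 : ℝ) ^ 2 := by
        rw [Nat.cast_natAbs, Int.cast_abs, sq_abs]
      rw [this]; nlinarith [sq_nonneg (k.2 : ℝ)]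
  by_cases hk : (![k.1, k.2] : Fin 2 → ℤ) = 0
  · have h1 : k.1 = 0 := by simpa using congrFun hk 0
    have h2 : k.2 = 0 := by simpa using congrFun hk 1
    rw [h1, h2]
    have : (0 : ℝ) < σ := by linarith
    norm_num [Real.zero_rpow this.ne']
    positivity
  · have hpos : 0 < ‖(![k.1, k.2] : Fin 2 → ℤ)‖ := norm_pos_iff.mpr hk
    rw [Real.rpow_neg hpos.le, Real.rpow_mul hpos.le, one_div]
    have : ‖(![k.1, k.2] : Fin 2 → ℤ)‖ ^ (2 : ℝ) = ‖(![k.1, k.2] : Fin 2 → ℤ)‖ ^ 2 := by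
      exact_mod_cast Real.rpow_natCast _ 2
    rw [this]
    gcongr

theorem hasSum_theta {t : ℝ} (ht : 0 < t) :
    HasSum (fun k : ℤ × ℤ => Real.exp (-Real.pi * ((k.1 : ℝ) ^ 2 + (k.2 : ℝ) ^ 2) * t))
      (HurwitzZeta.evenKernel 0 t ^ 2) := by
  have h := HurwitzZeta.hasSum_int_evenKernel 0 ht
  simp only [add_zero] at h
  rw [show ((0 : ℝ) : UnitAddCircle) = 0 from rfl] at h
  have hs : Summable fun n : ℤ => ‖Real.exp (-Real.pi * (n : ℝ) ^ 2 * t)‖ := by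
    simpa using h.summable
  have := h.mul h (summable_mul_of_summable_norm hs hs)
  rw [← sq] at this
  refine this.congr_fun fun k => ?_
  rw [← Real.exp_add]; ring_nf

/-- The spectral zeta function of the torus has a (unique) continuation to `ℂ \ {1}`. -/
theorem exists_isTorusZeta : ∃ Z, IsTorusZeta Z := by
  refine ⟨fun s => (Real.pi : ℂ) ^ s * ((Complex.Gamma s)⁻¹ *
    (thetaPair.Λ₀ s - 1 / (1 - s)) - (Complex.Gamma (s + 1))⁻¹), ?_, fun s hs => ?_⟩
  · intro s hs
    have hs1 : 1 - s ≠ 0 := fun h => hs (sub_eq_zero.mp h).symm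
    have hpi : (Real.pi : ℂ) ≠ 0 := by exact_mod_cast Real.pi_ne_zero
    have hG := Complex.differentiable_one_div_Gamma
    have hG1 : DifferentiableAt ℂ (fun s : ℂ => (Complex.Gamma (s + 1))⁻¹) s :=
      DifferentiableAt.comp (f := fun s : ℂ => s + 1) (g := fun s : ℂ => (Complex.Gamma s)⁻¹) s
        (hG (s + 1)) (by fun_prop)
    have hΛ := thetaPair.differentiable_Λ₀ s
    have h1 : DifferentiableAt ℂ (fun s : ℂ => 1 / (1 - s)) s :=
      (differentiableAt_const _).div (by fun_prop) hs1
    have hp : DifferentiableAt ℂ (fun s : ℂ => (Real.pi : ℂ) ^ s) s :=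
      differentiableAt_id.const_cpow (Or.inl hpi)
    exact (hp.mul (((hG s).mul (hΛ.sub h1)).sub hG1)).differentiableWithinAt
  · have hs0 : 0 < s.re := by linarith
    have hsne : s ≠ 0 := by rintro rfl; simp at hs0
    have hpi : (Real.pi : ℂ) ≠ 0 := by exact_mod_cast Real.pi_ne_zero
    have hG : Complex.Gamma s ≠ 0 := Complex.Gamma_ne_zero_of_re_pos hs0
    have hM := (thetaPair.hasMellin (s := s) hs).2
    have hz (k : ℤ × ℤ) : ((k.1 : ℝ) ^ 2 + (k.2 : ℝ) ^ 2 = 0) ↔ k = 0 := by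
      constructor
      · intro h
        have h1 : (k.1 : ℝ) = 0 := by nlinarith [sq_nonneg (k.1 : ℝ), sq_nonneg (k.2 : ℝ)]
        have h2 : (k.2 : ℝ) = 0 := by nlinarith [sq_nonneg (k.1 : ℝ), sq_nonneg (k.2 : ℝ)]
        exact Prod.ext (by exact_mod_cast h1) (by exact_mod_cast h2)
      · rintro rfl; simp
    have hF : ∀ t ∈ Ioi (0 : ℝ), HasSum (fun k : ℤ × ℤ =>
        if (k.1 : ℝ) ^ 2 + (k.2 : ℝ) ^ 2 = 0 then 0 else
          (1 : ℂ) * Real.exp (-Real.pi * ((k.1 : ℝ) ^ 2 + (k.2 : ℝ) ^ 2) * t))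
        (thetaPair.f t - thetaPair.f₀) := by
      intro t ht
      have h := Complex.hasSum_ofReal.mpr (hasSum_theta ht)
      have h' := hasSum_ite_sub_hasSum h 0
      have he : thetaPair.f t - thetaPair.f₀ =
          ((HurwitzZeta.evenKernel 0 t ^ 2 : ℝ) : ℂ) -
            ((Real.exp (-Real.pi * (((0 : ℤ × ℤ).1 : ℝ) ^ 2 + ((0 : ℤ × ℤ).2 : ℝ) ^ 2) * t) :
              ℝ) : ℂ) := by simp [thetaPair]
      rw [he]
      refine h'.congr_fun fun k => ?_
      by_cases hk : k = 0
      · rw [if_pos ((hz k).mpr hk), if_pos hk]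
      · rw [if_neg (fun h => hk ((hz k).mp h)), if_neg hk, one_mul]
    have hsum := hasSum_mellin_pi_mul₀ (fun k : ℤ × ℤ => by positivity) hs0 hF (by
      simpa using summable_lattice hs)
    rw [hM] at hsum
    have hval : (Real.pi : ℂ) ^ s * ((Complex.Gamma s)⁻¹ *
        (thetaPair.Λ₀ s - 1 / (1 - s)) - (Complex.Gamma (s + 1))⁻¹) =
        (Real.pi : ℂ) ^ s * (Complex.Gamma s)⁻¹ * thetaPair.Λ s := by
      rw [thetaPair.Λ₀_eq, Complex.Gamma_add_one s hsne]
      simp only [thetaPair, smul_eq_mul, mul_one, Complex.ofReal_one]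
      field_simp
      ring
    simp only [hval]
    have hsum2 := hsum.mul_left ((Real.pi : ℂ) ^ s * (Complex.Gamma s)⁻¹)
    rw [← hasSum_subtype_iff_of_support_subset (s := {k : ℤ × ℤ | k ≠ 0})] at hsum2
    · refine hsum2.congr_fun fun k => ?_
      simp only [Function.comp_apply, Complex.cpow_neg]
      have : (Real.pi : ℂ) ^ s ≠ 0 := by simp [Complex.cpow_eq_zero_iff, hpi]
      push_cast
      field_simp
    · intro k hk hk0
      have hk1 : k = 0 := hk0
      subst hk1
      exact hk (by simp [Complex.zero_cpow hsne])

/-- The spectral zeta function `ζ(Δ, s)` of the Laplace–Beltrami operator on the torus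
`(ℝ/2πℤ)²`, continued to `ℂ \ {1}` (its value at the pole `s = 1` is irrelevant). -/
def torusZeta : ℂ → ℂ := exists_isTorusZeta.choose

theorem torusZeta_spec : IsTorusZeta torusZeta := exists_isTorusZeta.choose_spec

/-! ### Hadamard regularized limits and integrals -/

/-- `c` is the regularized limit of `v` at infinity: `v` has an asymptotic expansion, up to a
remainder decaying like a negative power of `x`, into finitely many terms `x ^ α * (log x) ^ l`
(`α ∈ ℂ`, `l ∈ ℕ`), in which the constant term, `(α, l) = (0, 0)`, is `c`. -/
def HasRegLim (v : ℝ → ℂ) (c : ℂ) : Prop :=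
  ∃ (S : Finset (ℂ × ℕ)) (a : ℂ × ℕ → ℂ) (δ : ℝ), (0, 0) ∉ S ∧ 0 < δ ∧
    (fun x : ℝ => v x - (c + ∑ p ∈ S, a p * (x : ℂ) ^ p.1 * ((Real.log x : ℝ) : ℂ) ^ p.2))
      =o[atTop] fun x : ℝ => x ^ (-δ)

/-- `c` is the Hadamard regularized integral of `u` over `(0, ∞)`: the sum of the regularized
limits of `∫_ε^1 u` as `ε = 1 / R → 0` and of `∫_1^R u` as `R → ∞`. -/
def HasRegIntegral (u : ℝ → ℂ) (c : ℂ) : Prop :=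
  ContinuousOn u (Ioi 0) ∧ ∃ c₀ c₁ : ℂ,
    HasRegLim (fun R : ℝ => ∫ x in R⁻¹..1, u x) c₀ ∧
    HasRegLim (fun R : ℝ => ∫ x in (1 : ℝ)..R, u x) c₁ ∧
    c = c₀ + c₁

/-! ### The coefficients -/

/-- The factor `V_α(s) = 2 (sin(πs)/π) Γ(1-s) Γ(α) / Γ(α-s)`. -/
def V (α : ℕ) (s : ℂ) : ℂ :=
  2 * (Complex.sin (Real.pi * s) / Real.pi) *
    (Complex.Gamma (1 - s) * Complex.Gamma α / Complex.Gamma (α - s))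

/-- The symbol of the 5-point star Laplacian. -/
def symbol5 (x y : ℝ) : ℝ :=
  Real.sin (Real.pi * x) ^ 2 / Real.pi ^ 2 + Real.sin (Real.pi * y) ^ 2 / Real.pi ^ 2

/-- The symbol of the 9-point star Laplacian. -/
def symbol9 (x y : ℝ) : ℝ :=
  Real.sin (Real.pi * x) ^ 2 / Real.pi ^ 2 + Real.sin (Real.pi * y) ^ 2 / Real.pi ^ 2
    - 2 / (3 * Real.pi ^ 2) * Real.sin (Real.pi * x) ^ 2 * Real.sin (Real.pi * y) ^ 2

/-- The function `z ^ (2α-2s-1) ∫_0^1 ∫_0^1 (F(x,y) + z²) ^ (-α) dx dy` of `z`, for `α = 2`. -/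
def leadingIntegrand (F : ℝ → ℝ → ℝ) (s : ℂ) (z : ℝ) : ℂ :=
  (z : ℂ) ^ (4 - 2 * s - 1) *
    ((∫ x in (0 : ℝ)..1, ∫ y in (0 : ℝ)..1, ((F x y + z ^ 2) ^ 2)⁻¹ : ℝ) : ℂ)

/-- The function `z ^ (4-2s+1) ∑_{k ∈ ℤ²} k₁² k₂² / (k₁² + k₂² + z²) ^ 4` of `z`. -/
def angularIntegrand (s : ℂ) (z : ℝ) : ℂ :=
  (z : ℂ) ^ (4 - 2 * s + 1) *
    ((∑' k : ℤ × ℤ, (k.1 : ℝ) ^ 2 * (k.2 : ℝ) ^ 2 /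
      ((k.1 : ℝ) ^ 2 + (k.2 : ℝ) ^ 2 + z ^ 2) ^ 4 : ℝ) : ℂ)

end DiscreteTorus

end

/-!
Both star Laplacians are diagonalized by the functions `cos + sin` of the discrete torus, and their
eigenvalues are `n² F(j / n)`, where the symbol `F = symb l` is `sinSq x + sinSq y - l sinSq x sinSq
y` with `l = 0` or `l = 2 π² / 3`. Since the Mellin transform at `s` of `profile v = v exp (-v)` is
`Γ(s + 1)`, the function `Γ(s + 1) ζ(s)` is the Mellin transform of the heat-type trace `u ↦ ∑ j,
profile (n² u F(j / n))`; the factor `v` removes the zero eigenvalue and makes everything converge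
for `0 < Re s < 1`. From this trace one subtracts its leading part `n² ∫ profile (n² u F)`, whose
Mellin transform is a multiple, independent of `n`, of the leading coefficient times `n ^ (2 - 2 s)`
(`leadingIntegrand_integral`). The difference `torusRem` is expanded uniformly in `u`
(`abs_expansionRem_le`):

* For `n u ≤ 1` it is exponentially small in `n`, because the `n`-point trapezoidal rule is exact on
  the terms of degree `< n` of the power series of the profile, and the others are negligible
  (`abs_sum_profile_sub_le`).
* For `n u ≥ 1`, put `τ = n² u`. The expansion of `τ F` in powers of `1 / τ`, at fixed `τ x²` and
  `τ y²`, turns the profile into a Gaussian times polynomials (`profile_symb_expansion`). Summing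
  over the lattice and integrating over the plane, `torusRem` becomes
  `∑ m, (n² u) ^ (-m) q_m(u)`, where `q_m` is a difference between a lattice sum and an integral of
  one Gaussian polynomial (`torusRem_expansion`).

By the theta inversion formula, `q_m` vanishes to infinite order at `u = 0` (`flat_latticeRem`), so
that the expansion may be integrated against `u ^ (s - 1)` over the whole half-line. This gives the
complete expansion, with coefficients the Mellin transforms of `q_m` at `s - m`
(`spectralZeta_expansion`).

The function `q_0` is `u` times the lattice sum of `|k|² exp (-u |k|²)` minus the corresponding
integral, so its Mellin transform is `Γ(s + 1)` times the zeta function of the torus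
(`mellin_latticeRem_eq`, from uniqueness of the continuation). In `q_1`, integration by parts leaves
the lattice sums of `k₁⁴ + k₂⁴` and `k₁² k₂²`. The combination `k₁⁴ + 2 k₁² k₂² + k₂⁴` is again a
value of the zeta function, and the remaining multiple of `k₁² k₂²` has the factor `2 π² / 3 - l`:
it disappears for the 9-point Laplacian (`mellinCoeff_one`). A Laplace transform in `z²` relates its
Mellin transform to the regularized angular integral: subtracting the leading term `π / 4 * t⁻³` of
the squared theta series corresponds to removing a single power of `z`, which contributes nothing to
the regularized integral (`hasRegIntegral_angularIntegrand`).
-/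

namespace DiscreteTorus

/-! ### The symbols and their Taylor expansion -/

/-- The symbol `sin² (π x) / π²` of the discrete circle Laplacian. -/
noncomputable def sinSq (x : ℝ) : ℝ := Real.sin (Real.pi * x) ^ 2 / Real.pi ^ 2

/-- A one-parameter family of symbols which contains the symbols of both star Laplacians, for
`l = 0` and `l = 2 π² / 3`. -/
noncomputable def symb (l x y : ℝ) : ℝ := sinSq x + sinSq y - l * sinSq x * sinSq y

theorem symbol5_eq : symbol5 = symb 0 := by
  funext x y; simp [symbol5, symb, sinSq]

theorem symbol9_eq : symbol9 = symb (2 * Real.pi ^ 2 / 3) := by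
  funext x y
  simp only [symbol9, symb, sinSq]
  field_simp

theorem sinSq_nonneg (x : ℝ) : 0 ≤ sinSq x := by unfold sinSq; positivity

theorem pi_sq_mul_sinSq_le_one (x : ℝ) : Real.pi ^ 2 * sinSq x ≤ 1 := by
  unfold sinSq
  rw [mul_div_cancel₀ _ (by positivity)]
  exact Real.sin_sq_le_one _

theorem continuous_sinSq : Continuous sinSq := by unfold sinSq; fun_prop

theorem sinSq_periodic : Function.Periodic sinSq 1 := by
  intro x
  simp only [sinSq, mul_add, mul_one, Real.sin_add_pi, neg_sq]

theorem sinSq_ge {x : ℝ} (hx : |x| ≤ 1 / 2) : 4 / Real.pi ^ 2 * x ^ 2 ≤ sinSq x := by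
  have hpi := Real.pi_pos
  have h := Real.mul_le_sin (x := Real.pi * |x|) (by positivity) (by nlinarith)
  have h2 : 2 * |x| ≤ Real.sin (Real.pi * |x|) := by
    convert h using 1; field_simp
  have h3 : sinSq x = Real.sin (Real.pi * |x|) ^ 2 / Real.pi ^ 2 := by
    unfold sinSq
    rcases abs_cases x with ⟨h, -⟩ | ⟨h, -⟩ <;> rw [h]
    rw [mul_neg, Real.sin_neg, neg_sq]
  rw [h3, div_mul_eq_mul_div]
  gcongr
  have := pow_le_pow_left₀ (by positivity) h2 2
  rw [mul_pow, sq_abs] at this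
  linarith

/-- The mixed term is absorbed because `sinSq ≤ 1 / π²`; the value `l = 2 π² / 3` of the 9-point
Laplacian still leaves the factor `2 / 3`. -/
theorem symb_ge {l : ℝ} (hl : l ≤ 2 * Real.pi ^ 2 / 3) (x y : ℝ) :
    2 / 3 * (sinSq x + sinSq y) ≤ symb l x y := by
  have h1 := sinSq_nonneg x
  have h2 := sinSq_nonneg y
  have h3 := mul_le_mul_of_nonneg_right (pi_sq_mul_sinSq_le_one x) h2
  have h4 := mul_le_mul_of_nonneg_right (pi_sq_mul_sinSq_le_one y) h1
  have h5 : l * (sinSq x * sinSq y) ≤ 2 * Real.pi ^ 2 / 3 * (sinSq x * sinSq y) := by gcongr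
  unfold symb
  nlinarith

theorem symb_nonneg {l : ℝ} (hl : l ≤ 2 * Real.pi ^ 2 / 3) (x y : ℝ) : 0 ≤ symb l x y :=
  le_trans (by have := sinSq_nonneg x; have := sinSq_nonneg y; positivity) (symb_ge hl x y)

theorem symb_le {l : ℝ} (hl : 0 ≤ l) (x y : ℝ) : symb l x y ≤ 2 / Real.pi ^ 2 := by
  have h1 := sinSq_nonneg x
  have h2 := sinSq_nonneg y
  have h3 : 0 ≤ l * sinSq x * sinSq y := by positivity
  have h4 := pi_sq_mul_sinSq_le_one x
  have h5 := pi_sq_mul_sinSq_le_one y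
  rw [le_div_iff₀ (by positivity)]
  unfold symb
  nlinarith [mul_nonneg h3 (sq_nonneg Real.pi)]

theorem symb_ge_normSq {l : ℝ} (hl : l ≤ 2 * Real.pi ^ 2 / 3) {x y : ℝ} (hx : |x| ≤ 1 / 2)
    (hy : |y| ≤ 1 / 2) : 1 / 4 * (x ^ 2 + y ^ 2) ≤ symb l x y := by
  refine le_trans ?_ (symb_ge hl x y)
  have h1 := sinSq_ge hx
  have h2 := sinSq_ge hy
  have h3 : 3 / 8 ≤ 4 / Real.pi ^ 2 := by
    rw [div_le_div_iff₀ (by norm_num) (by positivity)]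
    nlinarith [Real.pi_lt_d2, Real.pi_pos]
  have h4 : 3 / 8 * x ^ 2 ≤ 4 / Real.pi ^ 2 * x ^ 2 := by gcongr
  have h5 : 3 / 8 * y ^ 2 ≤ 4 / Real.pi ^ 2 * y ^ 2 := by gcongr
  linarith

theorem continuous_symb (l : ℝ) : Continuous fun p : ℝ × ℝ => symb l p.1 p.2 := by
  have := continuous_sinSq
  unfold symb; fun_prop

/-- The coefficients of `sin² (π x) / π² = ∑ j, sinSqCoeff j * x ^ (2 j + 2)`. -/
noncomputable def sinSqCoeff (j : ℕ) : ℝ :=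
  (-1) ^ j * (2 * Real.pi) ^ (2 * j + 2) / (2 * Real.pi ^ 2 * (2 * j + 2).factorial)

theorem sinSqCoeff_zero : sinSqCoeff 0 = 1 := by
  have := Real.pi_ne_zero
  simp [sinSqCoeff, Nat.factorial]; field_simp

theorem sinSqCoeff_one : sinSqCoeff 1 = -(Real.pi ^ 2 / 3) := by
  have := Real.pi_ne_zero
  simp [sinSqCoeff, Nat.factorial]; field_simp; norm_num

theorem hasSum_sinSq (x : ℝ) : HasSum (fun j => sinSqCoeff j * x ^ (2 * j + 2)) (sinSq x) := by
  have h := (hasSum_nat_add_iff' 1).mpr (Real.hasSum_cos (2 * Real.pi * x))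
  have h2 := h.mul_left (-1 / (2 * Real.pi ^ 2))
  have hpi := Real.pi_ne_zero
  convert! h2 using 1
  · funext j
    simp only [sinSqCoeff]
    rw [show 2 * (j + 1) = 2 * j + 2 by ring, mul_pow _ x]
    field_simp
    ring
  · simp only [Finset.range_one, Finset.sum_singleton, sinSq]
    rw [show 2 * Real.pi * x = 2 * (Real.pi * x) by ring, Real.cos_two_mul, Real.cos_sq']
    simp; field_simp; ring

theorem sinSq_sub_sum_le (M : ℕ) : ∃ C, 0 ≤ C ∧ ∀ x : ℝ, |x| ≤ 1 / 2 →
    |sinSq x - ∑ j ∈ Finset.range M, sinSqCoeff j * x ^ (2 * j + 2)| ≤ C * x ^ (2 * M + 2) := by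
  have hs : Summable fun j => |sinSqCoeff (j + M)| := by
    rw [summable_nat_add_iff M (f := fun j => |sinSqCoeff j|)]
    simpa using (hasSum_sinSq 1).summable.abs
  refine ⟨∑' j, |sinSqCoeff (j + M)|, by positivity, fun x hx => ?_⟩
  have h := (hasSum_nat_add_iff' M).mpr (hasSum_sinSq x)
  rw [← h.tsum_eq, ← Real.norm_eq_abs, ← tsum_mul_right]
  refine tsum_of_norm_bounded (hs.mul_right _).hasSum fun j => ?_
  rw [Real.norm_eq_abs, abs_mul]
  gcongr
  rw [show 2 * (j + M) + 2 = 2 * j + (2 * M + 2) by ring, pow_add, abs_mul,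
    abs_of_nonneg (show 0 ≤ x ^ (2 * M + 2) by rw [← mul_add_one 2 M, pow_mul]; positivity)]
  refine mul_le_of_le_one_left (by rw [← mul_add_one 2 M, pow_mul]; positivity) ?_
  rw [abs_pow]
  exact pow_le_one₀ (abs_nonneg _) (by linarith)

/-! ### Asymptotic expansions with polynomial coefficients -/

/-- `g τ x y` is bounded by `τ ^ (-k)` times a polynomial in `τ x²` and `τ y²`, for `τ ≥ 1` and
`x, y ∈ r`. -/
def PolyBdd (r : Set ℝ) (k : ℕ) (g : ℝ → ℝ → ℝ → ℝ) : Prop :=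
  ∃ C : ℝ, ∃ A : ℕ, 0 ≤ C ∧ ∀ τ x y, 1 ≤ τ → x ∈ r → y ∈ r →
    |g τ x y| ≤ C * τ⁻¹ ^ k * (1 + τ * x ^ 2 + τ * y ^ 2) ^ A

theorem one_le_weight {τ : ℝ} (x y : ℝ) (hτ : 1 ≤ τ) : 1 ≤ 1 + τ * x ^ 2 + τ * y ^ 2 := by
  have : 0 ≤ τ * x ^ 2 := by positivity
  have : 0 ≤ τ * y ^ 2 := by positivity
  linarith

theorem PolyBdd.add {r : Set ℝ} {k : ℕ} {f g : ℝ → ℝ → ℝ → ℝ} (hf : PolyBdd r k f)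
    (hg : PolyBdd r k g) : PolyBdd r k (fun τ x y => f τ x y + g τ x y) := by
  obtain ⟨C, A, hC, hf⟩ := hf
  obtain ⟨C', A', hC', hg⟩ := hg
  refine ⟨C + C', A + A', by positivity, fun τ x y hτ hx hy => ?_⟩
  have h1 := hf τ x y hτ hx hy
  have h2 := hg τ x y hτ hx hy
  have hw := one_le_weight x y hτ
  have h3 : (1 + τ * x ^ 2 + τ * y ^ 2) ^ A ≤ (1 + τ * x ^ 2 + τ * y ^ 2) ^ (A + A') :=
    pow_le_pow_right₀ hw (by omega)
  have h4 : (1 + τ * x ^ 2 + τ * y ^ 2) ^ A' ≤ (1 + τ * x ^ 2 + τ * y ^ 2) ^ (A + A') :=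
    pow_le_pow_right₀ hw (by omega)
  calc _ ≤ |f τ x y| + |g τ x y| := abs_add_le _ _
    _ ≤ C * τ⁻¹ ^ k * (1 + τ * x ^ 2 + τ * y ^ 2) ^ (A + A') +
        C' * τ⁻¹ ^ k * (1 + τ * x ^ 2 + τ * y ^ 2) ^ (A + A') := by
        refine add_le_add (h1.trans ?_) (h2.trans ?_) <;> gcongr
    _ = _ := by ring

theorem PolyBdd.mul {r : Set ℝ} {k k' : ℕ} {f g : ℝ → ℝ → ℝ → ℝ} (hf : PolyBdd r k f)
    (hg : PolyBdd r k' g) : PolyBdd r (k + k') (fun τ x y => f τ x y * g τ x y) := by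
  obtain ⟨C, A, hC, hf⟩ := hf
  obtain ⟨C', A', hC', hg⟩ := hg
  refine ⟨C * C', A + A', by positivity, fun τ x y hτ hx hy => ?_⟩
  rw [abs_mul]
  refine (mul_le_mul (hf τ x y hτ hx hy) (hg τ x y hτ hx hy) (abs_nonneg _) ?_).trans_eq (by ring)
  have := one_le_weight x y hτ
  positivity

theorem PolyBdd.congr {r : Set ℝ} {k : ℕ} {f g : ℝ → ℝ → ℝ → ℝ} (hf : PolyBdd r k f)
    (h : ∀ τ x y, 1 ≤ τ → x ∈ r → y ∈ r → g τ x y = f τ x y) : PolyBdd r k g := by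
  obtain ⟨C, A, hC, hf⟩ := hf
  exact ⟨C, A, hC, fun τ x y hτ hx hy => by rw [h τ x y hτ hx hy]; exact hf τ x y hτ hx hy⟩

theorem PolyBdd.neg {r : Set ℝ} {k : ℕ} {f : ℝ → ℝ → ℝ → ℝ} (hf : PolyBdd r k f) :
    PolyBdd r k (fun τ x y => - f τ x y) := by
  obtain ⟨C, A, hC, hf⟩ := hf
  exact ⟨C, A, hC, fun τ x y hτ hx hy => by rw [abs_neg]; exact hf τ x y hτ hx hy⟩

theorem PolyBdd.mono {r r' : Set ℝ} {k k' : ℕ} {f : ℝ → ℝ → ℝ → ℝ} (hf : PolyBdd r k f)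
    (hr : r' ⊆ r) (hk : k' ≤ k) : PolyBdd r' k' f := by
  obtain ⟨C, A, hC, hf⟩ := hf
  refine ⟨C, A, hC, fun τ x y hτ hx hy => (hf τ x y hτ (hr hx) (hr hy)).trans ?_⟩
  have := one_le_weight x y hτ
  have : τ⁻¹ ^ k ≤ τ⁻¹ ^ k' :=
    pow_le_pow_of_le_one (by positivity) (inv_le_one_of_one_le₀ hτ) hk
  gcongr

theorem PolyBdd.sum {r : Set ℝ} {k : ℕ} {ι : Type*} (s : Finset ι) {f : ι → ℝ → ℝ → ℝ → ℝ}
    (h : ∀ i ∈ s, PolyBdd r k (f i)) : PolyBdd r k (fun τ x y => ∑ i ∈ s, f i τ x y) := by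
  classical
  induction s using Finset.induction_on with
  | empty => exact ⟨0, 0, le_rfl, by simp⟩
  | insert a s ha ih =>
    simp only [Finset.sum_insert ha]
    exact (h a (by simp)).add (ih fun i hi => h i (by simp [hi]))

/-- Evaluation of the coefficients of an expansion at `(τ x², τ y²)`. -/
noncomputable abbrev evalSq (p : MvPolynomial (Fin 2) ℝ) (τ x y : ℝ) : ℝ :=
  MvPolynomial.eval ![τ * x ^ 2, τ * y ^ 2] p

theorem polyBdd_inv_pow (r : Set ℝ) (k : ℕ) : PolyBdd r k (fun τ _ _ => τ⁻¹ ^ k) :=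
  ⟨1, 0, zero_le_one, fun τ x y hτ _ _ => by
    have : 0 ≤ τ⁻¹ := by positivity
    simp [abs_of_nonneg (by linarith : 0 ≤ τ)]⟩

theorem polyBdd_evalSq (r : Set ℝ) (p : MvPolynomial (Fin 2) ℝ) : PolyBdd r 0 (evalSq p) := by
  induction p using MvPolynomial.induction_on with
  | C a => exact ⟨|a|, 0, abs_nonneg _, by simp [evalSq]⟩
  | add p q hp hq => exact (hp.add hq).congr fun τ x y _ _ _ => by simp [evalSq]
  | mul_X p i hp =>
    have : PolyBdd r 0 (evalSq (MvPolynomial.X i)) := by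
      refine ⟨1, 1, zero_le_one, fun τ x y hτ _ _ => ?_⟩
      have h1 : 0 ≤ τ * x ^ 2 := by positivity
      have h2 : 0 ≤ τ * y ^ 2 := by positivity
      simp only [MvPolynomial.eval_X, pow_zero, pow_one, one_mul]
      fin_cases i
      · simp only [Fin.zero_eta, Matrix.cons_val_zero, abs_of_nonneg h1]; linarith
      · simp only [Fin.mk_one, Matrix.cons_val_one, Matrix.cons_val_fin_one, abs_of_nonneg h2]; linarith
    exact (hp.mul this).congr fun τ x y _ _ _ => by simp [evalSq]

/-- The truncated expansion `∑ m < M, τ ^ (-m) Ψ_m (τ x², τ y²)`. -/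
noncomputable def truncEval (M : ℕ) (Ψ : PowerSeries (MvPolynomial (Fin 2) ℝ)) (τ x y : ℝ) : ℝ :=
  ∑ m ∈ Finset.range M, τ⁻¹ ^ m * evalSq (PowerSeries.coeff m Ψ) τ x y

theorem polyBdd_truncEval (r : Set ℝ) (M : ℕ) (Ψ : PowerSeries (MvPolynomial (Fin 2) ℝ)) :
    PolyBdd r 0 (truncEval M Ψ) :=
  PolyBdd.sum _ fun m _ =>
    ((polyBdd_inv_pow r m).mul (polyBdd_evalSq r _)).mono subset_rfl (Nat.zero_le _)

theorem truncEval_add (M : ℕ) (Ψ Φ : PowerSeries (MvPolynomial (Fin 2) ℝ)) (τ x y : ℝ) :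
    truncEval M (Ψ + Φ) τ x y = truncEval M Ψ τ x y + truncEval M Φ τ x y := by
  simp [truncEval, mul_add, Finset.sum_add_distrib]

theorem polyBdd_truncEval_mul (r : Set ℝ) (M : ℕ) (Ψ Φ : PowerSeries (MvPolynomial (Fin 2) ℝ)) :
    PolyBdd r M fun τ x y =>
      truncEval M Ψ τ x y * truncEval M Φ τ x y - truncEval M (Ψ * Φ) τ x y := by
  have key : PolyBdd r M fun τ x y =>
      ∑ p ∈ (Finset.range M ×ˢ Finset.range M).filter (fun p => ¬ p.1 + p.2 < M),
        (τ⁻¹ ^ p.1 * evalSq (PowerSeries.coeff p.1 Ψ) τ x y) *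
          (τ⁻¹ ^ p.2 * evalSq (PowerSeries.coeff p.2 Φ) τ x y) := by
    refine PolyBdd.sum _ fun p hp => ?_
    have := ((polyBdd_inv_pow r p.1).mul (polyBdd_evalSq r (PowerSeries.coeff p.1 Ψ))).mul
      ((polyBdd_inv_pow r p.2).mul (polyBdd_evalSq r (PowerSeries.coeff p.2 Φ)))
    refine this.mono subset_rfl ?_
    simp at hp; omega
  refine key.congr fun τ x y _ _ _ => ?_
  have h1 : truncEval M (Ψ * Φ) τ x y =
      ∑ p ∈ (Finset.range M ×ˢ Finset.range M).filter (fun p => p.1 + p.2 < M),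
        (τ⁻¹ ^ p.1 * evalSq (PowerSeries.coeff p.1 Ψ) τ x y) *
          (τ⁻¹ ^ p.2 * evalSq (PowerSeries.coeff p.2 Φ) τ x y) := by
    rw [← Finset.sum_fiberwise_of_maps_to (g := fun p : ℕ × ℕ => p.1 + p.2) (t := Finset.range M)
      (fun p hp => by simp at hp ⊢; exact hp.2)]
    refine Finset.sum_congr rfl fun m hm => ?_
    rw [PowerSeries.coeff_mul, evalSq, map_sum, Finset.mul_sum]
    refine Finset.sum_congr ?_ fun p hp => ?_
    · ext p; simp at hm ⊢; omega
    · rw [map_mul, ← (Finset.mem_filter.mp hp).2]; ring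
  rw [h1, truncEval, truncEval, Finset.sum_mul_sum, ← Finset.sum_product',
    ← Finset.sum_filter_add_sum_filter_not _ (fun p : ℕ × ℕ => p.1 + p.2 < M)]
  ring

/-- `f τ x y ∼ ∑ m, τ ^ (-m) Ψ_m (τ x², τ y²)`, for `|x|, |y| ≤ 1/2`, in the sense that each
remainder is of the order of the first omitted term, up to polynomial factors. -/
def HasExpansion (f : ℝ → ℝ → ℝ → ℝ) (Ψ : PowerSeries (MvPolynomial (Fin 2) ℝ)) : Prop :=
  ∀ M, PolyBdd (Icc (-(1 / 2)) (1 / 2)) M fun τ x y => f τ x y - truncEval M Ψ τ x y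

theorem HasExpansion.add {f g : ℝ → ℝ → ℝ → ℝ} {Ψ Φ : PowerSeries (MvPolynomial (Fin 2) ℝ)}
    (hf : HasExpansion f Ψ) (hg : HasExpansion g Φ) :
    HasExpansion (fun τ x y => f τ x y + g τ x y) (Ψ + Φ) := fun M =>
  ((hf M).add (hg M)).congr fun τ x y _ _ _ => by rw [truncEval_add]; ring

theorem HasExpansion.congr {f g : ℝ → ℝ → ℝ → ℝ} {Ψ : PowerSeries (MvPolynomial (Fin 2) ℝ)}
    (hf : HasExpansion f Ψ) (h : ∀ τ x y, 1 ≤ τ → g τ x y = f τ x y) : HasExpansion g Ψ := fun M =>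
  (hf M).congr fun τ x y hτ _ _ => by rw [h τ x y hτ]

theorem HasExpansion.polyBdd {f : ℝ → ℝ → ℝ → ℝ} {Ψ : PowerSeries (MvPolynomial (Fin 2) ℝ)}
    (hf : HasExpansion f Ψ) : PolyBdd (Icc (-(1 / 2)) (1 / 2)) 0 f :=
  (hf 0).congr fun τ x y _ _ _ => by simp [truncEval]

theorem HasExpansion.mul {f g : ℝ → ℝ → ℝ → ℝ} {Ψ Φ : PowerSeries (MvPolynomial (Fin 2) ℝ)}
    (hf : HasExpansion f Ψ) (hg : HasExpansion g Φ) :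
    HasExpansion (fun τ x y => f τ x y * g τ x y) (Ψ * Φ) := fun M => by
  have h1 := (hf M).mul hg.polyBdd
  have h2 := (polyBdd_truncEval (Icc (-(1 / 2)) (1 / 2)) M Ψ).mul (hg M)
  rw [zero_add] at h2
  refine ((h1.add h2).add (polyBdd_truncEval_mul _ M Ψ Φ)).congr fun τ x y _ _ _ => ?_
  ring

theorem hasExpansion_evalSq (p : MvPolynomial (Fin 2) ℝ) :
    HasExpansion (evalSq p) (PowerSeries.C p) := by
  intro M
  rcases Nat.eq_zero_or_pos M with rfl | hM
  · exact (polyBdd_evalSq _ p).congr fun τ x y _ _ _ => by simp [truncEval]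
  · refine ⟨0, 0, le_rfl, fun τ x y _ _ _ => ?_⟩
    simp only [truncEval]
    rw [Finset.sum_eq_single 0]
    · simp
    · intro m _ hm; simp [PowerSeries.coeff_C, hm]
    · intro h; simp at h; omega

theorem hasExpansion_inv : HasExpansion (fun τ _ _ => τ⁻¹) PowerSeries.X := by
  intro M
  by_cases hM : M ≤ 1
  · refine ((polyBdd_inv_pow _ 1).mono (k' := M) subset_rfl hM).congr fun τ x y _ _ _ => ?_
    simp only [truncEval]
    rw [Finset.sum_eq_zero]
    · simp
    · intro m hm
      simp only [Finset.mem_range] at hm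
      simp [PowerSeries.coeff_X, show m ≠ 1 by omega]
  · refine ⟨0, 0, le_rfl, fun τ x y _ _ _ => ?_⟩
    simp only [truncEval]
    rw [Finset.sum_eq_single 1]
    · simp [evalSq]
    · intro m _ hm; simp [PowerSeries.coeff_X, hm]
    · intro h; simp at h; omega

theorem HasExpansion.pow {f : ℝ → ℝ → ℝ → ℝ} {Ψ : PowerSeries (MvPolynomial (Fin 2) ℝ)}
    (hf : HasExpansion f Ψ) (j : ℕ) : HasExpansion (fun τ x y => f τ x y ^ j) (Ψ ^ j) := by
  induction j with
  | zero => exact (hasExpansion_evalSq 1).congr fun τ x y _ => by simp [evalSq]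
  | succ j ih => simpa only [pow_succ] using ih.mul hf

theorem HasExpansion.sum {ι : Type*} (s : Finset ι) {f : ι → ℝ → ℝ → ℝ → ℝ}
    {Ψ : ι → PowerSeries (MvPolynomial (Fin 2) ℝ)} (h : ∀ i ∈ s, HasExpansion (f i) (Ψ i)) :
    HasExpansion (fun τ x y => ∑ i ∈ s, f i τ x y) (∑ i ∈ s, Ψ i) := by
  classical
  induction s using Finset.induction_on with
  | empty => exact fun M => ⟨0, 0, le_rfl, fun τ x y _ _ _ => by simp [truncEval, evalSq]⟩
  | insert a s ha ih =>
    simp only [Finset.sum_insert ha]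
    exact (h a (by simp)).add (ih fun i hi => h i (by simp [hi]))

/-- The expansion of `τ sin² (π x) / π²`, in one of the two variables. -/
noncomputable def sinSqSeries (i : Fin 2) : PowerSeries (MvPolynomial (Fin 2) ℝ) :=
  PowerSeries.mk fun j => MvPolynomial.C (sinSqCoeff j) * MvPolynomial.X i ^ (j + 1)

theorem hasExpansion_sinSq (i : Fin 2) :
    HasExpansion (fun τ x y => τ * sinSq (![x, y] i)) (sinSqSeries i) := by
  intro M
  obtain ⟨C, hC, h⟩ := sinSq_sub_sum_le M
  refine ⟨C, M + 1, hC, fun τ x y hτ hx hy => ?_⟩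
  beta_reduce
  have hz : |![x, y] i| ≤ 1 / 2 := by
    rw [abs_le]; fin_cases i
    · exact hx
    · exact hy
  have hw : τ * ![x, y] i ^ 2 ≤ 1 + τ * x ^ 2 + τ * y ^ 2 := by
    have h1 : 0 ≤ τ * x ^ 2 := by positivity
    have h2 : 0 ≤ τ * y ^ 2 := by positivity
    fin_cases i
    · simp only [Fin.zero_eta, Matrix.cons_val_zero]; linarith
    · simp only [Fin.mk_one, Matrix.cons_val_one, Matrix.cons_val_fin_one]; linarith
  have he : ![τ * x ^ 2, τ * y ^ 2] i = τ * ![x, y] i ^ 2 := by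
    fin_cases i <;> simp
  have hτ0 : τ ≠ 0 := by positivity
  generalize ![x, y] i = z at *
  have h1 : truncEval M (sinSqSeries i) τ x y =
      τ * ∑ j ∈ Finset.range M, sinSqCoeff j * z ^ (2 * j + 2) := by
    rw [truncEval, Finset.mul_sum]
    refine Finset.sum_congr rfl fun j _ => ?_
    simp only [sinSqSeries, PowerSeries.coeff_mk, map_mul, MvPolynomial.eval_C, map_pow,
      MvPolynomial.eval_X, he]
    rw [mul_pow, ← pow_mul, inv_pow]
    field_simp
    ring
  rw [h1, ← mul_sub, abs_mul, abs_of_nonneg (by positivity)]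
  calc τ * |_| ≤ τ * (C * z ^ (2 * M + 2)) := by gcongr; exact h z hz
    _ = C * τ⁻¹ ^ M * (τ * z ^ 2) ^ (M + 1) := by
        rw [mul_pow, ← pow_mul, inv_pow]; field_simp; ring
    _ ≤ _ := by gcongr

/-- The expansion of `τ * symb l x y`. -/
noncomputable def symbSeries (l : ℝ) : PowerSeries (MvPolynomial (Fin 2) ℝ) :=
  sinSqSeries 0 + sinSqSeries 1 +
    PowerSeries.C (MvPolynomial.C (-l)) * PowerSeries.X * sinSqSeries 0 * sinSqSeries 1

theorem hasExpansion_symb (l : ℝ) :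
    HasExpansion (fun τ x y => τ * symb l x y) (symbSeries l) := by
  refine (((hasExpansion_sinSq 0).add (hasExpansion_sinSq 1)).add
    ((((hasExpansion_evalSq (MvPolynomial.C (-l))).mul hasExpansion_inv).mul
      (hasExpansion_sinSq 0)).mul (hasExpansion_sinSq 1))).congr fun τ x y hτ => ?_
  have : τ ≠ 0 := by positivity
  simp only [symb, Matrix.cons_val_zero, Matrix.cons_val_one, evalSq, MvPolynomial.eval_C]
  field_simp
  ring

/-- The expansion of `τ * symb l x y - τ * (x² + y²)`; its constant term vanishes. -/
noncomputable def deltaSeries (l : ℝ) : PowerSeries (MvPolynomial (Fin 2) ℝ) :=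
  symbSeries l + PowerSeries.C (-(MvPolynomial.X 0 + MvPolynomial.X 1))

theorem hasExpansion_delta (l : ℝ) :
    HasExpansion (fun τ x y => τ * symb l x y - (τ * x ^ 2 + τ * y ^ 2)) (deltaSeries l) :=
  ((hasExpansion_symb l).add (hasExpansion_evalSq _)).congr fun τ x y _ => by
    simp [evalSq, sub_eq_add_neg]

theorem coeff_zero_symbSeries (l : ℝ) :
    PowerSeries.coeff 0 (symbSeries l) = MvPolynomial.X 0 + MvPolynomial.X 1 := by
  have : PowerSeries.coeff 0 (PowerSeries.C (MvPolynomial.C (-l)) * PowerSeries.X *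
      sinSqSeries 0 * sinSqSeries 1) = 0 := by
    rw [mul_assoc, mul_assoc, PowerSeries.coeff_C_mul, PowerSeries.coeff_zero_X_mul, mul_zero]
  rw [symbSeries, map_add, map_add, this]
  simp [sinSqSeries, sinSqCoeff_zero]

theorem coeff_one_symbSeries (l : ℝ) :
    PowerSeries.coeff 1 (symbSeries l) =
      MvPolynomial.C (-(Real.pi ^ 2 / 3)) * (MvPolynomial.X 0 ^ 2 + MvPolynomial.X 1 ^ 2) +
        MvPolynomial.C (-l) * (MvPolynomial.X 0 * MvPolynomial.X 1) := by
  have : PowerSeries.coeff 1 (PowerSeries.C (MvPolynomial.C (-l)) * PowerSeries.X *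
      sinSqSeries 0 * sinSqSeries 1) =
        MvPolynomial.C (-l) * (MvPolynomial.X 0 * MvPolynomial.X 1) := by
    rw [mul_assoc, mul_assoc, PowerSeries.coeff_C_mul, PowerSeries.coeff_succ_X_mul,
      PowerSeries.coeff_mul]
    simp [sinSqSeries, sinSqCoeff_zero]
  rw [symbSeries, map_add, map_add, this]
  simp only [sinSqSeries, PowerSeries.coeff_mk, sinSqCoeff_one]
  ring

theorem coeff_zero_deltaSeries (l : ℝ) : PowerSeries.coeff 0 (deltaSeries l) = 0 := by
  rw [deltaSeries, map_add, coeff_zero_symbSeries]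
  simp

theorem coeff_one_deltaSeries (l : ℝ) :
    PowerSeries.coeff 1 (deltaSeries l) = PowerSeries.coeff 1 (symbSeries l) := by
  rw [deltaSeries, map_add]
  simp

/-- The expansion of `exp (-(τ * symb l x y - τ * (x² + y²)))`. Only the first `m + 1` terms of the
exponential series contribute to the coefficient of order `m`. -/
noncomputable def expSeries (l : ℝ) : PowerSeries (MvPolynomial (Fin 2) ℝ) :=
  PowerSeries.mk fun m => PowerSeries.coeff m (∑ j ∈ Finset.range (m + 1),
    PowerSeries.C (MvPolynomial.C ((-1) ^ j / (j.factorial : ℝ))) * deltaSeries l ^ j)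

theorem coeff_deltaSeries_pow {l : ℝ} {m j : ℕ} (h : m < j) :
    PowerSeries.coeff m (deltaSeries l ^ j) = 0 := by
  obtain ⟨Φ, hΦ⟩ : PowerSeries.X ∣ deltaSeries l := by
    rw [PowerSeries.X_dvd_iff, ← PowerSeries.coeff_zero_eq_constantCoeff_apply,
      coeff_zero_deltaSeries]
  rw [hΦ, mul_pow, PowerSeries.coeff_X_pow_mul', if_neg (by omega)]

theorem coeff_expSeries (l : ℝ) {m M : ℕ} (h : m < M) :
    PowerSeries.coeff m (expSeries l) = PowerSeries.coeff m (∑ j ∈ Finset.range M,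
      PowerSeries.C (MvPolynomial.C ((-1) ^ j / (j.factorial : ℝ))) * deltaSeries l ^ j) := by
  rw [expSeries, PowerSeries.coeff_mk, map_sum, map_sum]
  refine Finset.sum_subset (by simpa using h) fun j _ hj => ?_
  rw [PowerSeries.coeff_C_mul, coeff_deltaSeries_pow (by simpa using hj), mul_zero]

theorem abs_exp_sub_sum_le (d : ℝ) (M : ℕ) :
    |Real.exp d - ∑ j ∈ Finset.range M, d ^ j / j.factorial| ≤
      (M + 3) * (|d| ^ M * max 1 (Real.exp d)) := by
  have hc : |Real.exp d - ∑ j ∈ Finset.range M, d ^ j / j.factorial| ≤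
      |d| ^ M * Real.exp |d| := by
    have := Complex.norm_exp_sub_sum_le_norm_mul_exp d M
    rw [Complex.norm_real] at this
    refine le_trans (le_of_eq ?_) this
    rw [← Real.norm_eq_abs, ← Complex.norm_real]
    push_cast
    rfl
  have hm : 1 ≤ max 1 (Real.exp d) := le_max_left _ _
  have hM : (0 : ℝ) ≤ M := Nat.cast_nonneg M
  have hd : 0 ≤ |d| ^ M := by positivity
  rcases le_total 0 d with h0 | h0
  · refine hc.trans ?_
    rw [abs_of_nonneg h0] at hd ⊢
    have : d ^ M * Real.exp d ≤ d ^ M * max 1 (Real.exp d) := by gcongr; exact le_max_right _ _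
    have h2 : 0 ≤ d ^ M * max 1 (Real.exp d) := by positivity
    nlinarith
  rcases le_total |d| 1 with h1 | h1
  · have he : Real.exp |d| ≤ 3 :=
      (Real.exp_le_exp.mpr h1).trans (Real.exp_one_lt_d9.le.trans (by norm_num))
    calc _ ≤ |d| ^ M * Real.exp |d| := hc
      _ ≤ |d| ^ M * 3 := by gcongr
      _ ≤ |d| ^ M * max 1 (Real.exp d) * 3 := by
          gcongr; exact le_mul_of_one_le_right hd hm
      _ ≤ _ := by
          have : 0 ≤ |d| ^ M * max 1 (Real.exp d) := by positivity
          nlinarith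
  · have h2 : |∑ j ∈ Finset.range M, d ^ j / j.factorial| ≤ M * |d| ^ M := by
      refine (Finset.abs_sum_le_sum_abs _ _).trans ?_
      rw [← nsmul_eq_mul]
      conv_rhs => rw [← Finset.card_range M]
      refine Finset.sum_le_card_nsmul _ _ _ fun j hj => ?_
      rw [abs_div, abs_pow, Nat.abs_cast]
      refine (div_le_self (by positivity) (by exact_mod_cast j.factorial_pos)).trans ?_
      exact pow_le_pow_right₀ h1 (by simpa using (Finset.mem_range.mp hj).le)
    have h3 : |Real.exp d| ≤ |d| ^ M := by
      rw [abs_of_pos (Real.exp_pos d)]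
      exact (Real.exp_le_one_iff.mpr h0).trans (one_le_pow₀ h1)
    calc _ ≤ |Real.exp d| + |∑ j ∈ Finset.range M, d ^ j / j.factorial| := abs_sub _ _
      _ ≤ |d| ^ M + M * |d| ^ M := add_le_add h3 h2
      _ = (M + 1) * (|d| ^ M * 1) := by ring
      _ ≤ (M + 3) * (|d| ^ M * max 1 (Real.exp d)) := by gcongr; norm_num

theorem PolyBdd.of_abs_le {r : Set ℝ} {k : ℕ} {f g : ℝ → ℝ → ℝ → ℝ} (hf : PolyBdd r k f) {c : ℝ}
    (hc : 0 ≤ c) (h : ∀ τ x y, 1 ≤ τ → x ∈ r → y ∈ r → |g τ x y| ≤ c * |f τ x y|) :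
    PolyBdd r k g := by
  obtain ⟨C, A, hC, hf⟩ := hf
  refine ⟨c * C, A, by positivity, fun τ x y hτ hx hy => (h τ x y hτ hx hy).trans ?_⟩
  rw [mul_assoc, mul_assoc, ← mul_assoc C]
  exact mul_le_mul_of_nonneg_left (hf τ x y hτ hx hy) hc

theorem PolyBdd.pow {r : Set ℝ} {k : ℕ} {f : ℝ → ℝ → ℝ → ℝ} (hf : PolyBdd r k f) (j : ℕ) :
    PolyBdd r (k * j) (fun τ x y => f τ x y ^ j) := by
  induction j with
  | zero => exact ⟨1, 0, zero_le_one, fun τ x y _ _ _ => by simp⟩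
  | succ j ih => simpa only [pow_succ, Nat.mul_succ] using ih.mul hf

theorem polyBdd_delta (l : ℝ) : PolyBdd (Icc (-(1 / 2)) (1 / 2)) 1
    (fun τ x y => τ * symb l x y - (τ * x ^ 2 + τ * y ^ 2)) :=
  (hasExpansion_delta l 1).congr fun τ x y _ _ _ => by
    simp only [truncEval, Finset.range_one, Finset.sum_singleton, coeff_zero_deltaSeries]
    simp [evalSq]

theorem exp_neg_symb_le {l τ x y : ℝ} (hl : l ≤ 2 * Real.pi ^ 2 / 3) (hτ : 1 ≤ τ)
    (hx : x ∈ Icc (-(1 / 2) : ℝ) (1 / 2)) (hy : y ∈ Icc (-(1 / 2) : ℝ) (1 / 2)) :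
    Real.exp ((τ * x ^ 2 + τ * y ^ 2) / 4) * Real.exp (-(τ * symb l x y)) ≤ 1 := by
  rw [← Real.exp_add, Real.exp_le_one_iff]
  have := symb_ge_normSq hl (abs_le.mpr hx) (abs_le.mpr hy)
  nlinarith

theorem exp_neg_weight_le {τ : ℝ} (x y : ℝ) (hτ : 1 ≤ τ) :
    Real.exp ((τ * x ^ 2 + τ * y ^ 2) / 4) * Real.exp (-(τ * x ^ 2 + τ * y ^ 2)) ≤ 1 := by
  rw [← Real.exp_add, Real.exp_le_one_iff]
  have : 0 ≤ τ * x ^ 2 + τ * y ^ 2 := by positivity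
  linarith

/-- The remainder of the expansion of `exp (-(τ * symb l x y))` keeps a Gaussian factor
`exp (-τ (x² + y²) / 4)`, because `symb l x y ≥ (x² + y²) / 4` on the square. -/
theorem polyBdd_exp_symb {l : ℝ} (hl : l ≤ 2 * Real.pi ^ 2 / 3) (M : ℕ) :
    PolyBdd (Icc (-(1 / 2)) (1 / 2)) M fun τ x y =>
      Real.exp ((τ * x ^ 2 + τ * y ^ 2) / 4) * (Real.exp (-(τ * symb l x y)) -
        Real.exp (-(τ * x ^ 2 + τ * y ^ 2)) * truncEval M (expSeries l) τ x y) := by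
  have h1 := (polyBdd_delta l).pow M
  rw [one_mul] at h1
  have h2 : HasExpansion (fun τ x y => ∑ j ∈ Finset.range M, (-1) ^ j / (j.factorial : ℝ) *
        (τ * symb l x y - (τ * x ^ 2 + τ * y ^ 2)) ^ j)
      (∑ j ∈ Finset.range M,
        PowerSeries.C (MvPolynomial.C ((-1) ^ j / (j.factorial : ℝ))) * deltaSeries l ^ j) :=
    HasExpansion.sum _ fun j _ =>
      ((hasExpansion_evalSq (MvPolynomial.C ((-1) ^ j / (j.factorial : ℝ)))).mul
        ((hasExpansion_delta l).pow j)).congr fun τ x y _ => by simp [evalSq]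
  have h3 : PolyBdd (Icc (-(1 / 2)) (1 / 2)) M fun τ x y =>
      ∑ j ∈ Finset.range M, (-1) ^ j / (j.factorial : ℝ) *
        (τ * symb l x y - (τ * x ^ 2 + τ * y ^ 2)) ^ j - truncEval M (expSeries l) τ x y := by
    refine (h2 M).congr fun τ x y _ _ _ => ?_
    congr 1
    refine Finset.sum_congr rfl fun m hm => ?_
    rw [coeff_expSeries l (Finset.mem_range.mp hm)]
  have h4 : PolyBdd (Icc (-(1 / 2)) (1 / 2)) M fun τ x y =>
      Real.exp ((τ * x ^ 2 + τ * y ^ 2) / 4) * (Real.exp (-(τ * symb l x y)) -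
        Real.exp (-(τ * x ^ 2 + τ * y ^ 2)) * ∑ j ∈ Finset.range M, (-1) ^ j / (j.factorial : ℝ) *
          (τ * symb l x y - (τ * x ^ 2 + τ * y ^ 2)) ^ j) := by
    refine h1.of_abs_le (c := M + 3) (by positivity) fun τ x y hτ hx hy => ?_
    have e1 := exp_neg_symb_le hl hτ hx hy
    have e2 := exp_neg_weight_le x y hτ
    set w := τ * x ^ 2 + τ * y ^ 2
    set d := -(τ * symb l x y - w)
    have h5 := abs_exp_sub_sum_le d M
    have h6 : Real.exp (-(τ * symb l x y)) = Real.exp (-w) * Real.exp d := by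
      rw [← Real.exp_add]; congr 1; ring
    have h7 : ∑ j ∈ Finset.range M, (-1) ^ j / (j.factorial : ℝ) * (τ * symb l x y - w) ^ j =
        ∑ j ∈ Finset.range M, d ^ j / j.factorial := by
      refine Finset.sum_congr rfl fun j _ => ?_
      rw [show d = (-1) * (τ * symb l x y - w) by ring, mul_pow]; ring
    rw [h6] at e1 ⊢
    rw [h7, ← mul_sub, ← mul_assoc, abs_mul, abs_of_nonneg (by positivity)]
    have h8 : Real.exp (w / 4) * Real.exp (-w) * max 1 (Real.exp d) ≤ 1 := by
      rw [mul_max_of_nonneg _ _ (by positivity), mul_one, mul_assoc]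
      exact max_le e2 e1
    rw [abs_pow, show |τ * symb l x y - w| = |d| from (abs_neg _).symm]
    calc Real.exp (w / 4) * Real.exp (-w) * |_|
        ≤ Real.exp (w / 4) * Real.exp (-w) * ((M + 3) * (|d| ^ M * max 1 (Real.exp d))) := by
          gcongr
      _ = (M + 3) * |d| ^ M * (Real.exp (w / 4) * Real.exp (-w) * max 1 (Real.exp d)) := by ring
      _ ≤ (M + 3) * |d| ^ M * 1 := by gcongr
      _ = _ := mul_one _
  have h5 : PolyBdd (Icc (-(1 / 2)) (1 / 2)) M fun τ x y =>
      Real.exp ((τ * x ^ 2 + τ * y ^ 2) / 4) * Real.exp (-(τ * x ^ 2 + τ * y ^ 2)) *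
        (∑ j ∈ Finset.range M, (-1) ^ j / (j.factorial : ℝ) *
          (τ * symb l x y - (τ * x ^ 2 + τ * y ^ 2)) ^ j - truncEval M (expSeries l) τ x y) := by
    refine h3.of_abs_le zero_le_one fun τ x y hτ _ _ => ?_
    rw [abs_mul, abs_of_nonneg (by positivity)]
    gcongr
    exact exp_neg_weight_le x y hτ
  refine (h4.add h5).congr fun τ x y _ _ _ => ?_
  ring

/-- The expansion of `exp (τ (x² + y²)) * (τ * symb l x y) * exp (-(τ * symb l x y))`. -/
noncomputable def profileSeries (l : ℝ) : PowerSeries (MvPolynomial (Fin 2) ℝ) :=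
  symbSeries l * expSeries l

/-- The weight function `v * exp (-v)`, which vanishes at `v = 0`. Its Mellin transform at `s` is
`Γ(s + 1)`. -/
noncomputable def profile (v : ℝ) : ℝ := v * Real.exp (-v)

theorem polyBdd_profile_symb {l : ℝ} (hl : l ≤ 2 * Real.pi ^ 2 / 3) (M : ℕ) :
    PolyBdd (Icc (-(1 / 2)) (1 / 2)) M fun τ x y =>
      Real.exp ((τ * x ^ 2 + τ * y ^ 2) / 4) * (profile (τ * symb l x y) -
        Real.exp (-(τ * x ^ 2 + τ * y ^ 2)) * truncEval M (profileSeries l) τ x y) := by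
  have h1 : PolyBdd (Icc (-(1 / 2)) (1 / 2)) M fun τ x y =>
      (τ * symb l x y - truncEval M (symbSeries l) τ x y) *
        (Real.exp ((τ * x ^ 2 + τ * y ^ 2) / 4) * Real.exp (-(τ * symb l x y))) := by
    refine (hasExpansion_symb l M).of_abs_le zero_le_one fun τ x y hτ hx hy => ?_
    rw [abs_mul, mul_comm, abs_of_nonneg (a := _ * _) (by positivity)]
    gcongr
    exact exp_neg_symb_le hl hτ hx hy
  have h2 := (polyBdd_truncEval (Icc (-(1 / 2)) (1 / 2)) M (symbSeries l)).mul
    (polyBdd_exp_symb hl M)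
  rw [zero_add] at h2
  have h3 : PolyBdd (Icc (-(1 / 2)) (1 / 2)) M fun τ x y =>
      Real.exp ((τ * x ^ 2 + τ * y ^ 2) / 4) * Real.exp (-(τ * x ^ 2 + τ * y ^ 2)) *
        (truncEval M (symbSeries l) τ x y * truncEval M (expSeries l) τ x y -
          truncEval M (symbSeries l * expSeries l) τ x y) := by
    refine (polyBdd_truncEval_mul _ M (symbSeries l) (expSeries l)).of_abs_le zero_le_one
      fun τ x y hτ hx hy => ?_
    rw [abs_mul, abs_of_nonneg (by positivity)]
    gcongr
    exact exp_neg_weight_le x y hτ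
  refine ((h1.add h2).add h3).congr fun τ x y _ _ _ => ?_
  simp only [profile, profileSeries]
  ring

theorem pow_mul_exp_neg_le (A : ℕ) : ∃ C, 0 ≤ C ∧ ∀ w : ℝ, 0 ≤ w →
    (1 + w) ^ A * Real.exp (-(w / 4)) ≤ C * Real.exp (-(w / 8)) := by
  refine ⟨8 ^ A * A.factorial * Real.exp (1 / 8), by positivity, fun w hw => ?_⟩
  have h := Real.pow_div_factorial_le_exp (x := (1 + w) / 8) (by positivity) A
  rw [div_pow, div_div, div_le_iff₀ (by positivity)] at h
  calc (1 + w) ^ A * Real.exp (-(w / 4))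
      ≤ Real.exp ((1 + w) / 8) * (8 ^ A * A.factorial) * Real.exp (-(w / 4)) := by gcongr
    _ = 8 ^ A * A.factorial * (Real.exp ((1 + w) / 8) * Real.exp (-(w / 4))) := by ring
    _ = 8 ^ A * A.factorial * (Real.exp (1 / 8) * Real.exp (-(w / 8))) := by
        rw [← Real.exp_add, ← Real.exp_add]; congr 2; ring
    _ = _ := by ring

/-- The fundamental square of the torus, centred at the zero of the symbol. -/
def square : Set (ℝ × ℝ) := Ioc (-(1 / 2)) (1 / 2) ×ˢ Ioc (-(1 / 2)) (1 / 2)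

/-- The profile of the symbol, cut off to the fundamental square, has an asymptotic expansion as
`τ → ∞` which is uniform on the whole plane: outside the square the expansion is negligible, since
there `τ (x² + y²) ≥ τ / 4`. -/
theorem profile_symb_expansion {l : ℝ} (hl : l ≤ 2 * Real.pi ^ 2 / 3) (M : ℕ) :
    ∃ C, 0 ≤ C ∧ ∀ τ x y : ℝ, 1 ≤ τ →
      |square.indicator (fun p => profile (τ * symb l p.1 p.2)) (x, y) -
        Real.exp (-(τ * x ^ 2 + τ * y ^ 2)) * truncEval M (profileSeries l) τ x y| ≤
      C * τ⁻¹ ^ M * Real.exp (-((τ * x ^ 2 + τ * y ^ 2) / 8)) := by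
  obtain ⟨C₁, A₁, hC₁, h₁⟩ := polyBdd_profile_symb hl M
  obtain ⟨C₂, A₂, hC₂, h₂⟩ := polyBdd_truncEval univ M (profileSeries l)
  obtain ⟨D₁, hD₁, hd₁⟩ := pow_mul_exp_neg_le A₁
  obtain ⟨D₂, hD₂, hd₂⟩ := pow_mul_exp_neg_le (A₂ + M)
  refine ⟨C₁ * D₁ + C₂ * 4 ^ M * D₂, by positivity, fun τ x y hτ => ?_⟩
  have hx0 : 0 ≤ τ * x ^ 2 := by positivity
  have hy0 : 0 ≤ τ * y ^ 2 := by positivity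
  by_cases hp : (x, y) ∈ square
  · rw [indicator_of_mem hp]
    have h := h₁ τ x y hτ (Ioc_subset_Icc_self hp.1) (Ioc_subset_Icc_self hp.2)
    have hd := hd₁ (τ * x ^ 2 + τ * y ^ 2) (by positivity)
    rw [← add_assoc] at hd
    rw [abs_mul, abs_of_pos (Real.exp_pos _)] at h
    set w := τ * x ^ 2 + τ * y ^ 2
    set E := |profile (τ * symb l x y) - Real.exp (-w) * truncEval M (profileSeries l) τ x y|
    have : E = Real.exp (w / 4) * E * Real.exp (-(w / 4)) := by
      rw [mul_right_comm, ← Real.exp_add]; simp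
    change E ≤ _
    rw [this]
    calc _ ≤ C₁ * τ⁻¹ ^ M * (1 + τ * x ^ 2 + τ * y ^ 2) ^ A₁ * Real.exp (-(w / 4)) := by gcongr
      _ = C₁ * τ⁻¹ ^ M * ((1 + τ * x ^ 2 + τ * y ^ 2) ^ A₁ * Real.exp (-(w / 4))) := by ring
      _ ≤ C₁ * τ⁻¹ ^ M * (D₁ * Real.exp (-(w / 8))) := by gcongr
      _ = C₁ * D₁ * τ⁻¹ ^ M * Real.exp (-(w / 8)) := by ring
      _ ≤ _ := by gcongr; exact le_add_of_nonneg_right (by positivity)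
  · rw [indicator_of_notMem hp, zero_sub, abs_neg, abs_mul, abs_of_pos (Real.exp_pos _)]
    have h := h₂ τ x y hτ (mem_univ _) (mem_univ _)
    have hd := hd₂ (τ * x ^ 2 + τ * y ^ 2) (by positivity)
    rw [← add_assoc] at hd
    have hxy : 1 / 4 ≤ x ^ 2 + y ^ 2 := by
      by_contra! hlt
      refine hp ⟨⟨?_, ?_⟩, ⟨?_, ?_⟩⟩ <;> nlinarith [sq_nonneg x, sq_nonneg y]
    have hwt : 1 ≤ 4 * τ⁻¹ * (1 + τ * x ^ 2 + τ * y ^ 2) := by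
      rw [mul_assoc, inv_mul_eq_div, mul_div_assoc', le_div_iff₀ (by positivity)]
      nlinarith
    have hM : 1 ≤ 4 ^ M * τ⁻¹ ^ M * (1 + τ * x ^ 2 + τ * y ^ 2) ^ M := by
      rw [← mul_pow, ← mul_pow]; exact one_le_pow₀ hwt
    set w := τ * x ^ 2 + τ * y ^ 2
    have hT : |truncEval M (profileSeries l) τ x y| ≤
        C₂ * 4 ^ M * τ⁻¹ ^ M * (1 + τ * x ^ 2 + τ * y ^ 2) ^ (A₂ + M) := by
      refine h.trans ?_
      rw [pow_zero, mul_one]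
      have hw1 := one_le_weight x y hτ
      calc _ ≤ C₂ * (1 + τ * x ^ 2 + τ * y ^ 2) ^ A₂ *
            (4 ^ M * τ⁻¹ ^ M * (1 + τ * x ^ 2 + τ * y ^ 2) ^ M) :=
          le_mul_of_one_le_right (by positivity) hM
        _ = _ := by rw [pow_add]; ring
    have he : Real.exp (-w) ≤ Real.exp (-(w / 4)) := by
      apply Real.exp_le_exp.mpr
      have : 0 ≤ w := by positivity
      linarith
    calc _ ≤ Real.exp (-(w / 4)) *
          (C₂ * 4 ^ M * τ⁻¹ ^ M * (1 + τ * x ^ 2 + τ * y ^ 2) ^ (A₂ + M)) := by gcongr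
      _ = C₂ * 4 ^ M * τ⁻¹ ^ M *
          ((1 + τ * x ^ 2 + τ * y ^ 2) ^ (A₂ + M) * Real.exp (-(w / 4))) := by ring
      _ ≤ C₂ * 4 ^ M * τ⁻¹ ^ M * (D₂ * Real.exp (-(w / 8))) := by gcongr
      _ = C₂ * 4 ^ M * D₂ * τ⁻¹ ^ M * Real.exp (-(w / 8)) := by ring
      _ ≤ _ := by gcongr; exact le_add_of_nonneg_left (by positivity)

theorem coeff_zero_profileSeries (l : ℝ) :
    PowerSeries.coeff 0 (profileSeries l) = MvPolynomial.X 0 + MvPolynomial.X 1 := by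
  have h : PowerSeries.coeff 0 (expSeries l) = 1 := by
    rw [coeff_expSeries l zero_lt_one]; simp
  rw [profileSeries, PowerSeries.coeff_mul, Finset.Nat.sum_antidiagonal_eq_sum_range_succ_mk]
  simp only [Finset.sum_range_succ, Finset.sum_range_zero, h, coeff_zero_symbSeries, mul_one,
    zero_add, Nat.sub_self]

theorem coeff_one_profileSeries (l : ℝ) :
    PowerSeries.coeff 1 (profileSeries l) =
      (1 - (MvPolynomial.X 0 + MvPolynomial.X 1)) * PowerSeries.coeff 1 (symbSeries l) := by
  have h0 : PowerSeries.coeff 0 (expSeries l) = 1 := by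
    rw [coeff_expSeries l zero_lt_one]; simp
  have h1 : PowerSeries.coeff 1 (expSeries l) = -PowerSeries.coeff 1 (symbSeries l) := by
    rw [coeff_expSeries l (show 1 < 1 + 1 by norm_num), Finset.sum_range_succ _ 1, Finset.sum_range_one, map_add,
      PowerSeries.coeff_C_mul, PowerSeries.coeff_C_mul, pow_one (deltaSeries l), coeff_one_deltaSeries]
    simp [PowerSeries.coeff_one]
  rw [profileSeries, PowerSeries.coeff_mul, Finset.Nat.sum_antidiagonal_eq_sum_range_succ_mk]
  simp only [Finset.sum_range_succ, Finset.sum_range_zero, h0, h1, coeff_zero_symbSeries,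
    zero_add, Nat.sub_self, Nat.sub_zero]
  ring

theorem constantCoeff_coeff_profileSeries (l : ℝ) (m : ℕ) :
    MvPolynomial.constantCoeff (PowerSeries.coeff m (profileSeries l)) = 0 := by
  have h (i : Fin 2) : PowerSeries.map MvPolynomial.constantCoeff (sinSqSeries i) = 0 := by
    ext j; simp [sinSqSeries]
  have h2 : PowerSeries.map MvPolynomial.constantCoeff (profileSeries l) = 0 := by
    simp [profileSeries, symbSeries, h]
  rw [← PowerSeries.coeff_map, h2, map_zero]

/-! ### Theta series with monomial weights -/

/-- The theta series `∑ k ∈ ℤ, k ^ (2 a) * exp (-u k²)`. -/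
noncomputable def theta (a : ℕ) (u : ℝ) : ℝ :=
  ∑' k : ℤ, (k : ℝ) ^ (2 * a) * Real.exp (-(u * (k : ℝ) ^ 2))

/-- The Gaussian moment `∫ x ^ (2 a) * exp (-x²) = Γ(a + 1/2)`. -/
noncomputable def gaussMoment (a : ℕ) : ℝ := Real.Gamma (a + 1 / 2)

theorem summable_theta (a : ℕ) {u : ℝ} (hu : 0 < u) :
    Summable fun k : ℤ => (k : ℝ) ^ (2 * a) * Real.exp (-(u * (k : ℝ) ^ 2)) := by
  have h := summable_pow_mul_jacobiTheta₂_term_bound 0 (T := u / Real.pi) (by positivity) (2 * a)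
  refine h.congr fun k => ?_
  rw [pow_mul, Int.cast_abs, sq_abs, ← pow_mul]
  congr 2
  field_simp
  ring

theorem hasDerivAt_theta (a : ℕ) {u : ℝ} (hu : 0 < u) :
    HasDerivAt (theta a) (-theta (a + 1) u) u := by
  have h := hasDerivAt_tsum_of_isPreconnected (t := Ioi (u / 2)) (y := u) (y₀ := u)
    (g := fun (k : ℤ) (y : ℝ) => (k : ℝ) ^ (2 * a) * Real.exp (-(y * (k : ℝ) ^ 2)))
    (g' := fun (k : ℤ) (y : ℝ) => -((k : ℝ) ^ (2 * (a + 1)) * Real.exp (-(y * (k : ℝ) ^ 2))))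
    (summable_theta (a + 1) (half_pos hu)) isOpen_Ioi isPreconnected_Ioi ?_ ?_
    (half_lt_self hu) (summable_theta a hu) (half_lt_self hu)
  · rw [theta, ← tsum_neg]; exact h
  · intro k y _
    have h1 : HasDerivAt (fun y : ℝ => -(y * (k : ℝ) ^ 2)) (-(1 * (k : ℝ) ^ 2)) y :=
      ((hasDerivAt_id y).mul_const _).neg
    refine (h1.exp.const_mul _).congr_deriv ?_
    ring
  · intro k y hy
    have hk : (0 : ℝ) ≤ (k : ℝ) ^ (2 * (a + 1)) := by rw [pow_mul]; positivity
    rw [norm_neg, Real.norm_of_nonneg (by positivity)]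
    have : u / 2 ≤ y := le_of_lt hy
    gcongr

theorem theta_nonneg (a : ℕ) (u : ℝ) : 0 ≤ theta a u :=
  tsum_nonneg fun k => mul_nonneg (by rw [pow_mul]; positivity) (Real.exp_pos _).le

theorem gaussMoment_succ (a : ℕ) : gaussMoment (a + 1) = (a + 1 / 2) * gaussMoment a := by
  unfold gaussMoment
  rw [← Real.Gamma_add_one (by positivity)]
  congr 1; push_cast; ring

theorem gaussMoment_zero : gaussMoment 0 = √Real.pi := by
  rw [gaussMoment, Nat.cast_zero, zero_add, Real.Gamma_one_half_eq]

/-- The difference between the theta series and the corresponding Gaussian integral. -/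
noncomputable def thetaRem (a : ℕ) (u : ℝ) : ℝ :=
  theta a u - gaussMoment a * u ^ (-(a + 1 / 2) : ℝ)

theorem hasDerivAt_thetaRem (a : ℕ) {u : ℝ} (hu : 0 < u) :
    HasDerivAt (thetaRem a) (-thetaRem (a + 1) u) u := by
  refine ((hasDerivAt_theta a hu).sub
    ((Real.hasDerivAt_rpow_const (p := (-(a + 1 / 2) : ℝ)) (Or.inl hu.ne')).const_mul
      (gaussMoment a))).congr_deriv ?_
  rw [thetaRem, gaussMoment_succ]
  push_cast
  rw [show (-(a + 1 + 1 / 2) : ℝ) = -(a + 1 / 2) - 1 by ring]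
  ring

/-- A function which vanishes to infinite order at `0` from the right. -/
def Flat (f : ℝ → ℝ) : Prop := ∀ K : ℕ, f =O[𝓝[>] 0] fun u => u ^ K

/-- The inversion formula of the theta function. -/
theorem flat_thetaRem_zero : Flat (thetaRem 0) := by
  obtain ⟨p, hp, h⟩ := HurwitzZeta.isBigO_atTop_evenKernel_sub 0
  simp only [if_true] at h
  have hlim : Tendsto (fun u : ℝ => Real.pi / u) (𝓝[>] 0) atTop := by
    simpa only [div_eq_mul_inv] using tendsto_inv_nhdsGT_zero.const_mul_atTop Real.pi_pos
  intro K
  have h1 : (fun t : ℝ => HurwitzZeta.evenKernel 0 t - 1) =O[atTop]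
      fun t : ℝ => t ^ (-(K + 1 : ℝ)) :=
    h.trans (isLittleO_exp_neg_mul_rpow_atTop hp _).isBigO
  have h2 := h1.comp_tendsto hlim
  have h3 : (fun u : ℝ => (Real.pi / u) ^ (1 / 2 : ℝ)) =O[𝓝[>] 0] fun u : ℝ => (u⁻¹ : ℝ) := by
    refine IsBigO.of_bound (Real.pi ^ (1 / 2 : ℝ)) ?_
    filter_upwards [Ioo_mem_nhdsGT (zero_lt_one' ℝ)] with u hu
    have hu0 : 0 < u := hu.1
    rw [Real.norm_of_nonneg (by positivity), Real.norm_of_nonneg (by positivity),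
      Real.div_rpow Real.pi_pos.le hu0.le, div_eq_mul_inv, ← Real.rpow_neg hu0.le,
      ← Real.rpow_neg_one]
    gcongr ?_ * ?_
    exact Real.rpow_le_rpow_of_exponent_ge hu0 hu.2.le (by norm_num)
  refine ((h3.mul h2).congr' ?_ ?_).trans
    (isBigO_const_mul_self (Real.pi ^ (-(K + 1 : ℝ))) (fun u : ℝ => u ^ K) _)
  · filter_upwards [self_mem_nhdsWithin] with u (hu : 0 < u)
    have e1 : theta 0 u = HurwitzZeta.evenKernel 0 (u / Real.pi) := by
      have := HurwitzZeta.hasSum_int_evenKernel 0 (t := u / Real.pi) (by positivity)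
      rw [show ((0 : ℝ) : UnitAddCircle) = 0 from rfl] at this
      rw [theta, ← this.tsum_eq]
      refine tsum_congr fun k => ?_
      have := Real.pi_ne_zero
      simp only [mul_zero, pow_zero, one_mul, add_zero]
      congr 1; field_simp
    rw [thetaRem, e1, HurwitzZeta.evenKernel_functional_equation,
      ← HurwitzZeta.evenKernel_eq_cosKernel_of_zero, one_div_div, gaussMoment_zero]
    simp only [Function.comp_apply]
    have e2 : 1 / (u / Real.pi) ^ (1 / 2 : ℝ) = (Real.pi / u) ^ (1 / 2 : ℝ) := by
      rw [one_div, ← Real.inv_rpow (by positivity), inv_div]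
    have e3 : √Real.pi * u ^ (-(((0 : ℕ) : ℝ) + 1 / 2)) = (Real.pi / u) ^ (1 / 2 : ℝ) := by
      rw [Real.div_rpow Real.pi_pos.le hu.le, Real.sqrt_eq_rpow, div_eq_mul_inv _ (u ^ _),
        ← Real.rpow_neg hu.le]
      norm_num
    rw [e2, e3]; ring
  · filter_upwards [self_mem_nhdsWithin] with u (hu : 0 < u)
    simp only [Function.comp_apply]
    rw [Real.div_rpow Real.pi_pos.le hu.le, Real.rpow_neg hu.le, ← Nat.cast_succ,
      Real.rpow_natCast, pow_succ]
    field_simp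

theorem theta_succ_isBigO_zero (a : ℕ) :
    theta (a + 1) =O[𝓝[>] 0] fun u => (u ^ (a + 2))⁻¹ := by
  have hs : Summable fun k : ℤ => 1 / (k : ℝ) ^ 2 := Real.summable_one_div_int_pow.mpr one_lt_two
  refine IsBigO.of_bound ((a + 2).factorial * ∑' k : ℤ, 1 / (k : ℝ) ^ 2) ?_
  filter_upwards [self_mem_nhdsWithin] with u (hu : 0 < u)
  rw [mul_comm, ← mul_assoc, ← tsum_mul_left]
  refine tsum_of_norm_bounded (hs.mul_left _).hasSum fun k => ?_
  have hk : (0 : ℝ) ≤ (k : ℝ) ^ (2 * (a + 1)) := by rw [pow_mul]; positivity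
  rw [Real.norm_of_nonneg (by positivity), Real.norm_of_nonneg (by positivity)]
  rcases eq_or_ne k 0 with rfl | hk0
  · simp
  have hk1 : (k : ℝ) ≠ 0 := by exact_mod_cast hk0
  have h := Real.pow_div_factorial_le_exp (x := u * (k : ℝ) ^ 2) (by positivity) (a + 2)
  rw [Real.exp_neg]
  rw [div_le_iff₀ (by positivity)] at h
  rw [← div_eq_mul_inv, div_le_iff₀ (Real.exp_pos _)]
  calc (k : ℝ) ^ (2 * (a + 1)) = (u ^ (a + 2))⁻¹ * (1 / (k : ℝ) ^ 2) * (u * (k : ℝ) ^ 2) ^ (a + 2) := by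
        rw [mul_pow, ← pow_mul]; field_simp; ring
    _ ≤ (u ^ (a + 2))⁻¹ * (1 / (k : ℝ) ^ 2) *
        (Real.exp (u * (k : ℝ) ^ 2) * (a + 2).factorial) := by gcongr
    _ = _ := by ring

theorem thetaRem_succ_isBigO_zero (a : ℕ) :
    thetaRem (a + 1) =O[𝓝[>] 0] fun u => (u ^ (a + 2))⁻¹ := by
  refine (theta_succ_isBigO_zero a).sub ?_
  refine (isBigO_const_mul_self _ _ _).trans ?_
  refine IsBigO.of_bound 1 ?_
  filter_upwards [Ioo_mem_nhdsGT (zero_lt_one' ℝ)] with u hu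
  have hu0 : 0 < u := hu.1
  rw [one_mul, Real.norm_of_nonneg (by positivity), Real.norm_of_nonneg (by positivity),
    ← Real.rpow_natCast, ← Real.rpow_neg hu0.le]
  refine Real.rpow_le_rpow_of_exponent_ge hu0 hu.2.le ?_
  push_cast; linarith

/-- Landau interpolation: if `f` is flat at `0` and `f''` grows at most polynomially, then `f'` is
flat at `0`. -/
theorem Flat.deriv {f f' f'' : ℝ → ℝ} {B : ℕ} (hf : Flat f)
    (h1 : ∀ u, 0 < u → HasDerivAt f (f' u) u) (h2 : ∀ u, 0 < u → HasDerivAt f' (f'' u) u)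
    (hB : f'' =O[𝓝[>] 0] fun u => (u ^ B)⁻¹) : Flat f' := by
  intro K
  obtain ⟨C₁, hC₁, b1⟩ := (hf (2 * K + B + 1)).exists_pos
  obtain ⟨C₂, hC₂, b2⟩ := hB.exists_pos
  rw [IsBigOWith_def] at b1 b2
  obtain ⟨δ₁, hδ₁, b1⟩ := mem_nhdsGT_iff_exists_Ioo_subset.mp b1
  obtain ⟨δ₂, hδ₂, b2⟩ := mem_nhdsGT_iff_exists_Ioo_subset.mp b2
  have hδ₁ : 0 < δ₁ := hδ₁
  have hδ₂ : 0 < δ₂ := hδ₂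
  refine IsBigO.of_bound (C₁ * 2 ^ (2 * K + B + 1) + C₁ + C₂) ?_
  filter_upwards [Ioo_mem_nhdsGT (show 0 < min 1 (min (δ₁ / 2) (δ₂ / 2)) by positivity)] with u hu
  obtain ⟨hu0, hu1⟩ := hu
  simp only [lt_min_iff] at hu1
  obtain ⟨hu1, hu2, hu3⟩ := hu1
  -- the step of the difference quotient is small enough for `η * u ^ (-B) ≤ u ^ K`, while
  -- `f / η` is still of order `u ^ K`
  set η := u ^ (K + B + 1) with hη
  have hη0 : 0 < η := by positivity
  have hηu : η ≤ u := by
    calc η ≤ u ^ 1 := pow_le_pow_of_le_one hu0.le hu1.le (by omega)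
      _ = u := pow_one u
  obtain ⟨ξ, hξ, e1⟩ := exists_hasDerivAt_eq_slope f f' (show u < u + η by linarith)
    (fun x hx => (h1 x (by linarith [hx.1])).continuousAt.continuousWithinAt)
    (fun x hx => h1 x (by linarith [hx.1]))
  obtain ⟨ξ', hξ', e2⟩ := exists_hasDerivAt_eq_slope f' f'' hξ.1
    (fun x hx => (h2 x (by linarith [hx.1])).continuousAt.continuousWithinAt)
    (fun x hx => h2 x (by linarith [hx.1]))
  have hb2 : ‖f'' ξ'‖ ≤ C₂ * ‖(ξ' ^ B)⁻¹‖ :=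
    b2 (show ξ' ∈ Ioo 0 δ₂ from ⟨by linarith [hξ'.1], by linarith [hξ'.2, hξ.2]⟩)
  have hb1 : ‖f u‖ ≤ C₁ * ‖u ^ (2 * K + B + 1)‖ :=
    b1 (show u ∈ Ioo 0 δ₁ from ⟨hu0, by linarith⟩)
  have hb1' : ‖f (u + η)‖ ≤ C₁ * ‖(u + η) ^ (2 * K + B + 1)‖ :=
    b1 (show u + η ∈ Ioo 0 δ₁ from ⟨by linarith, by linarith⟩)
  rw [Real.norm_eq_abs, Real.norm_of_nonneg (by positivity)] at hb1 hb1'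
  have hξ0 : 0 < ξ' := by linarith [hξ'.1]
  rw [Real.norm_eq_abs, Real.norm_of_nonneg (by positivity)] at hb2
  have hb2' : |f'' ξ'| ≤ C₂ * (u ^ B)⁻¹ := by
    refine hb2.trans ?_
    have := hξ'.1.le
    gcongr
  have hb1'' : |f (u + η)| ≤ C₁ * (2 ^ (2 * K + B + 1) * u ^ (2 * K + B + 1)) := by
    refine hb1'.trans ?_
    rw [← mul_pow]
    gcongr
    linarith
  have e3 : f' u = (f (u + η) - f u) / η - f'' ξ' * (ξ - u) := by
    rw [e2, div_mul_cancel₀ _ (by linarith [hξ.1]), e1, add_sub_cancel_left]; ring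
  have hup : u ^ (2 * K + B + 1) = u ^ K * η := by rw [hη, ← pow_add]; congr 1; ring
  have hub : (u ^ B)⁻¹ * η ≤ u ^ K := by
    rw [hη, inv_mul_le_iff₀ (by positivity), ← pow_add]
    exact pow_le_pow_of_le_one hu0.le hu1.le (by omega)
  rw [Real.norm_eq_abs, Real.norm_eq_abs, abs_of_nonneg (show 0 ≤ u ^ K by positivity), e3]
  calc |(f (u + η) - f u) / η - f'' ξ' * (ξ - u)|
      ≤ |(f (u + η) - f u) / η| + |f'' ξ' * (ξ - u)| := abs_sub _ _
    _ ≤ (C₁ * 2 ^ (2 * K + B + 1) + C₁) * u ^ K + C₂ * u ^ K := by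
        refine add_le_add ?_ ?_
        · rw [abs_div, abs_of_pos hη0, div_le_iff₀ hη0]
          refine (abs_sub _ _).trans ((add_le_add hb1'' hb1).trans_eq ?_)
          rw [hup]; ring
        · rw [abs_mul, abs_of_pos (by linarith [hξ.1] : 0 < ξ - u)]
          calc |f'' ξ'| * (ξ - u) ≤ C₂ * (u ^ B)⁻¹ * η := by
                have := hξ.1.le
                gcongr
                linarith [hξ.2]
            _ = C₂ * ((u ^ B)⁻¹ * η) := by ring
            _ ≤ _ := by gcongr
    _ = _ := by ring

theorem flat_thetaRem (a : ℕ) : Flat (thetaRem a) := by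
  induction a with
  | zero => exact flat_thetaRem_zero
  | succ a ih =>
    have h : Flat (fun u => -thetaRem (a + 1) u) := by
      refine Flat.deriv (f'' := fun u => thetaRem (a + 2) u) (B := a + 3) ih
        (fun u hu => hasDerivAt_thetaRem a hu) (fun u hu => ?_) (thetaRem_succ_isBigO_zero (a + 1))
      exact (hasDerivAt_thetaRem (a + 1) hu).neg.congr_deriv (neg_neg _)
    intro K
    simpa using (h K).neg_left

theorem theta_isBigO_zero (a : ℕ) : theta a =O[𝓝[>] 0] fun u => (u ^ (a + 1))⁻¹ := by
  have h0 : thetaRem a =O[𝓝[>] 0] fun u => (u ^ (a + 1))⁻¹ := by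
    refine (flat_thetaRem a 0).trans (IsBigO.of_bound 1 ?_)
    filter_upwards [Ioo_mem_nhdsGT (zero_lt_one' ℝ)] with u hu
    have hu0 : 0 < u := hu.1
    rw [one_mul, pow_zero, norm_one, Real.norm_of_nonneg (by positivity)]
    exact (one_le_inv₀ (by positivity)).mpr (pow_le_one₀ hu0.le hu.2.le)
  have h1 : (fun u : ℝ => gaussMoment a * u ^ (-(a + 1 / 2) : ℝ)) =O[𝓝[>] 0]
      fun u => (u ^ (a + 1))⁻¹ := by
    refine (isBigO_const_mul_self _ _ _).trans (IsBigO.of_bound 1 ?_)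
    filter_upwards [Ioo_mem_nhdsGT (zero_lt_one' ℝ)] with u hu
    have hu0 : 0 < u := hu.1
    rw [one_mul, Real.norm_of_nonneg (by positivity), Real.norm_of_nonneg (by positivity),
      ← Real.rpow_natCast, ← Real.rpow_neg hu0.le]
    refine Real.rpow_le_rpow_of_exponent_ge hu0 hu.2.le ?_
    push_cast; linarith
  refine (h0.add h1).congr_left fun u => ?_
  simp [thetaRem]

theorem theta_isBigO_one_atTop (a : ℕ) : theta a =O[atTop] fun _ => (1 : ℝ) := by
  refine IsBigO.of_bound (theta a 1) ?_
  filter_upwards [eventually_ge_atTop 1] with u hu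
  rw [norm_one, mul_one, Real.norm_of_nonneg (theta_nonneg a u)]
  refine (summable_theta a (by linarith)).tsum_le_tsum (fun k => ?_) (summable_theta a one_pos)
  have hk : (0 : ℝ) ≤ (k : ℝ) ^ (2 * a) := by rw [pow_mul]; positivity
  gcongr

theorem theta_succ_isBigO_exp_atTop (a : ℕ) :
    theta (a + 1) =O[atTop] fun u => Real.exp (-1 * u) := by
  refine IsBigO.of_bound (Real.exp 1 * theta (a + 1) 1) ?_
  filter_upwards [eventually_ge_atTop 1] with u hu
  rw [Real.norm_of_nonneg (theta_nonneg _ u), Real.norm_of_nonneg (Real.exp_pos _).le,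
    mul_right_comm, ← Real.exp_add, theta, theta, ← tsum_mul_left]
  refine (summable_theta _ (by linarith)).tsum_le_tsum (fun k => ?_)
    ((summable_theta _ one_pos).mul_left _)
  have hk : (0 : ℝ) ≤ (k : ℝ) ^ (2 * (a + 1)) := by rw [pow_mul]; positivity
  rw [mul_left_comm]
  rcases eq_or_ne k 0 with rfl | hk0
  · simp
  gcongr
  rw [← Real.exp_add, Real.exp_le_exp]
  have hk1 : (1 : ℝ) ≤ (k : ℝ) ^ 2 := by
    have : 0 < k ^ 2 := by positivity
    exact_mod_cast this
  nlinarith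

/-! ### Lattice sums minus integrals of Gaussian monomials in two variables -/

/-- The difference between the lattice sum and the integral of
`x ^ (2 a) * y ^ (2 b) * exp (-u (x² + y²))`. -/
noncomputable def latticeRem (a b : ℕ) (u : ℝ) : ℝ :=
  theta a u * theta b u - gaussMoment a * gaussMoment b * (u ^ (a + b + 1))⁻¹

theorem hasDerivAt_latticeRem (a b : ℕ) {u : ℝ} (hu : 0 < u) :
    HasDerivAt (latticeRem a b) (-(latticeRem (a + 1) b u + latticeRem a (b + 1) u)) u := by
  refine (((hasDerivAt_theta a hu).mul (hasDerivAt_theta b hu)).sub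
    (((hasDerivAt_pow (a + b + 1) u).inv (by positivity)).const_mul
      (gaussMoment a * gaussMoment b))).congr_deriv ?_
  simp only [latticeRem, gaussMoment_succ, Nat.add_sub_cancel]
  rw [show a + 1 + b + 1 = a + b + 2 by ring, show a + (b + 1) + 1 = a + b + 2 by ring]
  push_cast
  field_simp
  ring

theorem continuousOn_latticeRem (a b : ℕ) : ContinuousOn (latticeRem a b) (Ioi 0) := fun _ hu =>
  (hasDerivAt_latticeRem a b hu).continuousAt.continuousWithinAt

theorem flat_latticeRem (a b : ℕ) : Flat (latticeRem a b) := by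
  intro K
  have h1 := (flat_thetaRem a (K + (b + 1))).mul (theta_isBigO_zero b)
  have h2 : (fun u : ℝ => u ^ (-(a + 1 / 2) : ℝ)) =O[𝓝[>] 0] fun u => (u ^ (a + 1))⁻¹ := by
    refine IsBigO.of_bound 1 ?_
    filter_upwards [Ioo_mem_nhdsGT (zero_lt_one' ℝ)] with u hu
    have hu0 : 0 < u := hu.1
    rw [one_mul, Real.norm_of_nonneg (by positivity), Real.norm_of_nonneg (by positivity),
      ← Real.rpow_natCast, ← Real.rpow_neg hu0.le]
    refine Real.rpow_le_rpow_of_exponent_ge hu0 hu.2.le ?_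
    push_cast; linarith
  have h3 := ((flat_thetaRem b (K + (a + 1))).mul h2).const_mul_left (gaussMoment a)
  have e (c : ℕ) : (fun u : ℝ => u ^ (K + (c + 1)) * (u ^ (c + 1))⁻¹) =ᶠ[𝓝[>] 0]
      fun u => u ^ K := by
    filter_upwards [self_mem_nhdsWithin] with u (hu : 0 < u)
    rw [pow_add]; field_simp
  refine ((h1.congr' .rfl (e b)).add (h3.congr' .rfl (e a))).congr' ?_ .rfl
  filter_upwards [self_mem_nhdsWithin] with u (hu : 0 < u)
  have : (u ^ (a + b + 1))⁻¹ = u ^ (-(a + 1 / 2) : ℝ) * u ^ (-(b + 1 / 2) : ℝ) := by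
    rw [← Real.rpow_natCast, ← Real.rpow_neg hu.le, ← Real.rpow_add hu]
    congr 1; push_cast; ring
  simp only [latticeRem, this, thetaRem]
  ring

theorem theta_mul_isBigO_exp_atTop {a b : ℕ} (h : a + b ≠ 0) :
    (fun u => theta a u * theta b u) =O[atTop] fun u => Real.exp (-1 * u) := by
  rcases a with _ | a
  · obtain ⟨b, rfl⟩ : ∃ c, b = c + 1 := Nat.exists_eq_succ_of_ne_zero (by omega)
    simpa using (theta_isBigO_one_atTop 0).mul (theta_succ_isBigO_exp_atTop b)
  · simpa using (theta_succ_isBigO_exp_atTop a).mul (theta_isBigO_one_atTop b)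

theorem latticeRem_isBigO_atTop {a b : ℕ} (h : a + b ≠ 0) :
    latticeRem a b =O[atTop] fun u => u ^ (-(a + b + 1) : ℝ) := by
  have e : (fun u : ℝ => gaussMoment a * gaussMoment b * (u ^ (a + b + 1))⁻¹) =ᶠ[atTop]
      fun u => gaussMoment a * gaussMoment b * u ^ (-(a + b + 1) : ℝ) := by
    filter_upwards [eventually_gt_atTop 0] with u hu
    rw [← Real.rpow_natCast, ← Real.rpow_neg hu.le]; push_cast; rfl
  exact ((theta_mul_isBigO_exp_atTop h).trans
    (isLittleO_exp_neg_mul_rpow_atTop one_pos _).isBigO).sub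
      ((isBigO_const_mul_self _ _ _).congr' e.symm .rfl)

theorem Flat.isBigO_rpow {f : ℝ → ℝ} (hf : Flat f) (b : ℝ) :
    f =O[𝓝[>] 0] fun u => u ^ (-b) := by
  refine (hf ⌈-b⌉₊).trans (IsBigO.of_bound 1 ?_)
  filter_upwards [Ioo_mem_nhdsGT (zero_lt_one' ℝ)] with u hu
  have hu0 : 0 < u := hu.1
  rw [one_mul, Real.norm_of_nonneg (by positivity), Real.norm_of_nonneg (by positivity),
    ← Real.rpow_natCast]
  exact Real.rpow_le_rpow_of_exponent_ge hu0 hu.2.le (Nat.le_ceil _)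

theorem mellinConvergent_latticeRem {a b : ℕ} (h : a + b ≠ 0) {s : ℂ} (hs : s.re < a + b + 1) :
    MellinConvergent (fun u => ((latticeRem a b u : ℝ) : ℂ)) s := by
  refine mellinConvergent_of_isBigO_rpow (a := a + b + 1) (b := s.re - 1)
    ((Complex.continuous_ofReal.comp_continuousOn
      (continuousOn_latticeRem a b)).locallyIntegrableOn measurableSet_Ioi)
    (Complex.isBigO_ofReal_left.mpr (latticeRem_isBigO_atTop h)) hs
    (Complex.isBigO_ofReal_left.mpr ((flat_latticeRem a b).isBigO_rpow _)) (by linarith)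

/-- Integration by parts for the Mellin transform. -/
theorem mellin_deriv {f f' : ℝ → ℂ} {s : ℂ} (hd : ∀ u, 0 < u → HasDerivAt f (f' u) u)
    (hf : MellinConvergent f s) (hf' : MellinConvergent f' (s + 1))
    (h0 : Tendsto (fun u : ℝ => (u : ℂ) ^ s * f u) (𝓝[>] 0) (𝓝 0))
    (h1 : Tendsto (fun u : ℝ => (u : ℂ) ^ s * f u) atTop (𝓝 0)) :
    mellin f' (s + 1) = -(s * mellin f s) := by
  have hu : ∀ u ∈ Ioi (0 : ℝ), HasDerivAt (fun u : ℝ => (u : ℂ) ^ s) (s * (u : ℂ) ^ (s - 1)) u := by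
    intro u hu
    rcases eq_or_ne s 0 with rfl | hs
    · simpa using hasDerivAt_const u (1 : ℂ)
    · exact hasDerivAt_ofReal_cpow_const hu.ne' hs
  have hf2 : IntegrableOn ((fun u : ℝ => (u : ℂ) ^ s) * f') (Ioi 0) := by
    simpa [MellinConvergent, Pi.mul_def] using hf'
  have hf1 : IntegrableOn ((fun u : ℝ => s * (u : ℂ) ^ (s - 1)) * f) (Ioi 0) := by
    have := Integrable.const_mul hf s
    simpa [Pi.mul_def, mul_assoc, IntegrableOn] using this
  have := integral_Ioi_mul_deriv_eq_deriv_mul hu (fun u hu => hd u hu) hf2 hf1 h0 h1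
  simp only [mellin, add_sub_cancel_right, smul_eq_mul]
  rw [this]
  simp [mul_assoc, integral_const_mul]

theorem mellin_latticeRem_succ {a b : ℕ} (h : a + b ≠ 0) {s : ℂ} (hs : s.re < a + b + 1) :
    mellin (fun u => ((latticeRem (a + 1) b u + latticeRem a (b + 1) u : ℝ) : ℂ)) (s + 1) =
      s * mellin (fun u => ((latticeRem a b u : ℝ) : ℂ)) s := by
  have hc : MellinConvergent
      (fun u => ((latticeRem (a + 1) b u + latticeRem a (b + 1) u : ℝ) : ℂ)) (s + 1) := by
    have h1 := mellinConvergent_latticeRem (a := a + 1) (b := b) (by omega) (s := s + 1)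
      (by simp; linarith)
    have h2 := mellinConvergent_latticeRem (a := a) (b := b + 1) (by omega) (s := s + 1)
      (by simp; linarith)
    simpa using (hasMellin_add h1 h2).1
  have hc' : MellinConvergent
      (fun u => ((-(latticeRem (a + 1) b u + latticeRem a (b + 1) u) : ℝ) : ℂ)) (s + 1) := by
    have := hc.const_smul (-1 : ℂ)
    simpa using this
  have hnorm : ∀ u : ℝ, 0 < u → ‖(u : ℂ) ^ s * ((latticeRem a b u : ℝ) : ℂ)‖ =
      ‖u ^ s.re * latticeRem a b u‖ := by
    intro u hu
    rw [norm_mul, norm_mul, Complex.norm_cpow_eq_rpow_re_of_pos hu, Complex.norm_real,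
      Real.norm_of_nonneg (by positivity : 0 ≤ u ^ s.re)]
  have key := mellin_deriv (f := fun u => ((latticeRem a b u : ℝ) : ℂ))
    (fun u hu => (hasDerivAt_latticeRem a b hu).ofReal_comp)
    (mellinConvergent_latticeRem h hs) hc' ?_ ?_
  · rw [← neg_inj, ← key]
    simp only [mellin, smul_eq_mul, Complex.ofReal_neg, mul_neg, integral_neg]
  · have h1 := ((isBigO_refl (fun u : ℝ => u ^ s.re) (𝓝[>] 0)).mul
      ((flat_latticeRem a b).isBigO_rpow (s.re - 1)))
    have h2 : (fun u : ℝ => u ^ s.re * u ^ (-(s.re - 1))) =ᶠ[𝓝[>] 0] fun u => u := by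
      filter_upwards [self_mem_nhdsWithin] with u (hu : 0 < u)
      rw [← Real.rpow_add hu]; simp
    have h3 := (h1.congr' .rfl h2).trans_tendsto (tendsto_id.mono_left nhdsWithin_le_nhds)
    rw [tendsto_zero_iff_norm_tendsto_zero] at h3 ⊢
    refine h3.congr' ?_
    filter_upwards [self_mem_nhdsWithin] with u (hu : 0 < u)
    exact (hnorm u hu).symm
  · have h1 := ((isBigO_refl (fun u : ℝ => u ^ s.re) atTop).mul (latticeRem_isBigO_atTop h))
    have h2 : (fun u : ℝ => u ^ s.re * u ^ (-(a + b + 1) : ℝ)) =ᶠ[atTop]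
        fun u => u ^ (-(a + b + 1 - s.re)) := by
      filter_upwards [eventually_gt_atTop 0] with u hu
      rw [← Real.rpow_add hu]; congr 1; ring
    have h3 := (h1.congr' .rfl h2).trans_tendsto (tendsto_rpow_neg_atTop (by linarith))
    rw [tendsto_zero_iff_norm_tendsto_zero] at h3 ⊢
    refine h3.congr' ?_
    filter_upwards [eventually_gt_atTop 0] with u hu
    exact (hnorm u hu).symm

/-! ### The spectrum of the star Laplacians -/

/-- The operator with symbol `symb l`. -/
noncomputable def starLaplacian (l : ℝ) (n : ℕ) : TorusFun n →ₗ[ℝ] TorusFun n :=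
  lapFst n + lapSnd n - (l / (n : ℝ) ^ 2) • (lapFst n ∘ₗ lapSnd n)

theorem laplacian5_eq (n : ℕ) : laplacian5 n = starLaplacian 0 n := by
  simp [laplacian5, starLaplacian]

theorem laplacian9_eq (n : ℕ) : laplacian9 n = starLaplacian (2 * Real.pi ^ 2 / 3) n := by
  rw [laplacian9, starLaplacian]
  congr 2
  ring

/-- The real character `p ↦ cos (2π j p / n) + sin (2π j p / n)` of `ℤ/nℤ`. These form an
orthogonal basis of real eigenfunctions of the Laplacian. -/
noncomputable def cas {n : ℕ} [NeZero n] (j p : ZMod n) : ℝ :=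
  (ZMod.stdAddChar (j * p)).re + (ZMod.stdAddChar (j * p)).im

section Spectrum

variable {n : ℕ} [NeZero n]

theorem stdAddChar_re (j : ZMod n) :
    (ZMod.stdAddChar j).re = Real.cos (2 * (Real.pi * (j.val / n))) := by
  have h : ((j.val : ℤ) : ZMod n) = j := by simp
  rw [← h, ZMod.stdAddChar_coe, h]
  rw [show (2 * Real.pi * Complex.I * ((j.val : ℤ) : ℂ) / (n : ℂ)) =
    ((2 * (Real.pi * (j.val / n)) : ℝ) : ℂ) * Complex.I by push_cast; ring]
  rw [Complex.exp_ofReal_mul_I_re]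

theorem stdAddChar_neg (j : ZMod n) :
    ZMod.stdAddChar (-j) = (starRingEnd ℂ) (ZMod.stdAddChar j) :=
  AddChar.map_neg_eq_conj _ j

theorem cas_second_difference (j p : ZMod n) :
    2 * cas j p - cas j (p + 1) - cas j (p - 1) =
      4 * Real.pi ^ 2 * sinSq (j.val / n) * cas j p := by
  have h1 : ZMod.stdAddChar (j * (p + 1)) = ZMod.stdAddChar (j * p) * ZMod.stdAddChar j := by
    rw [mul_add, mul_one, AddChar.map_add_eq_mul]
  have h2 : ZMod.stdAddChar (j * (p - 1)) =
      ZMod.stdAddChar (j * p) * (starRingEnd ℂ) (ZMod.stdAddChar j) := by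
    rw [mul_sub, mul_one, sub_eq_add_neg, AddChar.map_add_eq_mul, stdAddChar_neg]
  have h3 := stdAddChar_re j
  have h4 : 4 * Real.pi ^ 2 * sinSq (j.val / n) = 2 - 2 * (ZMod.stdAddChar j).re := by
    rw [h3, Real.cos_two_mul, Real.cos_sq', sinSq]
    field_simp
    ring
  rw [h4]
  simp only [cas, h1, h2, Complex.mul_re, Complex.mul_im, Complex.conj_re, Complex.conj_im]
  ring

theorem sum_cas_mul_cas (j k : ZMod n) :
    ∑ p, cas j p * cas p k = if j = k then (n : ℝ) else 0 := by
  have hs (b : ZMod n) : ∑ p, ZMod.stdAddChar (p * b) = if b = 0 then (n : ℂ) else 0 := by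
    rw [AddChar.sum_mulShift b (ZMod.isPrimitive_stdAddChar n)]
    simp [ZMod.card]
  have h (p : ZMod n) : cas j p * cas p k =
      (ZMod.stdAddChar (p * (j - k))).re + (ZMod.stdAddChar (p * (j + k))).im := by
    have h1 : ZMod.stdAddChar (p * (j - k)) =
        ZMod.stdAddChar (j * p) * (starRingEnd ℂ) (ZMod.stdAddChar (p * k)) := by
      rw [← stdAddChar_neg, ← AddChar.map_add_eq_mul]; congr 1; ring
    have h2 : ZMod.stdAddChar (p * (j + k)) =
        ZMod.stdAddChar (j * p) * ZMod.stdAddChar (p * k) := by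
      rw [← AddChar.map_add_eq_mul]; congr 1; ring
    rw [h1, h2]
    simp only [cas, Complex.mul_re, Complex.mul_im, Complex.conj_re, Complex.conj_im]
    ring
  simp_rw [h]
  rw [Finset.sum_add_distrib, ← Complex.re_sum, ← Complex.im_sum, hs, hs]
  simp only [sub_eq_zero]
  split_ifs <;> simp

/-- The matrix whose columns are the joint eigenfunctions of the two partial Laplacians. -/
noncomputable def casMatrix (n : ℕ) [NeZero n] : Matrix (ZMod n × ZMod n) (ZMod n × ZMod n) ℝ :=
  Matrix.of fun p j => cas j.1 p.1 * cas j.2 p.2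

theorem cas_comm (j p : ZMod n) : cas j p = cas p j := by
  simp [cas, mul_comm]

theorem casMatrix_mul_self : casMatrix n * casMatrix n = ((n : ℝ) ^ 2) • 1 := by
  ext p j
  rw [Matrix.mul_apply, Fintype.sum_prod_type]
  have : ∀ x y : ZMod n, casMatrix n p (x, y) * casMatrix n (x, y) j =
      (cas p.1 x * cas x j.1) * (cas p.2 y * cas y j.2) := by
    intro x y
    simp only [casMatrix, Matrix.of_apply]
    rw [cas_comm x p.1, cas_comm y p.2, cas_comm j.1, cas_comm j.2]
    ring
  simp_rw [this]
  rw [← Finset.sum_mul_sum, sum_cas_mul_cas, sum_cas_mul_cas]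
  simp only [Matrix.smul_apply, Matrix.one_apply, Prod.ext_iff, smul_eq_mul]
  split_ifs <;> simp_all [sq]

/-- The eigenvalues of `starLaplacian l n`. -/
noncomputable def eigenvalue (l : ℝ) (n : ℕ) (j : ZMod n × ZMod n) : ℝ :=
  (n : ℝ) ^ 2 * symb l (j.1.val / n) (j.2.val / n)

theorem lapFst_casMatrix (j : ZMod n × ZMod n) :
    lapFst n (fun p => casMatrix n p j) =
      ((n : ℝ) ^ 2 * sinSq (j.1.val / n)) • fun p => casMatrix n p j := by
  ext p
  have h := cas_second_difference j.1 p.1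
  have hpi := Real.pi_ne_zero
  simp only [lapFst, LinearMap.coe_mk, AddHom.coe_mk, casMatrix, Matrix.of_apply, Pi.smul_apply,
    smul_eq_mul]
  rw [← mul_assoc 2, ← sub_mul, ← sub_mul, h]
  field_simp

theorem lapSnd_casMatrix (j : ZMod n × ZMod n) :
    lapSnd n (fun p => casMatrix n p j) =
      ((n : ℝ) ^ 2 * sinSq (j.2.val / n)) • fun p => casMatrix n p j := by
  ext p
  have h := cas_second_difference j.2 p.2
  have hpi := Real.pi_ne_zero
  simp only [lapSnd, LinearMap.coe_mk, AddHom.coe_mk, casMatrix, Matrix.of_apply, Pi.smul_apply,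
    smul_eq_mul]
  rw [mul_left_comm 2, ← mul_sub, ← mul_sub, h]
  field_simp

theorem starLaplacian_casMatrix (l : ℝ) (j : ZMod n × ZMod n) :
    starLaplacian l n (fun p => casMatrix n p j) =
      eigenvalue l n j • fun p => casMatrix n p j := by
  have hn : (n : ℝ) ≠ 0 := by exact_mod_cast NeZero.ne n
  simp only [starLaplacian, LinearMap.sub_apply, LinearMap.add_apply, LinearMap.smul_apply,
    LinearMap.comp_apply, lapFst_casMatrix, lapSnd_casMatrix, map_smul]
  rw [smul_smul, smul_smul, ← add_smul, ← sub_smul]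
  congr 1
  simp only [eigenvalue, symb]
  field_simp

theorem charpoly_starLaplacian (l : ℝ) :
    (starLaplacian l n).charpoly =
      ∏ j, (Polynomial.X - Polynomial.C (eigenvalue l n j)) := by
  have hn : ((n : ℝ) ^ 2) ≠ 0 := by
    have : (n : ℝ) ≠ 0 := by exact_mod_cast NeZero.ne n
    positivity
  let U : (Matrix (ZMod n × ZMod n) (ZMod n × ZMod n) ℝ)ˣ :=
    { val := casMatrix n
      inv := ((n : ℝ) ^ 2)⁻¹ • casMatrix n
      val_inv := by
        rw [Matrix.mul_smul, casMatrix_mul_self, smul_smul, inv_mul_cancel₀ hn, one_smul]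
      inv_val := by
        rw [Matrix.smul_mul, casMatrix_mul_self, smul_smul, inv_mul_cancel₀ hn, one_smul] }
  have h : LinearMap.toMatrix' (starLaplacian l n) * U.val =
      U.val * Matrix.diagonal (eigenvalue l n) := by
    ext p j
    rw [Matrix.mul_diagonal, Matrix.mul_apply_eq_vecMul]
    have h2 := congrFun (LinearMap.toMatrix'_mulVec (starLaplacian l n)
      (fun p => casMatrix n p j)) p
    rw [starLaplacian_casMatrix] at h2
    rw [Pi.smul_apply, smul_eq_mul, mul_comm] at h2
    exact h2
  have h3 : LinearMap.toMatrix' (starLaplacian l n) =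
      U.val * Matrix.diagonal (eigenvalue l n) * U⁻¹.val := by
    rw [← h, mul_assoc, Units.mul_inv, mul_one]
  rw [← LinearMap.charpoly_toMatrix (starLaplacian l n) (Pi.basisFun ℝ (ZMod n × ZMod n)),
    LinearMap.toMatrix_eq_toMatrix', h3, Matrix.coe_units_inv, Matrix.charpoly_units_conj, Matrix.charpoly_diagonal]

theorem spectralZeta_starLaplacian (l : ℝ) {s : ℂ} (hs : s ≠ 0) :
    spectralZeta (starLaplacian l n) s = ∑ j, ((eigenvalue l n j : ℝ) : ℂ) ^ (-s) := by
  have hr : (starLaplacian l n).charpoly.roots = Finset.univ.val.map (eigenvalue l n) := by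
    rw [charpoly_starLaplacian,
      ← Polynomial.roots_multiset_prod_X_sub_C (Finset.univ.val.map (eigenvalue l n)),
      Multiset.map_map]
    rfl
  rw [spectralZeta, hr, Multiset.filter_map, Multiset.map_map, ← Finset.filter_val]
  rw [← Finset.sum_filter_add_sum_filter_not Finset.univ (fun j => eigenvalue l n j ≠ 0)]
  rw [Finset.sum_eq_zero (s := Finset.univ.filter fun j => ¬ eigenvalue l n j ≠ 0), add_zero]
  · rfl
  · intro j hj
    simp only [ne_eq, not_not, Finset.mem_filter] at hj
    rw [hj.2, Complex.ofReal_zero, Complex.zero_cpow (neg_ne_zero.mpr hs)]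

end Spectrum

/-! ### The trapezoidal rule for small times -/

theorem sum_exp_eq (n : ℕ) [NeZero n] (m : ℤ) :
    ∑ j : ZMod n, Complex.exp (2 * Real.pi * Complex.I * m * ((j.val / n : ℝ) : ℂ)) =
      if (n : ℤ) ∣ m then (n : ℂ) else 0 := by
  have h := AddChar.sum_mulShift (m : ZMod n) (ZMod.isPrimitive_stdAddChar n)
  rw [ZMod.card] at h
  simp only [ZMod.intCast_zmod_eq_zero_iff_dvd] at h
  rw [Nat.cast_ite, Nat.cast_zero] at h
  rw [← h]
  refine Finset.sum_congr rfl fun j _ => ?_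
  have h2 : j * (m : ZMod n) = ((j.val * m : ℤ) : ZMod n) := by simp
  rw [h2, ZMod.stdAddChar_coe]
  congr 1
  push_cast
  ring

theorem integral_exp_eq (m : ℤ) :
    ∫ x in (0 : ℝ)..1, Complex.exp (2 * Real.pi * Complex.I * m * (x : ℂ)) =
      if m = 0 then 1 else 0 := by
  split_ifs with h
  · simp [h]
  · have hc : (2 * Real.pi * Complex.I * m : ℂ) ≠ 0 := by
      have : (m : ℂ) ≠ 0 := by exact_mod_cast h
      have := Complex.two_pi_I_ne_zero
      positivity
    rw [integral_exp_mul_complex hc, Complex.ofReal_one, Complex.ofReal_zero, mul_one, mul_zero,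
      Complex.exp_zero, mul_comm _ (m : ℂ), Complex.exp_int_mul_two_pi_mul_I, sub_self, zero_div]

/-- The trapezoidal rule with `n` nodes is exact on trigonometric polynomials of degree `< n`. -/
theorem trapezoid_exact {n d : ℕ} [NeZero n] (hd : d < n) (a b : ℝ) :
    ∑ j : ZMod n, (a + b * sinSq (j.val / n)) ^ d =
      n * ∫ x in (0 : ℝ)..1, (a + b * sinSq x) ^ d := by
  set β : ℂ := -(b / (4 * Real.pi ^ 2))
  set Q : Polynomial ℂ := (Polynomial.C β * Polynomial.X ^ 2 +
    Polynomial.C (a + b / (2 * Real.pi ^ 2) : ℂ) * Polynomial.X + Polynomial.C β) ^ d with hQ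
  have hdeg : Q.natDegree < 2 * d + 1 := by
    have h2 : (Polynomial.C β * Polynomial.X ^ 2 +
      Polynomial.C (a + b / (2 * Real.pi ^ 2) : ℂ) * Polynomial.X + Polynomial.C β).natDegree ≤ 2 :=
      Polynomial.natDegree_quadratic_le
    have h3 := Polynomial.natDegree_pow_le_of_le d h2
    rw [← hQ] at h3
    omega
  have key (x : ℝ) : (((a + b * sinSq x) ^ d : ℝ) : ℂ) = ∑ i ∈ Finset.range (2 * d + 1),
      Q.coeff i * Complex.exp (2 * Real.pi * Complex.I * ((i - d : ℤ) : ℂ) * (x : ℂ)) := by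
    set z := Complex.exp (2 * Real.pi * Complex.I * (x : ℂ)) with hz
    have hz0 : z ≠ 0 := Complex.exp_ne_zero _
    have hs : ((a + b * sinSq x : ℝ) : ℂ) * z =
        β * z ^ 2 + (a + b / (2 * Real.pi ^ 2)) * z + β := by
      have h1 : sinSq x = (1 - Real.cos (2 * (Real.pi * x))) / (2 * Real.pi ^ 2) := by
        have := Real.pi_ne_zero
        rw [Real.cos_two_mul, Real.cos_sq', sinSq]; field_simp; ring
      have h2 : ((Real.cos (2 * (Real.pi * x)) : ℝ) : ℂ) = (z + z⁻¹) / 2 := by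
        rw [Complex.ofReal_cos, Complex.cos, hz, ← Complex.exp_neg]
        push_cast
        congr 3 <;> ring
      have hp : (Real.pi : ℂ) ≠ 0 := by exact_mod_cast Real.pi_ne_zero
      rw [h1]
      push_cast at h2 ⊢
      rw [h2]
      simp only [β]
      field_simp
      ring
    have h3 : (((a + b * sinSq x) ^ d : ℝ) : ℂ) = (z ^ d)⁻¹ * Q.eval z := by
      rw [hQ, Polynomial.eval_pow]
      simp only [Polynomial.eval_add, Polynomial.eval_mul, Polynomial.eval_C, Polynomial.eval_pow,
        Polynomial.eval_X]
      rw [← hs, mul_pow]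
      push_cast
      field_simp
    rw [h3, Polynomial.eval_eq_sum_range' hdeg, Finset.mul_sum]
    refine Finset.sum_congr rfl fun i _ => ?_
    have h4 : Complex.exp (2 * Real.pi * Complex.I * ((i - d : ℤ) : ℂ) * (x : ℂ)) =
        z ^ i * (z ^ d)⁻¹ := by
      rw [hz, ← Complex.exp_nat_mul, ← Complex.exp_nat_mul, ← Complex.exp_neg, ← Complex.exp_add]
      congr 1
      push_cast
      ring
    rw [h4]; ring
  have hdvd (i : ℕ) (hi : i ∈ Finset.range (2 * d + 1)) :
      (n : ℤ) ∣ (i - d : ℤ) ↔ (i - d : ℤ) = 0 := by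
    simp only [Finset.mem_range] at hi
    constructor
    · intro h
      by_contra h0
      have := Int.le_of_dvd (abs_pos.mpr h0) ((dvd_abs _ _).mpr h)
      rcases abs_cases (i - d : ℤ) with ⟨h1, -⟩ | ⟨h1, -⟩ <;> omega
    · intro h; rw [h]; exact dvd_zero _
  have hL : ((∑ j : ZMod n, (a + b * sinSq (j.val / n)) ^ d : ℝ) : ℂ) =
      ∑ i ∈ Finset.range (2 * d + 1), Q.coeff i * if (i - d : ℤ) = 0 then (n : ℂ) else 0 := by
    rw [Complex.ofReal_sum]
    simp_rw [key]
    rw [Finset.sum_comm]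
    refine Finset.sum_congr rfl fun i hi => ?_
    rw [← Finset.mul_sum, sum_exp_eq]
    simp only [hdvd i hi]
  have hR : ((n * ∫ x in (0 : ℝ)..1, (a + b * sinSq x) ^ d : ℝ) : ℂ) =
      ∑ i ∈ Finset.range (2 * d + 1), Q.coeff i * if (i - d : ℤ) = 0 then (n : ℂ) else 0 := by
    rw [Complex.ofReal_mul, ← intervalIntegral.integral_ofReal]
    simp_rw [key]
    rw [intervalIntegral.integral_finsetSum, Finset.mul_sum]
    · refine Finset.sum_congr rfl fun i _ => ?_
      rw [intervalIntegral.integral_const_mul, integral_exp_eq]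
      split_ifs <;> simp [mul_comm]
    · intro i _
      exact Continuous.intervalIntegrable (by fun_prop) _ _
  exact_mod_cast hL.trans hR.symm

theorem symb_eq (l x y : ℝ) : symb l x y = sinSq y + (1 - l * sinSq y) * sinSq x := by
  unfold symb; ring

theorem symb_comm (l x y : ℝ) : symb l x y = symb l y x := by unfold symb; ring

/-- The fundamental square may be replaced by the unit square. -/
theorem setIntegral_square {l : ℝ} {g : ℝ → ℝ}
    (hg : Continuous fun p : ℝ × ℝ => g (symb l p.1 p.2)) :
    ∫ p in square, g (symb l p.1 p.2) =
      ∫ x in (0 : ℝ)..1, ∫ y in (0 : ℝ)..1, g (symb l x y) := by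
  have hi : IntegrableOn (fun p : ℝ × ℝ => g (symb l p.1 p.2)) square := by
    refine (hg.continuousOn.integrableOn_compact
      (isCompact_Icc (a := (-(1 / 2) : ℝ)) (b := 1 / 2) |>.prod
        (isCompact_Icc (a := (-(1 / 2) : ℝ)) (b := 1 / 2)))).mono_set ?_
    exact prod_mono Ioc_subset_Icc_self Ioc_subset_Icc_self
  rw [square, Measure.volume_eq_prod, setIntegral_prod _ (by rwa [← Measure.volume_eq_prod])]
  rw [← intervalIntegral.integral_of_le (by norm_num)]
  have h1 (x : ℝ) : ∫ y in Ioc (-(1 / 2) : ℝ) (1 / 2), g (symb l x y) =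
      ∫ y in (0 : ℝ)..1, g (symb l x y) := by
    rw [← intervalIntegral.integral_of_le (by norm_num)]
    have hp : Function.Periodic (fun y => g (symb l x y)) 1 := fun y => by
      simp only [symb, sinSq_periodic y]
    have := hp.intervalIntegral_add_eq (-(1 / 2)) 0
    norm_num at this ⊢
    exact this
  simp only [h1]
  have hp : Function.Periodic (fun x => ∫ y in (0 : ℝ)..1, g (symb l x y)) 1 := fun x => by
    simp only [symb, sinSq_periodic x]
  have := hp.intervalIntegral_add_eq (-(1 / 2)) 0
  norm_num at this ⊢
  exact this

theorem trapezoid_exact_symb {n d : ℕ} [NeZero n] (hd : d < n) (l : ℝ) :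
    ∑ j : ZMod n × ZMod n, symb l (j.1.val / n) (j.2.val / n) ^ d =
      n ^ 2 * ∫ p in square, symb l p.1 p.2 ^ d := by
  have hc := continuous_symb l
  have hcs := continuous_sinSq
  rw [setIntegral_square (g := fun v => v ^ d) (hc.pow d), Fintype.sum_prod_type_right]
  have h1 (y : ℝ) : ∑ j : ZMod n, symb l (j.val / n) y ^ d =
      n * ∫ x in (0 : ℝ)..1, symb l x y ^ d := by
    simp only [symb_eq l _ y]
    exact trapezoid_exact hd _ _
  simp only [h1]
  rw [← Finset.mul_sum, ← intervalIntegral.integral_finsetSum]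
  · have h2 (x : ℝ) : ∑ j : ZMod n, symb l x (j.val / n) ^ d =
        n * ∫ y in (0 : ℝ)..1, symb l x y ^ d := by
      simp only [symb_comm l x]
      exact h1 x
    simp only [h2]
    rw [intervalIntegral.integral_const_mul]
    ring
  · intro j _
    refine Continuous.intervalIntegrable ?_ _ _
    unfold symb; fun_prop

/-- The mean of the profile of the symbol over the torus. -/
noncomputable def profileMean (l τ : ℝ) : ℝ := ∫ p in square, profile (τ * symb l p.1 p.2)

theorem integrableOn_square {f : ℝ × ℝ → ℝ} (hf : Continuous f) : IntegrableOn f square := by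
  refine (hf.continuousOn.integrableOn_compact
    (isCompact_Icc (a := (-(1 / 2) : ℝ)) (b := 1 / 2) |>.prod
      (isCompact_Icc (a := (-(1 / 2) : ℝ)) (b := 1 / 2)))).mono_set ?_
  exact prod_mono Ioc_subset_Icc_self Ioc_subset_Icc_self

theorem volume_square : volume square = 1 := by
  rw [square, Measure.volume_eq_prod, Measure.prod_prod, Real.volume_Ioc]
  norm_num

theorem measurableSet_square : MeasurableSet square := measurableSet_Ioc.prod measurableSet_Ioc

/-- For `v ≤ n / 4` the Taylor remainder of order `n` decays geometrically, since
`n ^ n / n! ≤ exp n` and `e < 4`. -/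
theorem abs_profile_sub_sum_le {n : ℕ} (hn : n ≠ 0) {v : ℝ} (h0 : 0 ≤ v) (h1 : v ≤ n / 4) :
    |profile v - ∑ j ∈ Finset.range (n - 1), (-1) ^ j / (j.factorial : ℝ) * v ^ (j + 1)| ≤
      2 * n * (Real.exp 1 / 4) ^ n := by
  obtain ⟨N, rfl⟩ := Nat.exists_eq_succ_of_ne_zero hn
  simp only [Nat.succ_eq_add_one, Nat.add_sub_cancel]
  have hN : (0 : ℝ) < (N + 1 : ℕ) := by positivity
  have h := Complex.exp_bound' (x := ((-v : ℝ) : ℂ)) (n := N) (by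
    rw [Complex.norm_real, Real.norm_eq_abs, abs_neg, abs_of_nonneg h0, div_le_iff₀ hN]
    linarith)
  rw [Complex.norm_real, Real.norm_eq_abs, abs_neg, abs_of_nonneg h0] at h
  have h2 : |Real.exp (-v) - ∑ j ∈ Finset.range N, (-v) ^ j / (j.factorial : ℝ)| ≤
      v ^ N / N.factorial * 2 := by
    refine le_trans (le_of_eq ?_) h
    rw [← Real.norm_eq_abs, ← Complex.norm_real]
    push_cast
    rfl
  have h3 : profile v - ∑ j ∈ Finset.range N, (-1) ^ j / (j.factorial : ℝ) * v ^ (j + 1) =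
      v * (Real.exp (-v) - ∑ j ∈ Finset.range N, (-v) ^ j / (j.factorial : ℝ)) := by
    rw [profile, mul_sub, Finset.mul_sum]
    congr 1
    refine Finset.sum_congr rfl fun j _ => ?_
    rw [neg_pow v]; ring
  have h4 := Real.pow_div_factorial_le_exp (x := ((N + 1 : ℕ) : ℝ)) hN.le (N + 1)
  rw [h3, abs_mul, abs_of_nonneg h0]
  calc v * |_| ≤ v * (v ^ N / N.factorial * 2) := by gcongr
    _ = 2 * (N + 1 : ℕ) * (v ^ (N + 1) / (N + 1).factorial) := by
        rw [Nat.factorial_succ]; push_cast; field_simp; ring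
    _ ≤ 2 * (N + 1 : ℕ) * (((N + 1 : ℕ) / 4 : ℝ) ^ (N + 1) / (N + 1).factorial) := by gcongr
    _ = 2 * (N + 1 : ℕ) * ((((N + 1 : ℕ) : ℝ) ^ (N + 1) / (N + 1).factorial) / 4 ^ (N + 1)) := by
        rw [div_pow]; ring
    _ ≤ 2 * (N + 1 : ℕ) * (Real.exp ((N + 1 : ℕ) : ℝ) / 4 ^ (N + 1)) := by gcongr
    _ = _ := by rw [div_pow, ← Real.exp_nat_mul, mul_one]

theorem continuous_profile : Continuous profile := by unfold profile; fun_prop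

/-- For times `τ ≤ n`, the power series of the profile of the symbol is dominated by its terms of
degree less than `n`, on which the trapezoidal rule is exact. -/
theorem abs_sum_profile_sub_le {l : ℝ} (hl0 : 0 ≤ l) (hl : l ≤ 2 * Real.pi ^ 2 / 3) {n : ℕ}
    [NeZero n] {τ : ℝ} (h0 : 0 ≤ τ) (h1 : τ ≤ n) :
    |∑ j : ZMod n × ZMod n, profile (τ * symb l (j.1.val / n) (j.2.val / n)) -
      n ^ 2 * profileMean l τ| ≤ 4 * (n ^ 3 * (Real.exp 1 / 4) ^ n) := by
  set c : ℕ → ℝ := fun j => (-1) ^ j / (j.factorial : ℝ)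
  set P : ℝ → ℝ := fun v => ∑ j ∈ Finset.range (n - 1), c j * v ^ (j + 1)
  have hc := continuous_symb l
  have hP : ∀ x y : ℝ, |profile (τ * symb l x y) - P (τ * symb l x y)| ≤
      2 * n * (Real.exp 1 / 4) ^ n := by
    intro x y
    refine abs_profile_sub_sum_le (NeZero.ne n) (mul_nonneg h0 (symb_nonneg hl x y)) ?_
    -- this holds because `8 ≤ π²`
    have h2 : symb l x y ≤ 1 / 4 := by
      refine (symb_le hl0 x y).trans ?_
      rw [div_le_div_iff₀ (by positivity) (by norm_num)]
      nlinarith [Real.pi_gt_three]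
    calc τ * symb l x y ≤ n * (1 / 4) := by
          gcongr
          exact symb_nonneg hl x y
      _ = n / 4 := by ring
  have hexact : ∑ j : ZMod n × ZMod n, P (τ * symb l (j.1.val / n) (j.2.val / n)) =
      n ^ 2 * ∫ p in square, P (τ * symb l p.1 p.2) := by
    simp only [P]
    rw [Finset.sum_comm, integral_finsetSum, Finset.mul_sum]
    · refine Finset.sum_congr rfl fun i hi => ?_
      simp only [Finset.mem_range] at hi
      simp only [mul_pow τ, ← mul_assoc]
      rw [← Finset.mul_sum, trapezoid_exact_symb (by omega), integral_const_mul]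
      ring
    · intro i _
      exact integrableOn_square (by fun_prop)
  have hsum : |∑ j : ZMod n × ZMod n, (profile (τ * symb l (j.1.val / n) (j.2.val / n)) -
      P (τ * symb l (j.1.val / n) (j.2.val / n)))| ≤ n ^ 2 * (2 * n * (Real.exp 1 / 4) ^ n) := by
    refine (Finset.abs_sum_le_sum_abs _ _).trans ((Finset.sum_le_card_nsmul _ _ _
      fun j _ => hP _ _).trans_eq ?_)
    rw [Finset.card_univ, Fintype.card_prod, ZMod.card, nsmul_eq_mul]
    push_cast
    ring
  have hint : |∫ p in square, (profile (τ * symb l p.1 p.2) - P (τ * symb l p.1 p.2))| ≤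
      2 * n * (Real.exp 1 / 4) ^ n := by
    have := norm_setIntegral_le_of_norm_le_const (μ := volume) (s := square)
      (f := fun p : ℝ × ℝ => profile (τ * symb l p.1 p.2) - P (τ * symb l p.1 p.2))
      (C := 2 * n * (Real.exp 1 / 4) ^ n) (by rw [volume_square]; simp) (fun p _ => hP p.1 p.2)
    rw [measureReal_def, volume_square] at this
    simpa using this
  have hPc : Continuous P := by
    simp only [P]; fun_prop
  have hpc := continuous_profile
  rw [integral_sub (integrableOn_square (by fun_prop)) (integrableOn_square (by fun_prop))] at hint
  rw [Finset.sum_sub_distrib, hexact] at hsum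
  rw [profileMean]
  set A := ∑ j : ZMod n × ZMod n, profile (τ * symb l (j.1.val / n) (j.2.val / n))
  set B := ∫ p in square, profile (τ * symb l p.1 p.2)
  set D := ∫ p in square, P (τ * symb l p.1 p.2)
  calc |A - n ^ 2 * B| = |(A - n ^ 2 * D) - n ^ 2 * (B - D)| := by congr 1; ring
    _ ≤ |A - n ^ 2 * D| + |n ^ 2 * (B - D)| := abs_sub _ _
    _ ≤ n ^ 2 * (2 * n * (Real.exp 1 / 4) ^ n) + n ^ 2 * (2 * n * (Real.exp 1 / 4) ^ n) := by
        rw [abs_mul _ (B - D), abs_of_nonneg (by positivity : (0 : ℝ) ≤ n ^ 2)]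
        gcongr
    _ = _ := by ring

theorem exists_pow_mul_geometric_le (K : ℕ) :
    ∃ C : ℝ, 0 ≤ C ∧ ∀ n : ℕ, n ≠ 0 →
      4 * (n ^ 3 * (Real.exp 1 / 4) ^ n : ℝ) ≤ C * ((n : ℝ) ^ K)⁻¹ := by
  have h : |Real.exp 1 / 4| < 1 := by
    rw [abs_of_pos (by positivity), div_lt_one (by norm_num)]
    exact Real.exp_one_lt_d9.trans (by norm_num)
  obtain ⟨C, hC⟩ := (tendsto_pow_const_mul_const_pow_of_abs_lt_one (K + 3) h).bddAbove_range
  refine ⟨4 * max C 0, by positivity, fun n hn => ?_⟩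
  have hn' : (0 : ℝ) < n := by positivity
  have h2 : (n : ℝ) ^ (K + 3) * (Real.exp 1 / 4) ^ n ≤ max C 0 :=
    (hC ⟨n, rfl⟩).trans (le_max_left _ _)
  rw [← div_eq_mul_inv, le_div_iff₀ (by positivity)]
  calc _ = 4 * ((n : ℝ) ^ (K + 3) * (Real.exp 1 / 4) ^ n) := by ring
    _ ≤ _ := by gcongr

/-! ### Mellin transforms of Laplace transforms -/

theorem hasMellin_exp_neg_mul {α : ℂ} (hα : 0 < α.re) {t : ℝ} (ht : 0 < t) :
    HasMellin (fun x : ℝ => ((Real.exp (-(t * x)) : ℝ) : ℂ)) α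
      (Complex.Gamma α * (t : ℂ) ^ (-α)) := by
  have hc : MellinConvergent (fun x : ℝ => ((Real.exp (-x) : ℝ) : ℂ)) α := by
    have := Complex.GammaIntegral_convergent hα
    simpa [MellinConvergent, mul_comm] using this
  refine ⟨(MellinConvergent.comp_mul_left ht).mpr hc, ?_⟩
  have := Complex.integral_cpow_mul_exp_neg_mul_Ioi hα ht
  simp only [mellin, smul_eq_mul]
  push_cast
  rw [this, one_div, Complex.inv_cpow _ _ (by
    rw [Complex.arg_ofReal_of_nonneg ht.le]; exact Real.pi_pos.ne), Complex.cpow_neg]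
  ring

theorem mellin_exp_neg_mul_sq {α : ℂ} (hα : 0 < α.re) {t : ℝ} (ht : 0 < t) :
    HasMellin (fun z : ℝ => ((Real.exp (-(t * z ^ 2)) : ℝ) : ℂ)) (2 * α)
      (Complex.Gamma α / 2 * (t : ℂ) ^ (-α)) := by
  have h1 := hasMellin_exp_neg_mul hα ht
  have e : (2 * α) / ((2 : ℝ) : ℂ) = α := by push_cast; ring
  have h2 := mellin_comp_rpow (fun x : ℝ => ((Real.exp (-(t * x)) : ℝ) : ℂ)) (2 * α) 2
  have h3 := MellinConvergent.comp_rpow (f := fun x : ℝ => ((Real.exp (-(t * x)) : ℝ) : ℂ))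
    (s := 2 * α) (two_ne_zero (α := ℝ))
  simp only [Real.rpow_two] at h2 h3
  rw [e] at h2 h3
  refine ⟨h3.mpr h1.1, ?_⟩
  rw [h2, h1.2]
  simp
  ring

/-- The Mellin transform of `z ↦ ∫ exp (-t z²) g(t) dt` at `2 α`. -/
theorem mellin_laplace_sq {α : ℂ} (hα : 0 < α.re) {g : ℝ → ℝ} (hg : ContinuousOn g (Ioi 0))
    (hint : IntegrableOn (fun t => t ^ (-α.re) * g t) (Ioi 0)) :
    HasMellin (fun z : ℝ => ((∫ t in Ioi (0 : ℝ), Real.exp (-(t * z ^ 2)) * g t : ℝ) : ℂ)) (2 * α)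
      (Complex.Gamma α / 2 * ∫ t in Ioi (0 : ℝ), (t : ℂ) ^ (-α) * (g t : ℂ)) := by
  set μ := (volume : Measure ℝ).restrict (Ioi 0)
  set Φ : ℝ × ℝ → ℂ := fun p => (p.1 : ℂ) ^ (2 * α - 1) *
    (((Real.exp (-(p.2 * p.1 ^ 2)) : ℝ) : ℂ) * (g p.2 : ℂ)) with hΦ
  have hmeas : AEStronglyMeasurable Φ (μ.prod μ) := by
    have h1 : AEStronglyMeasurable (fun p : ℝ × ℝ => (g p.2 : ℂ)) (μ.prod μ) :=
      (Complex.continuous_ofReal.comp_aestronglyMeasurable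
        (hg.aestronglyMeasurable measurableSet_Ioi)).comp_snd
    have h2 : Measurable fun p : ℝ × ℝ => (p.1 : ℂ) ^ (2 * α - 1) := by fun_prop
    have h3 : Measurable fun p : ℝ × ℝ => ((Real.exp (-(p.2 * p.1 ^ 2)) : ℝ) : ℂ) := by fun_prop
    exact h2.aestronglyMeasurable.mul (h3.aestronglyMeasurable.mul h1)
  have hslice : ∀ t ∈ Ioi (0 : ℝ), Integrable (fun z => Φ (z, t)) μ := by
    intro t ht
    have := (mellin_exp_neg_mul_sq hα ht).1.mul_const (g t : ℂ)
    simpa [MellinConvergent, IntegrableOn, hΦ, mul_assoc] using this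
  have hα' : ((α.re : ℂ)).re = α.re := Complex.ofReal_re _
  have hnorm : ∀ t ∈ Ioi (0 : ℝ), ∫ z, ‖Φ (z, t)‖ ∂μ =
      Real.Gamma α.re / 2 * (t ^ (-α.re) * |g t|) := by
    intro t ht
    have ht' : (0 : ℝ) < t := ht
    have h := (mellin_exp_neg_mul_sq (α := α.re) (by simpa using hα) ht).2
    have h2 : ∫ z, ‖Φ (z, t)‖ ∂μ =
        ∫ z in Ioi (0 : ℝ), (z ^ (2 * α.re - 1) * Real.exp (-(t * z ^ 2))) * |g t| := by
      refine setIntegral_congr_fun measurableSet_Ioi fun z (hz : 0 < z) => ?_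
      simp only [hΦ, norm_mul, Complex.norm_real, Real.norm_eq_abs, Real.abs_exp]
      rw [Complex.norm_cpow_eq_rpow_re_of_pos hz]
      simp [mul_assoc]
    rw [h2, integral_mul_const, ← mul_assoc]
    congr 1
    have h3 : mellin (fun z : ℝ => ((Real.exp (-(t * z ^ 2)) : ℝ) : ℂ)) (2 * α.re) =
        ((∫ z in Ioi (0 : ℝ), z ^ (2 * α.re - 1) * Real.exp (-(t * z ^ 2)) : ℝ) : ℂ) := by
      rw [mellin, ← integral_complex_ofReal]
      refine setIntegral_congr_fun measurableSet_Ioi fun z (hz : 0 < z) => ?_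
      simp only [smul_eq_mul, Complex.ofReal_mul]
      rw [Complex.ofReal_cpow hz.le]
      push_cast
      rfl
    rw [h3] at h
    have h4 : Complex.Gamma α.re / 2 * (t : ℂ) ^ (-(α.re : ℂ)) =
        ((Real.Gamma α.re / 2 * t ^ (-α.re) : ℝ) : ℂ) := by
      rw [Complex.Gamma_ofReal, ← Complex.ofReal_neg, ← Complex.ofReal_cpow ht'.le]
      push_cast; rfl
    rw [h4] at h
    exact_mod_cast h
  have hΦi : Integrable Φ (μ.prod μ) := by
    rw [integrable_prod_iff' hmeas]
    refine ⟨?_, ?_⟩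
    · exact (ae_restrict_iff' measurableSet_Ioi).mpr (ae_of_all _ hslice)
    · have h1 : IntegrableOn (fun t => Real.Gamma α.re / 2 * (t ^ (-α.re) * |g t|)) (Ioi 0) := by
        refine Integrable.const_mul ?_ _
        refine hint.norm.congr ?_
        refine (ae_restrict_iff' measurableSet_Ioi).mpr (ae_of_all _ fun t (ht : 0 < t) => ?_)
        beta_reduce
        rw [norm_mul, Real.norm_eq_abs, Real.norm_eq_abs, abs_of_pos (by positivity)]
      exact h1.congr_fun (fun t ht => (hnorm t ht).symm) measurableSet_Ioi
  have hin : ∀ z : ℝ, ∫ t, Φ (z, t) ∂μ = (z : ℂ) ^ (2 * α - 1) •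
      ((∫ t in Ioi (0 : ℝ), Real.exp (-(t * z ^ 2)) * g t : ℝ) : ℂ) := by
    intro z
    simp only [hΦ]
    rw [integral_const_mul, smul_eq_mul, ← integral_complex_ofReal]
    simp [μ]
  constructor
  · have := hΦi.integral_prod_left
    simp only [hin] at this
    exact this
  · have := integral_integral_swap (f := fun z t => Φ (z, t)) hΦi
    simp only [hin] at this
    rw [mellin, this, ← integral_const_mul]
    refine setIntegral_congr_fun measurableSet_Ioi fun t ht => ?_
    have h := (mellin_exp_neg_mul_sq hα ht).2
    rw [mellin] at h
    simp only [hΦ, ← mul_assoc]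
    rw [integral_mul_const]
    simp only [smul_eq_mul] at h
    rw [h]

/-! ### The leading coefficient -/

/-- The mean of `exp (-t * symb)` over the torus. -/
noncomputable def heatMean (l t : ℝ) : ℝ := ∫ p in square, Real.exp (-(t * symb l p.1 p.2))

theorem profile_le_one (v : ℝ) : profile v ≤ 1 := by
  have h1 := Real.add_one_le_exp v
  have h2 : v ≤ Real.exp v := by linarith
  rw [profile, Real.exp_neg, ← div_eq_mul_inv, div_le_one (Real.exp_pos v)]
  exact h2

theorem profile_nonneg {v : ℝ} (hv : 0 ≤ v) : 0 ≤ profile v := mul_nonneg hv (Real.exp_pos _).le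

theorem profile_le_exp (v : ℝ) : profile v ≤ 2 * Real.exp (-(v / 2)) := by
  have h1 := Real.add_one_le_exp (v / 2)
  have h2 : v ≤ 2 * Real.exp (v / 2) := by linarith
  calc profile v = v * Real.exp (-v) := rfl
    _ ≤ 2 * Real.exp (v / 2) * Real.exp (-v) := by gcongr
    _ = 2 * Real.exp (-(v / 2)) := by rw [mul_assoc, ← Real.exp_add]; ring_nf

section LeadingCoefficient

variable {l : ℝ}

theorem hasDerivAt_heatMean (hl0 : 0 ≤ l) (hl : l ≤ 2 * Real.pi ^ 2 / 3) {t : ℝ} (ht : 0 < t) :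
    HasDerivAt (heatMean l) (-(profileMean l t / t)) t := by
  have hc := continuous_symb l
  have hb : ∀ p : ℝ × ℝ, symb l p.1 p.2 ≤ 1 := fun p => by
    refine (symb_le hl0 _ _).trans ?_
    rw [div_le_one (by positivity)]
    nlinarith [Real.pi_gt_three]
  have h := hasDerivAt_integral_of_dominated_loc_of_deriv_le (μ := volume.restrict square)
    (F := fun t (p : ℝ × ℝ) => Real.exp (-(t * symb l p.1 p.2)))
    (F' := fun t (p : ℝ × ℝ) => -(symb l p.1 p.2 * Real.exp (-(t * symb l p.1 p.2))))
    (bound := fun _ => 1) (x₀ := t) (s := Ioi 0) (Ioi_mem_nhds ht)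
    (Eventually.of_forall fun t => Continuous.aestronglyMeasurable (by fun_prop))
    (integrableOn_square (by fun_prop)) (Continuous.aestronglyMeasurable (by fun_prop))
    (ae_of_all _ fun p u (hu : 0 < u) => ?_) (integrableOn_square continuous_const)
    (ae_of_all _ fun p u _ => ?_)
  · refine h.2.congr_deriv ?_
    rw [profileMean, integral_neg, ← integral_div]
    congr 1
    refine integral_congr_ae (ae_of_all _ fun p => ?_)
    simp only [profile]
    field_simp
  · have h0 := symb_nonneg hl p.1 p.2
    rw [norm_neg, Real.norm_of_nonneg (by positivity)]
    refine mul_le_one₀ (hb p) (Real.exp_pos _).le ?_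
    rw [Real.exp_le_one_iff]
    have : 0 ≤ u * symb l p.1 p.2 := by positivity
    linarith
  · have h1 : HasDerivAt (fun u : ℝ => -(u * symb l p.1 p.2)) (-(1 * symb l p.1 p.2)) u :=
      ((hasDerivAt_id u).mul_const _).neg
    refine h1.exp.congr_deriv ?_
    ring

theorem continuousOn_heatMean (hl0 : 0 ≤ l) (hl : l ≤ 2 * Real.pi ^ 2 / 3) :
    ContinuousOn (heatMean l) (Ioi 0) := fun _ ht =>
  (hasDerivAt_heatMean hl0 hl ht).continuousAt.continuousWithinAt

theorem continuousOn_profileMean (hl : l ≤ 2 * Real.pi ^ 2 / 3) :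
    ContinuousOn (profileMean l) (Ioi 0) := by
  have hc := continuous_symb l
  have hp := continuous_profile
  refine continuousOn_of_dominated (bound := fun _ => 1)
    (fun t _ => Continuous.aestronglyMeasurable (by fun_prop)) (fun t ht => ae_of_all _ fun p => ?_)
    (integrableOn_square continuous_const)
    (ae_of_all _ fun p => Continuous.continuousOn (by fun_prop))
  rw [Real.norm_of_nonneg (profile_nonneg (mul_nonneg (le_of_lt ht) (symb_nonneg hl _ _)))]
  exact profile_le_one _

theorem heatMean_nonneg (l t : ℝ) : 0 ≤ heatMean l t :=
  integral_nonneg fun _ => (Real.exp_pos _).le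

theorem heatMean_le_one (hl : l ≤ 2 * Real.pi ^ 2 / 3) {t : ℝ} (ht : 0 ≤ t) :
    heatMean l t ≤ 1 := by
  have hc := continuous_symb l
  have h : heatMean l t ≤ ∫ p in square, (1 : ℝ) := by
    refine setIntegral_mono (integrableOn_square (by fun_prop))
      (integrableOn_square continuous_const) fun p => ?_
    rw [Real.exp_le_one_iff]
    have := mul_nonneg ht (symb_nonneg hl p.1 p.2)
    linarith
  refine h.trans_eq ?_
  simp [measureReal_def, volume_square]

theorem integrable_gaussian_prod {b : ℝ} (hb : 0 < b) :
    Integrable fun p : ℝ × ℝ => Real.exp (-(b * (p.1 ^ 2 + p.2 ^ 2))) := by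
  have h := (integrable_exp_neg_mul_sq hb).mul_prod (integrable_exp_neg_mul_sq hb)
  refine h.congr (ae_of_all _ fun p => ?_)
  simp only [← Real.exp_add]
  congr 1; ring

theorem integral_gaussian_prod {b : ℝ} (hb : 0 < b) :
    ∫ p : ℝ × ℝ, Real.exp (-(b * (p.1 ^ 2 + p.2 ^ 2))) = Real.pi / b := by
  have h := integral_prod_mul (μ := volume) (ν := volume) (fun x : ℝ => Real.exp (-b * x ^ 2))
    (fun x : ℝ => Real.exp (-b * x ^ 2))
  rw [integral_gaussian, Real.mul_self_sqrt (by positivity)] at h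
  rw [← h]
  refine integral_congr_ae (ae_of_all _ fun p => ?_)
  simp only [← Real.exp_add]
  congr 1; ring

theorem heatMean_le_div (hl : l ≤ 2 * Real.pi ^ 2 / 3) {t : ℝ} (ht : 0 < t) :
    heatMean l t ≤ 4 * Real.pi / t := by
  have hc := continuous_symb l
  have hi := integrable_gaussian_prod (b := t / 4) (by positivity)
  calc heatMean l t ≤ ∫ p in square, Real.exp (-(t / 4 * (p.1 ^ 2 + p.2 ^ 2))) := by
        refine setIntegral_mono_on (integrableOn_square (by fun_prop)) hi.integrableOn
          measurableSet_square fun p hp => ?_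
        rw [Real.exp_le_exp, neg_le_neg_iff]
        have h := symb_ge_normSq hl (abs_le.mpr (Ioc_subset_Icc_self hp.1))
          (abs_le.mpr (Ioc_subset_Icc_self hp.2))
        nlinarith
    _ ≤ ∫ p : ℝ × ℝ, Real.exp (-(t / 4 * (p.1 ^ 2 + p.2 ^ 2))) :=
        setIntegral_le_integral hi (ae_of_all _ fun p => (Real.exp_pos _).le)
    _ = _ := by rw [integral_gaussian_prod (by positivity)]; field_simp

theorem profileMean_nonneg (hl : l ≤ 2 * Real.pi ^ 2 / 3) {t : ℝ} (ht : 0 ≤ t) :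
    0 ≤ profileMean l t :=
  integral_nonneg fun _ => profile_nonneg (mul_nonneg ht (symb_nonneg hl _ _))

theorem profileMean_le (l t : ℝ) : profileMean l t ≤ 2 * heatMean l (t / 2) := by
  have hc := continuous_symb l
  have hp := continuous_profile
  rw [heatMean, ← integral_const_mul]
  refine setIntegral_mono (integrableOn_square (by fun_prop)) (integrableOn_square (by fun_prop))
    fun p => (profile_le_exp _).trans_eq ?_
  congr 2; ring

theorem heatMean_isBigO_atTop (hl : l ≤ 2 * Real.pi ^ 2 / 3) :
    heatMean l =O[atTop] fun t => t ^ (-1 : ℝ) := by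
  refine IsBigO.of_bound (4 * Real.pi) ?_
  filter_upwards [eventually_gt_atTop 0] with t ht
  rw [Real.rpow_neg_one, Real.norm_of_nonneg (heatMean_nonneg l t),
    Real.norm_of_nonneg (by positivity), ← div_eq_mul_inv]
  exact heatMean_le_div hl ht

theorem heatMean_isBigO_zero (hl : l ≤ 2 * Real.pi ^ 2 / 3) :
    heatMean l =O[𝓝[>] 0] fun t => t ^ (-0 : ℝ) := by
  refine IsBigO.of_bound 1 ?_
  filter_upwards [self_mem_nhdsWithin] with t (ht : 0 < t)
  rw [neg_zero, Real.rpow_zero, Real.norm_of_nonneg (heatMean_nonneg l t), norm_one, mul_one]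
  exact heatMean_le_one hl ht.le

theorem profileMean_isBigO_atTop (hl : l ≤ 2 * Real.pi ^ 2 / 3) :
    profileMean l =O[atTop] fun t => t ^ (-1 : ℝ) := by
  refine IsBigO.of_bound (16 * Real.pi) ?_
  filter_upwards [eventually_gt_atTop 0] with t ht
  rw [Real.rpow_neg_one, Real.norm_of_nonneg (profileMean_nonneg hl ht.le),
    Real.norm_of_nonneg (by positivity), ← div_eq_mul_inv]
  refine (profileMean_le l t).trans ?_
  have := heatMean_le_div hl (half_pos ht)
  calc 2 * heatMean l (t / 2) ≤ 2 * (4 * Real.pi / (t / 2)) := by gcongr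
    _ = _ := by field_simp; ring

theorem profileMean_isBigO_zero (hl : l ≤ 2 * Real.pi ^ 2 / 3) :
    profileMean l =O[𝓝[>] 0] fun t => t ^ (-0 : ℝ) := by
  refine IsBigO.of_bound 2 ?_
  filter_upwards [self_mem_nhdsWithin] with t (ht : 0 < t)
  rw [neg_zero, Real.rpow_zero, Real.norm_of_nonneg (profileMean_nonneg hl ht.le), norm_one]
  have := heatMean_le_one hl (half_pos ht).le
  have := profileMean_le l t
  linarith

theorem mellinConvergent_profileMean (hl : l ≤ 2 * Real.pi ^ 2 / 3) {s : ℂ} (h0 : 0 < s.re)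
    (h1 : s.re < 1) : MellinConvergent (fun t => ((profileMean l t : ℝ) : ℂ)) s :=
  mellinConvergent_of_isBigO_rpow
    ((Complex.continuous_ofReal.comp_continuousOn
      (continuousOn_profileMean hl)).locallyIntegrableOn measurableSet_Ioi)
    (Complex.isBigO_ofReal_left.mpr (profileMean_isBigO_atTop hl)) h1
    (Complex.isBigO_ofReal_left.mpr (profileMean_isBigO_zero hl)) h0

theorem mellin_profileMean (hl0 : 0 ≤ l) (hl : l ≤ 2 * Real.pi ^ 2 / 3) {s : ℂ} (h0 : 0 < s.re)
    (h1 : s.re < 1) : mellin (fun t => ((profileMean l t : ℝ) : ℂ)) s =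
      s * mellin (fun t => ((heatMean l t : ℝ) : ℂ)) s := by
  have hconv : MellinConvergent (fun t => ((heatMean l t : ℝ) : ℂ)) s :=
    mellinConvergent_of_isBigO_rpow
      ((Complex.continuous_ofReal.comp_continuousOn
        (continuousOn_heatMean hl0 hl)).locallyIntegrableOn measurableSet_Ioi)
      (Complex.isBigO_ofReal_left.mpr (heatMean_isBigO_atTop hl)) h1
      (Complex.isBigO_ofReal_left.mpr (heatMean_isBigO_zero hl)) h0
  have e : ∀ t ∈ Ioi (0 : ℝ), (t : ℂ) ^ (s + 1 - 1) • ((-(profileMean l t / t) : ℝ) : ℂ) =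
      -((t : ℂ) ^ (s - 1) • ((profileMean l t : ℝ) : ℂ)) := by
    intro t ht
    have ht' : (t : ℂ) ≠ 0 := by exact_mod_cast (ne_of_gt ht)
    rw [add_sub_cancel_right, Complex.cpow_sub _ _ ht', Complex.cpow_one]
    push_cast
    simp only [smul_eq_mul]
    field_simp
  have hc' : MellinConvergent (fun t => ((-(profileMean l t / t) : ℝ) : ℂ)) (s + 1) := by
    refine IntegrableOn.congr_fun ?_ (fun t ht => (e t ht).symm) measurableSet_Ioi
    exact (mellinConvergent_profileMean hl h0 h1).neg
  have hnorm : ∀ t : ℝ, 0 < t → ‖(t : ℂ) ^ s * ((heatMean l t : ℝ) : ℂ)‖ =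
      t ^ s.re * heatMean l t := by
    intro t ht
    rw [norm_mul, Complex.norm_cpow_eq_rpow_re_of_pos ht, Complex.norm_real,
      Real.norm_of_nonneg (heatMean_nonneg l t)]
  have key := mellin_deriv (f := fun t => ((heatMean l t : ℝ) : ℂ))
    (fun t ht => (hasDerivAt_heatMean hl0 hl ht).ofReal_comp) hconv hc' ?_ ?_
  · rw [← neg_inj, ← key, mellin, mellin, ← integral_neg]
    exact (setIntegral_congr_fun measurableSet_Ioi e).symm
  · rw [tendsto_zero_iff_norm_tendsto_zero]
    have h2 : Tendsto (fun t : ℝ => t ^ s.re) (𝓝[>] 0) (𝓝 0) := by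
      have := (Real.continuousAt_rpow_const 0 s.re (Or.inr h0.le)).tendsto
      rw [Real.zero_rpow h0.ne'] at this
      exact this.mono_left nhdsWithin_le_nhds
    refine squeeze_zero' (Eventually.of_forall fun t => norm_nonneg _) ?_ h2
    filter_upwards [self_mem_nhdsWithin] with t (ht : 0 < t)
    rw [hnorm t ht]
    exact mul_le_of_le_one_right (by positivity) (heatMean_le_one hl ht.le)
  · rw [tendsto_zero_iff_norm_tendsto_zero]
    have h2 := (tendsto_rpow_neg_atTop (show 0 < 1 - s.re by linarith)).const_mul (4 * Real.pi)
    rw [mul_zero] at h2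
    refine squeeze_zero' (Eventually.of_forall fun t => norm_nonneg _) ?_ h2
    filter_upwards [eventually_gt_atTop 0] with t ht
    rw [hnorm t ht]
    calc t ^ s.re * heatMean l t ≤ t ^ s.re * (4 * Real.pi / t) := by
          gcongr; exact heatMean_le_div hl ht
      _ = _ := by
          rw [show -(1 - s.re) = s.re - 1 by ring, Real.rpow_sub_one ht.ne']; ring

theorem integral_inv_sq_eq_laplace (hl : l ≤ 2 * Real.pi ^ 2 / 3) {z : ℝ} (hz : 0 < z) :
    ∫ x in (0 : ℝ)..1, ∫ y in (0 : ℝ)..1, ((symb l x y + z ^ 2) ^ 2)⁻¹ =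
      ∫ t in Ioi (0 : ℝ), Real.exp (-(t * z ^ 2)) * (t * heatMean l t) := by
  have hc := continuous_symb l
  have hpos (p : ℝ × ℝ) : 0 < symb l p.1 p.2 + z ^ 2 := by
    have := symb_nonneg hl p.1 p.2
    positivity
  have hg (r : ℝ) (hr : 0 < r) : IntegrableOn (fun t : ℝ => t * Real.exp (-(r * t))) (Ioi 0) ∧
      ∫ t in Ioi (0 : ℝ), t * Real.exp (-(r * t)) = (r ^ 2)⁻¹ := by
    have h1 := Real.integral_rpow_mul_exp_neg_mul_Ioi (a := 2) (r := r) two_pos hr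
    have h2 : ∀ t : ℝ, t ^ ((2 : ℝ) - 1) = t := fun t => by norm_num
    simp only [h2] at h1
    have h3 : (1 / r) ^ (2 : ℝ) * Real.Gamma 2 = (r ^ 2)⁻¹ := by
      rw [Real.rpow_two, Real.Gamma_two]; simp
    rw [h3] at h1
    refine ⟨?_, h1⟩
    by_contra hni
    rw [integral_undef hni] at h1
    have : (0 : ℝ) < (r ^ 2)⁻¹ := by positivity
    linarith
  rw [← setIntegral_square (g := fun v => ((v + z ^ 2) ^ 2)⁻¹)
    (Continuous.inv₀ (by fun_prop) fun p => (pow_pos (hpos p) 2).ne')]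
  have h1 : ∀ p : ℝ × ℝ, ((symb l p.1 p.2 + z ^ 2) ^ 2)⁻¹ =
      ∫ t in Ioi (0 : ℝ), t * Real.exp (-((symb l p.1 p.2 + z ^ 2) * t)) := fun p =>
    ((hg _ (hpos p)).2).symm
  simp only [h1]
  rw [integral_integral_swap]
  · refine setIntegral_congr_fun measurableSet_Ioi fun t _ => ?_
    simp only [heatMean]
    rw [← mul_assoc, ← integral_const_mul]
    refine integral_congr_ae (ae_of_all _ fun p => ?_)
    simp only
    rw [mul_comm (Real.exp _) t, mul_assoc, ← Real.exp_add]
    congr 2; ring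
  · have h2 : Integrable (fun q : (ℝ × ℝ) × ℝ => (1 : ℝ) * (q.2 * Real.exp (-(z ^ 2 * q.2))))
        ((volume.restrict square).prod (volume.restrict (Ioi 0))) :=
      (integrableOn_square continuous_const).mul_prod (hg (z ^ 2) (by positivity)).1
    refine h2.mono (Continuous.aestronglyMeasurable (by fun_prop)) ?_
    rw [Measure.prod_restrict]
    refine (ae_restrict_iff' (measurableSet_square.prod measurableSet_Ioi)).mpr
      (ae_of_all _ fun q hq => ?_)
    have hq2 : 0 < q.2 := hq.2
    simp only [Function.uncurry]
    rw [Real.norm_of_nonneg (by positivity), Real.norm_of_nonneg (by positivity), one_mul]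
    have := symb_nonneg hl q.1.1 q.1.2
    gcongr
    linarith

theorem V_two {s : ℂ} (h0 : 0 < s.re) (h1 : s.re < 1) :
    V 2 s = 2 / (Complex.Gamma s * Complex.Gamma (2 - s)) := by
  have hG := Complex.Gamma_mul_Gamma_one_sub s
  have hs : Complex.Gamma s ≠ 0 := Complex.Gamma_ne_zero_of_re_pos h0
  have h1s : Complex.Gamma (1 - s) ≠ 0 := Complex.Gamma_ne_zero_of_re_pos (by simp; linarith)
  have hpi : (Real.pi : ℂ) ≠ 0 := by exact_mod_cast Real.pi_ne_zero
  have hsin : Complex.sin (Real.pi * s) ≠ 0 := by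
    intro h
    rw [h, div_zero] at hG
    exact mul_ne_zero hs h1s hG
  have h2 : Complex.sin (Real.pi * s) / Real.pi =
      (Complex.Gamma s * Complex.Gamma (1 - s))⁻¹ := by
    rw [hG, inv_div]
  have h3 : Complex.Gamma ((2 : ℕ) : ℂ) = 1 := by simp
  rw [V, h2, h3]
  push_cast
  field_simp

/-- Up to elementary factors, the leading coefficient is the Mellin transform of the mean of the
profile of the symbol: both are Mellin transforms of `heatMean`. -/
theorem leadingIntegrand_integral (hl0 : 0 ≤ l) (hl : l ≤ 2 * Real.pi ^ 2 / 3) {s : ℂ}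
    (h0 : 0 < s.re) (h1 : s.re < 1) :
    IntegrableOn (leadingIntegrand (symb l) s) (Ioi 0) ∧
      V 2 s * ∫ z in Ioi 0, leadingIntegrand (symb l) s z =
        (Complex.Gamma (s + 1))⁻¹ * mellin (fun t => ((profileMean l t : ℝ) : ℂ)) s := by
  have hα : 0 < (2 - s).re := by simp; linarith
  have hcont : ContinuousOn (fun t => t * heatMean l t) (Ioi 0) :=
    continuousOn_id.mul (continuousOn_heatMean hl0 hl)
  have hint : IntegrableOn (fun t => t ^ (-(2 - s).re) * (t * heatMean l t)) (Ioi 0) := by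
    have h := mellin_convergent_of_isBigO_scalar (s := s.re)
      ((continuousOn_heatMean hl0 hl).locallyIntegrableOn measurableSet_Ioi)
      (heatMean_isBigO_atTop hl) h1 (heatMean_isBigO_zero hl) h0
    refine h.congr_fun (fun t ht => ?_) measurableSet_Ioi
    have ht' : (0 : ℝ) < t := ht
    simp only [← mul_assoc]
    congr 1
    rw [← Real.rpow_add_one ht'.ne']
    congr 1
    simp; ring
  have h := mellin_laplace_sq hα hcont hint
  have he : ∀ z ∈ Ioi (0 : ℝ), (z : ℂ) ^ (2 * (2 - s) - 1) •
      ((∫ t in Ioi (0 : ℝ), Real.exp (-(t * z ^ 2)) * (t * heatMean l t) : ℝ) : ℂ) =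
        leadingIntegrand (symb l) s z := by
    intro z hz
    rw [leadingIntegrand, integral_inv_sq_eq_laplace hl hz, smul_eq_mul]
    congr 2; ring
  refine ⟨h.1.congr_fun he measurableSet_Ioi, ?_⟩
  rw [← setIntegral_congr_fun measurableSet_Ioi he]
  have h2 := h.2
  rw [mellin] at h2
  rw [h2, mellin_profileMean hl0 hl h0 h1, V_two h0 h1]
  have h3 : ∫ t in Ioi (0 : ℝ), (t : ℂ) ^ (-(2 - s)) * ((t * heatMean l t : ℝ) : ℂ) =
      mellin (fun t => ((heatMean l t : ℝ) : ℂ)) s := by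
    refine setIntegral_congr_fun measurableSet_Ioi fun t ht => ?_
    have ht' : (t : ℂ) ≠ 0 := by exact_mod_cast (ne_of_gt ht)
    have : s - 1 = -(2 - s) + 1 := by ring
    rw [this, Complex.cpow_add _ _ ht', Complex.cpow_one]
    push_cast
    simp only [smul_eq_mul]
    ring
  have hs0 : s ≠ 0 := by rintro rfl; simp at h0
  have hG := Complex.Gamma_ne_zero_of_re_pos h0
  have hG2 := Complex.Gamma_ne_zero_of_re_pos hα
  rw [h3, Complex.Gamma_add_one s hs0]
  field_simp

end LeadingCoefficient

/-! ### Lattice sums and integrals of Gaussian polynomials -/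

theorem integral_pow_mul_gaussian (a : ℕ) {τ : ℝ} (hτ : 0 < τ) :
    Integrable (fun x : ℝ => (τ * x ^ 2) ^ a * Real.exp (-(τ * x ^ 2))) ∧
      ∫ x : ℝ, (τ * x ^ 2) ^ a * Real.exp (-(τ * x ^ 2)) =
        gaussMoment a * τ ^ (-(1 / 2) : ℝ) := by
  have hexp : ∀ x : ℝ, x ^ (((2 * a : ℕ) : ℝ)) = x ^ (2 * a) := fun x => Real.rpow_natCast _ _
  have hi := integrable_rpow_mul_exp_neg_mul_sq hτ (s := ((2 * a : ℕ) : ℝ))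
    (by have : (0 : ℝ) ≤ ((2 * a : ℕ) : ℝ) := Nat.cast_nonneg _; linarith)
  have h := integral_rpow_mul_exp_neg_mul_rpow (p := 2) (q := ((2 * a : ℕ) : ℝ)) two_pos
    (by have : (0 : ℝ) ≤ ((2 * a : ℕ) : ℝ) := Nat.cast_nonneg _; linarith) hτ
  simp only [hexp, Real.rpow_two] at hi h
  have e : ∀ x : ℝ, (τ * x ^ 2) ^ a * Real.exp (-(τ * x ^ 2)) =
      τ ^ a * (x ^ (2 * a) * Real.exp (-τ * x ^ 2)) := fun x => by
    rw [mul_pow, ← pow_mul, mul_assoc, neg_mul]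
  simp only [e]
  refine ⟨hi.const_mul _, ?_⟩
  have habs : ∀ x : ℝ, x ^ (2 * a) * Real.exp (-τ * x ^ 2) =
      |x| ^ (2 * a) * Real.exp (-τ * |x| ^ 2) := fun x => by
    rw [pow_mul |x|, sq_abs, ← pow_mul]
  rw [integral_const_mul, show (fun x : ℝ => x ^ (2 * a) * Real.exp (-τ * x ^ 2)) =
    fun x => |x| ^ (2 * a) * Real.exp (-τ * |x| ^ 2) from funext habs,
    integral_comp_abs (f := fun x => x ^ (2 * a) * Real.exp (-τ * x ^ 2)), h,
    gaussMoment]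
  have h1 : (((2 * a : ℕ) : ℝ) + 1) / 2 = a + 1 / 2 := by push_cast; ring
  have h2 : -(((2 * a : ℕ) : ℝ) + 1) / 2 = -(1 / 2) - a := by push_cast; ring
  rw [h1, h2, Real.rpow_sub hτ, Real.rpow_natCast]
  field_simp

theorem evalSq_eq_sum (q : MvPolynomial (Fin 2) ℝ) (τ x y : ℝ) :
    evalSq q τ x y =
      ∑ d ∈ q.support, q.coeff d * ((τ * x ^ 2) ^ d 0 * (τ * y ^ 2) ^ d 1) := by
  rw [evalSq, MvPolynomial.eval_eq']
  simp [Fin.prod_univ_two]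

theorem integral_evalSq (q : MvPolynomial (Fin 2) ℝ) {τ : ℝ} (hτ : 0 < τ) :
    Integrable (fun p : ℝ × ℝ => Real.exp (-(τ * p.1 ^ 2 + τ * p.2 ^ 2)) * evalSq q τ p.1 p.2) ∧
      ∫ p : ℝ × ℝ, Real.exp (-(τ * p.1 ^ 2 + τ * p.2 ^ 2)) * evalSq q τ p.1 p.2 =
        τ⁻¹ * ∑ d ∈ q.support, q.coeff d * (gaussMoment (d 0) * gaussMoment (d 1)) := by
  have e : ∀ p : ℝ × ℝ, Real.exp (-(τ * p.1 ^ 2 + τ * p.2 ^ 2)) * evalSq q τ p.1 p.2 =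
      ∑ d ∈ q.support, q.coeff d * (((τ * p.1 ^ 2) ^ d 0 * Real.exp (-(τ * p.1 ^ 2))) *
        ((τ * p.2 ^ 2) ^ d 1 * Real.exp (-(τ * p.2 ^ 2)))) := fun p => by
    rw [evalSq_eq_sum, Finset.mul_sum]
    refine Finset.sum_congr rfl fun d _ => ?_
    rw [neg_add, Real.exp_add]; ring
  have hi (d : Fin 2 →₀ ℕ) : Integrable (fun p : ℝ × ℝ =>
      ((τ * p.1 ^ 2) ^ d 0 * Real.exp (-(τ * p.1 ^ 2))) *
        ((τ * p.2 ^ 2) ^ d 1 * Real.exp (-(τ * p.2 ^ 2)))) :=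
    (integral_pow_mul_gaussian (d 0) hτ).1.mul_prod (integral_pow_mul_gaussian (d 1) hτ).1
  have hi' : ∀ d ∈ q.support, Integrable (fun p : ℝ × ℝ => q.coeff d *
      (((τ * p.1 ^ 2) ^ d 0 * Real.exp (-(τ * p.1 ^ 2))) *
        ((τ * p.2 ^ 2) ^ d 1 * Real.exp (-(τ * p.2 ^ 2))))) := fun d _ => (hi d).const_mul _
  simp only [e]
  refine ⟨integrable_finsetSum _ hi', ?_⟩
  rw [integral_finsetSum _ hi', Finset.mul_sum]
  refine Finset.sum_congr rfl fun d _ => ?_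
  have := integral_prod_mul (μ := volume) (ν := volume)
    (fun x : ℝ => (τ * x ^ 2) ^ d 0 * Real.exp (-(τ * x ^ 2)))
    (fun x : ℝ => (τ * x ^ 2) ^ d 1 * Real.exp (-(τ * x ^ 2)))
  rw [integral_const_mul, Measure.volume_eq_prod, this, (integral_pow_mul_gaussian (d 0) hτ).2,
    (integral_pow_mul_gaussian (d 1) hτ).2]
  have h1 : τ ^ (-(1 / 2) : ℝ) * τ ^ (-(1 / 2) : ℝ) = τ⁻¹ := by
    rw [← Real.rpow_add hτ, ← Real.rpow_neg_one]; norm_num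
  rw [← h1]; ring

theorem hasSum_theta_mul (a b : ℕ) {u : ℝ} (hu : 0 < u) :
    HasSum (fun k : ℤ × ℤ => ((k.1 : ℝ) ^ (2 * a) * Real.exp (-(u * (k.1 : ℝ) ^ 2))) *
      ((k.2 : ℝ) ^ (2 * b) * Real.exp (-(u * (k.2 : ℝ) ^ 2)))) (theta a u * theta b u) := by
  have h1 := summable_theta a hu
  have h2 := summable_theta b hu
  exact h1.hasSum.mul h2.hasSum (summable_mul_of_summable_norm h1.norm h2.norm)

theorem hasSum_evalSq (q : MvPolynomial (Fin 2) ℝ) {u : ℝ} (hu : 0 < u) :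
    HasSum (fun k : ℤ × ℤ => Real.exp (-(u * (k.1 : ℝ) ^ 2 + u * (k.2 : ℝ) ^ 2)) *
        evalSq q u k.1 k.2)
      (∑ d ∈ q.support, q.coeff d * (u ^ (d 0 + d 1) * (theta (d 0) u * theta (d 1) u))) := by
  have h := hasSum_sum (s := q.support) fun d _ =>
    ((hasSum_theta_mul (d 0) (d 1) hu).mul_left (u ^ (d 0 + d 1))).mul_left (q.coeff d)
  refine h.congr_fun fun k => ?_
  rw [evalSq_eq_sum, Finset.mul_sum]
  refine Finset.sum_congr rfl fun d _ => ?_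
  rw [neg_add, Real.exp_add, mul_pow, mul_pow, pow_add, pow_mul, pow_mul]
  ring

/-- The difference between the lattice sum and the integral of `exp (-u |x|²) q(u x₁², u x₂²)`. -/
noncomputable def polyRem (q : MvPolynomial (Fin 2) ℝ) (u : ℝ) : ℝ :=
  ∑ d ∈ q.support, q.coeff d * (u ^ (d 0 + d 1) * latticeRem (d 0) (d 1) u)

theorem polyRem_eq (q : MvPolynomial (Fin 2) ℝ) {u : ℝ} (hu : 0 < u) :
    polyRem q u =
      ∑ d ∈ q.support, q.coeff d * (u ^ (d 0 + d 1) * (theta (d 0) u * theta (d 1) u)) -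
        u⁻¹ * ∑ d ∈ q.support, q.coeff d * (gaussMoment (d 0) * gaussMoment (d 1)) := by
  rw [polyRem, Finset.mul_sum, ← Finset.sum_sub_distrib]
  refine Finset.sum_congr rfl fun d _ => ?_
  rw [latticeRem, pow_succ]
  field_simp

theorem continuousOn_polyRem (q : MvPolynomial (Fin 2) ℝ) : ContinuousOn (polyRem q) (Ioi 0) := by
  unfold polyRem
  refine continuousOn_finsetSum _ fun d _ => continuousOn_const.mul
    ((continuousOn_id.pow _).mul (continuousOn_latticeRem _ _))

theorem flat_polyRem (q : MvPolynomial (Fin 2) ℝ) : Flat (polyRem q) := by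
  intro K
  have h (d : Fin 2 →₀ ℕ) : (fun u : ℝ => q.coeff d * (u ^ (d 0 + d 1) *
      latticeRem (d 0) (d 1) u)) =O[𝓝[>] 0] fun u => u ^ K := by
    refine IsBigO.const_mul_left ?_ _
    have h1 : (fun u : ℝ => u ^ (d 0 + d 1)) =O[𝓝[>] 0] fun _ => (1 : ℝ) := by
      refine IsBigO.of_bound 1 ?_
      filter_upwards [Ioo_mem_nhdsGT (zero_lt_one' ℝ)] with u hu
      rw [norm_one, mul_one, Real.norm_of_nonneg (pow_nonneg hu.1.le _)]
      exact pow_le_one₀ hu.1.le hu.2.le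
    simpa using h1.mul (flat_latticeRem (d 0) (d 1) K)
  exact IsBigO.fun_sum fun d _ => h d

theorem Flat.exists_le {f : ℝ → ℝ} (hf : Flat f) (hc : ContinuousOn f (Ioi 0)) (K : ℕ) :
    ∃ C, 0 ≤ C ∧ ∀ u, 0 < u → u ≤ 1 → |f u| ≤ C * u ^ K := by
  obtain ⟨C₁, hC₁, h1⟩ := (hf K).exists_pos
  rw [IsBigOWith_def] at h1
  obtain ⟨δ, hδ, h1⟩ := mem_nhdsGT_iff_exists_Ioo_subset.mp h1
  have hδ : 0 < δ := hδ
  obtain ⟨C₂, h2⟩ := (isCompact_Icc (a := δ) (b := 1)).exists_bound_of_continuousOn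
    (hc.mono fun x hx => lt_of_lt_of_le hδ hx.1)
  refine ⟨max C₁ (max C₂ 0 * (δ ^ K)⁻¹), by positivity, fun u h0 hu1 => ?_⟩
  rcases lt_or_ge u δ with h | h
  · have h3 : ‖f u‖ ≤ C₁ * ‖u ^ K‖ := h1 ⟨h0, h⟩
    rw [Real.norm_eq_abs, Real.norm_of_nonneg (by positivity)] at h3
    exact h3.trans (by gcongr; exact le_max_left _ _)
  · have h3 := h2 u ⟨h, hu1⟩
    rw [Real.norm_eq_abs] at h3
    calc |f u| ≤ max C₂ 0 := h3.trans (le_max_left _ _)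
      _ = max C₂ 0 * (δ ^ K)⁻¹ * δ ^ K := by field_simp
      _ ≤ max C₁ (max C₂ 0 * (δ ^ K)⁻¹) * u ^ K := by
          gcongr; exact le_max_right _ _

theorem theta_zero_le : ∃ C, 0 ≤ C ∧ ∀ u, 0 < u → theta 0 u ≤ C * (1 + u⁻¹) := by
  have hs : Summable fun k : ℤ => 1 / (k : ℝ) ^ 2 := Real.summable_one_div_int_pow.mpr one_lt_two
  have hS : 0 ≤ ∑' k : ℤ, 1 / (k : ℝ) ^ 2 := tsum_nonneg fun k => by positivity
  refine ⟨1 + ∑' k : ℤ, 1 / (k : ℝ) ^ 2, by positivity, fun u hu => ?_⟩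
  have h1 : HasSum (fun k : ℤ => (if k = 0 then (1 : ℝ) else 0) + u⁻¹ * (1 / (k : ℝ) ^ 2))
      (1 + u⁻¹ * ∑' k : ℤ, 1 / (k : ℝ) ^ 2) := (hasSum_ite_eq 0 1).add (hs.hasSum.mul_left _)
  have h2 : theta 0 u ≤ 1 + u⁻¹ * ∑' k : ℤ, 1 / (k : ℝ) ^ 2 := by
    rw [← h1.tsum_eq]
    refine (summable_theta 0 hu).tsum_le_tsum (fun k => ?_) h1.summable
    rw [mul_zero, pow_zero, one_mul]
    rcases eq_or_ne k 0 with rfl | hk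
    · simp
    · rw [if_neg hk, zero_add]
      have hk' : (0 : ℝ) < (k : ℝ) ^ 2 := by
        have : (k : ℝ) ≠ 0 := by exact_mod_cast hk
        positivity
      have := profile_le_one (u * (k : ℝ) ^ 2)
      rw [profile] at this
      rw [one_div, ← mul_inv, ← one_div, le_div_iff₀ (by positivity), mul_comm]
      exact this
  have hu' : 0 < u⁻¹ := by positivity
  nlinarith

/-! ### The expansion for large times -/

section LargeTimes

variable {n : ℕ} [NeZero n]

theorem sinSq_valMinAbs (j : ZMod n) : sinSq (j.valMinAbs / n) = sinSq (j.val / n) := by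
  have hn : (n : ℝ) ≠ 0 := by exact_mod_cast NeZero.ne n
  rw [ZMod.valMinAbs_def_pos]
  split_ifs
  · simp
  · push_cast
    rw [sub_div, div_self hn]
    have := sinSq_periodic ((j.val : ℝ) / n - 1)
    rw [sub_add_cancel] at this
    exact this.symm

theorem mem_square_iff (k : ℤ × ℤ) :
    ((k.1 / n : ℝ), (k.2 / n : ℝ)) ∈ square ↔
      k.1 * 2 ∈ Ioc (-n : ℤ) n ∧ k.2 * 2 ∈ Ioc (-n : ℤ) n := by
  have hn : (0 : ℝ) < n := by exact_mod_cast Nat.pos_of_ne_zero (NeZero.ne n)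
  have h (k : ℤ) : (k / n : ℝ) ∈ Ioc (-(1 / 2) : ℝ) (1 / 2) ↔ k * 2 ∈ Ioc (-n : ℤ) n := by
    simp only [mem_Ioc]
    rw [lt_div_iff₀ hn, div_le_iff₀ hn]
    constructor
    · rintro ⟨h1, h2⟩
      constructor
      · have : (-n : ℝ) < k * 2 := by linarith
        exact_mod_cast this
      · have : (k * 2 : ℝ) ≤ n := by linarith
        exact_mod_cast this
    · rintro ⟨h1, h2⟩
      have h1' : (-n : ℝ) < k * 2 := by exact_mod_cast h1
      have h2' : (k * 2 : ℝ) ≤ n := by exact_mod_cast h2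
      constructor <;> linarith
  simp only [square, mem_prod, h]

/-- A sum over the discrete torus is a sum over the lattice points in a centred square. -/
theorem hasSum_square_indicator (l : ℝ) (g : ℝ → ℝ) :
    HasSum (fun k : ℤ × ℤ => square.indicator (fun p => g (symb l p.1 p.2))
      ((k.1 / n : ℝ), (k.2 / n : ℝ)))
      (∑ j : ZMod n × ZMod n, g (symb l (j.1.val / n) (j.2.val / n))) := by
  have hinj : Function.Injective fun j : ZMod n × ZMod n => (j.1.valMinAbs, j.2.valMinAbs) := by
    intro i j h
    simp only [Prod.mk.injEq, ZMod.valMinAbs_inj] at h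
    exact Prod.ext h.1 h.2
  rw [← hinj.hasSum_iff]
  · refine (hasSum_fintype _).congr_fun fun j => ?_
    simp only [Function.comp_apply]
    rw [indicator_of_mem]
    · simp only [symb, sinSq_valMinAbs]
    · exact (mem_square_iff (n := n) (j.1.valMinAbs, j.2.valMinAbs)).mpr
        ⟨ZMod.valMinAbs_mem_Ioc _, ZMod.valMinAbs_mem_Ioc _⟩
  · intro k hk
    refine indicator_of_notMem (fun h => hk ?_) _
    rw [mem_square_iff] at h
    refine ⟨((k.1 : ZMod n), (k.2 : ZMod n)), ?_⟩
    exact Prod.ext ((ZMod.valMinAbs_spec _ _).mpr ⟨rfl, h.1⟩)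
      ((ZMod.valMinAbs_spec _ _).mpr ⟨rfl, h.2⟩)

/-- The difference between the sum of the profile over the spectrum and its leading
approximation. -/
noncomputable def torusRem (l : ℝ) (n : ℕ) [NeZero n] (u : ℝ) : ℝ :=
  ∑ j : ZMod n × ZMod n, profile (n ^ 2 * u * symb l (j.1.val / n) (j.2.val / n)) -
    n ^ 2 * profileMean l (n ^ 2 * u)

theorem integral_truncEval (M : ℕ) (Ψ : PowerSeries (MvPolynomial (Fin 2) ℝ)) {τ : ℝ}
    (hτ : 0 < τ) :
    Integrable (fun p : ℝ × ℝ =>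
        Real.exp (-(τ * p.1 ^ 2 + τ * p.2 ^ 2)) * truncEval M Ψ τ p.1 p.2) ∧
      ∫ p : ℝ × ℝ, Real.exp (-(τ * p.1 ^ 2 + τ * p.2 ^ 2)) * truncEval M Ψ τ p.1 p.2 =
        ∑ m ∈ Finset.range M, τ⁻¹ ^ m * (τ⁻¹ * ∑ d ∈ (PowerSeries.coeff m Ψ).support,
          (PowerSeries.coeff m Ψ).coeff d * (gaussMoment (d 0) * gaussMoment (d 1))) := by
  have e : ∀ p : ℝ × ℝ, Real.exp (-(τ * p.1 ^ 2 + τ * p.2 ^ 2)) * truncEval M Ψ τ p.1 p.2 =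
      ∑ m ∈ Finset.range M, τ⁻¹ ^ m * (Real.exp (-(τ * p.1 ^ 2 + τ * p.2 ^ 2)) *
        evalSq (PowerSeries.coeff m Ψ) τ p.1 p.2) := fun p => by
    rw [truncEval, Finset.mul_sum]
    exact Finset.sum_congr rfl fun m _ => by ring
  have hi := fun m (_ : m ∈ Finset.range M) =>
    (integral_evalSq (PowerSeries.coeff m Ψ) hτ).1.const_mul (τ⁻¹ ^ m)
  simp only [e]
  refine ⟨integrable_finsetSum _ hi, ?_⟩
  rw [integral_finsetSum _ hi]
  refine Finset.sum_congr rfl fun m _ => ?_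
  rw [integral_const_mul, (integral_evalSq (PowerSeries.coeff m Ψ) hτ).2]

theorem hasSum_truncEval (M : ℕ) (Ψ : PowerSeries (MvPolynomial (Fin 2) ℝ)) {u : ℝ}
    (hu : 0 < u) :
    HasSum (fun k : ℤ × ℤ =>
        Real.exp (-(n ^ 2 * u * (k.1 / n : ℝ) ^ 2 + n ^ 2 * u * (k.2 / n : ℝ) ^ 2)) *
          truncEval M Ψ (n ^ 2 * u) (k.1 / n) (k.2 / n))
      (∑ m ∈ Finset.range M, (n ^ 2 * u)⁻¹ ^ m * ∑ d ∈ (PowerSeries.coeff m Ψ).support,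
          (PowerSeries.coeff m Ψ).coeff d *
            (u ^ (d 0 + d 1) * (theta (d 0) u * theta (d 1) u))) := by
  have hn : (n : ℝ) ≠ 0 := by exact_mod_cast NeZero.ne n
  have e (k : ℤ) : n ^ 2 * u * (k / n : ℝ) ^ 2 = u * (k : ℝ) ^ 2 := by field_simp
  have h := hasSum_sum (s := Finset.range M) fun m _ =>
    (hasSum_evalSq (PowerSeries.coeff m Ψ) hu).mul_left (((n : ℝ) ^ 2 * u)⁻¹ ^ m)
  refine h.congr_fun fun k => ?_
  rw [truncEval, Finset.mul_sum]
  refine Finset.sum_congr rfl fun m _ => ?_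
  simp only [evalSq, e]
  ring

/-- For `n² u ≥ 1`, the expansion of the profile of the symbol can be summed over the lattice and
integrated over the plane. -/
theorem torusRem_expansion {l : ℝ} (hl : l ≤ 2 * Real.pi ^ 2 / 3) (M : ℕ) :
    ∃ C, 0 ≤ C ∧ ∀ (n : ℕ) [NeZero n] (u : ℝ), 0 < u → 1 ≤ n ^ 2 * u →
      |torusRem l n u - ∑ m ∈ Finset.range M, (n ^ 2 * u)⁻¹ ^ m *
        polyRem (PowerSeries.coeff m (profileSeries l)) u| ≤
          C * (n ^ 2 * u)⁻¹ ^ M * (1 + u⁻¹) ^ 2 := by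
  obtain ⟨C, hC, h⟩ := profile_symb_expansion hl M
  obtain ⟨D, hD, hθ⟩ := theta_zero_le
  refine ⟨C * (64 * D ^ 2) + C * (8 * Real.pi), by positivity, fun n _ u hu hτ => ?_⟩
  have hn : (n : ℝ) ≠ 0 := by exact_mod_cast NeZero.ne n
  have hn' : (0 : ℝ) < n := by positivity
  set τ : ℝ := n ^ 2 * u with hτdef
  have hτ0 : 0 < τ := by positivity
  set Ψ := profileSeries l
  -- sum the pointwise remainder over the lattice points `k / n`
  have hsum := (hasSum_square_indicator (n := n) l (fun v => profile (τ * v))).sub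
    (hasSum_truncEval (n := n) M Ψ hu)
  rw [← hτdef] at hsum
  have hbound : HasSum (fun k : ℤ × ℤ => C * τ⁻¹ ^ M *
      Real.exp (-((τ * (k.1 / n : ℝ) ^ 2 + τ * (k.2 / n : ℝ) ^ 2) / 8)))
      (C * τ⁻¹ ^ M * (theta 0 (u / 8) * theta 0 (u / 8))) := by
    refine ((hasSum_theta_mul 0 0 (show 0 < u / 8 by positivity)).mul_left _).congr_fun fun k => ?_
    rw [mul_zero, pow_zero, pow_zero, one_mul, one_mul, ← Real.exp_add, hτdef]
    congr 2
    field_simp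
    ring
  have h1 := tsum_of_norm_bounded (f := fun k : ℤ × ℤ =>
    square.indicator (fun p => profile (τ * symb l p.1 p.2)) ((k.1 / n : ℝ), (k.2 / n : ℝ)) -
      Real.exp (-(τ * (k.1 / n : ℝ) ^ 2 + τ * (k.2 / n : ℝ) ^ 2)) *
        truncEval M Ψ τ (k.1 / n) (k.2 / n)) hbound (fun k => h τ (k.1 / n) (k.2 / n) hτ)
  rw [hsum.tsum_eq, Real.norm_eq_abs] at h1
  -- integrate the same remainder over the plane
  have hpc := continuous_profile
  have hsc := continuous_symb l
  have hint1 : Integrable (square.indicator fun p : ℝ × ℝ => profile (τ * symb l p.1 p.2)) :=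
    (integrableOn_square (by fun_prop)).integrable_indicator measurableSet_square
  have hint2 := integral_truncEval M Ψ hτ0
  have hint3 : Integrable fun p : ℝ × ℝ => C * τ⁻¹ ^ M *
      Real.exp (-((τ * p.1 ^ 2 + τ * p.2 ^ 2) / 8)) := by
    refine Integrable.const_mul ?_ _
    refine (integrable_gaussian_prod (b := τ / 8) (by positivity)).congr (ae_of_all _ fun p => ?_)
    simp only
    congr 2; ring
  have h2 := norm_integral_le_of_norm_le (f := fun p : ℝ × ℝ =>
    square.indicator (fun p => profile (τ * symb l p.1 p.2)) p -
      Real.exp (-(τ * p.1 ^ 2 + τ * p.2 ^ 2)) * truncEval M Ψ τ p.1 p.2) hint3 (ae_of_all _ fun p => h τ p.1 p.2 hτ)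
  rw [integral_sub hint1 hint2.1, integral_indicator measurableSet_square, hint2.2,
    integral_const_mul] at h2
  have h3 : ∫ p : ℝ × ℝ, Real.exp (-((τ * p.1 ^ 2 + τ * p.2 ^ 2) / 8)) = Real.pi / (τ / 8) := by
    rw [← integral_gaussian_prod (b := τ / 8) (by positivity)]
    refine integral_congr_ae (ae_of_all _ fun p => ?_)
    simp only
    congr 2; ring
  rw [h3, Real.norm_eq_abs] at h2
  change |profileMean l τ - _| ≤ _ at h2
  have hθ8 : theta 0 (u / 8) ≤ 8 * D * (1 + u⁻¹) := by
    refine (hθ (u / 8) (by positivity)).trans ?_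
    have : 0 < u⁻¹ := by positivity
    rw [inv_div, div_eq_mul_inv]
    nlinarith
  have hsq : theta 0 (u / 8) * theta 0 (u / 8) ≤ 64 * D ^ 2 * (1 + u⁻¹) ^ 2 := by
    have h0 := theta_nonneg 0 (u / 8)
    calc _ ≤ 8 * D * (1 + u⁻¹) * (8 * D * (1 + u⁻¹)) := by gcongr
      _ = _ := by ring
  set A := ∑ j : ZMod n × ZMod n, profile (τ * symb l (j.1.val / n) (j.2.val / n))
  set S : ℕ → ℝ := fun m => ∑ d ∈ (PowerSeries.coeff m Ψ).support,
    (PowerSeries.coeff m Ψ).coeff d * (u ^ (d 0 + d 1) * (theta (d 0) u * theta (d 1) u))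
  set G : ℕ → ℝ := fun m => ∑ d ∈ (PowerSeries.coeff m Ψ).support,
    (PowerSeries.coeff m Ψ).coeff d * (gaussMoment (d 0) * gaussMoment (d 1))
  have e1 : torusRem l n u - ∑ m ∈ Finset.range M, τ⁻¹ ^ m * polyRem (PowerSeries.coeff m Ψ) u =
      (A - ∑ m ∈ Finset.range M, τ⁻¹ ^ m * S m) -
        n ^ 2 * (profileMean l τ - ∑ m ∈ Finset.range M, τ⁻¹ ^ m * (τ⁻¹ * G m)) := by
    have : ∑ m ∈ Finset.range M, τ⁻¹ ^ m * polyRem (PowerSeries.coeff m Ψ) u =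
        ∑ m ∈ Finset.range M, τ⁻¹ ^ m * S m -
          n ^ 2 * ∑ m ∈ Finset.range M, τ⁻¹ ^ m * (τ⁻¹ * G m) := by
      rw [Finset.mul_sum, ← Finset.sum_sub_distrib]
      refine Finset.sum_congr rfl fun m _ => ?_
      rw [polyRem_eq _ hu, mul_sub]
      congr 1
      have : u⁻¹ = n ^ 2 * τ⁻¹ := by rw [hτdef]; field_simp
      rw [this]; ring
    rw [this, torusRem, ← hτdef]
    ring
  have hτM : 0 ≤ τ⁻¹ ^ M := by positivity
  have hui : 0 < u⁻¹ := by positivity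
  rw [e1]
  calc _ ≤ |A - ∑ m ∈ Finset.range M, τ⁻¹ ^ m * S m| +
        |n ^ 2 * (profileMean l τ - ∑ m ∈ Finset.range M, τ⁻¹ ^ m * (τ⁻¹ * G m))| := abs_sub _ _
    _ ≤ C * τ⁻¹ ^ M * (64 * D ^ 2 * (1 + u⁻¹) ^ 2) +
        n ^ 2 * (C * τ⁻¹ ^ M * (Real.pi / (τ / 8))) := by
        rw [abs_mul _ (profileMean l τ - _), abs_of_nonneg (by positivity : (0 : ℝ) ≤ n ^ 2)]
        gcongr
        exact h1.trans (by gcongr)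
    _ = C * (64 * D ^ 2) * τ⁻¹ ^ M * (1 + u⁻¹) ^ 2 + C * (8 * Real.pi) * τ⁻¹ ^ M * u⁻¹ := by
        have : n ^ 2 * (C * τ⁻¹ ^ M * (Real.pi / (τ / 8))) =
            C * (8 * Real.pi) * τ⁻¹ ^ M * u⁻¹ := by
          rw [hτdef]; field_simp
        rw [this]; ring
    _ ≤ C * (64 * D ^ 2) * τ⁻¹ ^ M * (1 + u⁻¹) ^ 2 +
        C * (8 * Real.pi) * τ⁻¹ ^ M * (1 + u⁻¹) ^ 2 := by
        gcongr
        nlinarith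
    _ = _ := by ring

end LargeTimes

/-! ### Mellin transforms of the remainders -/

theorem hasMellin_congr {f g : ℝ → ℂ} {s m : ℂ} (hf : HasMellin f s m)
    (h : ∀ t, 0 < t → f t = g t) : HasMellin g s m := by
  have e : EqOn (fun t : ℝ => (t : ℂ) ^ (s - 1) • f t) (fun t : ℝ => (t : ℂ) ^ (s - 1) • g t)
      (Ioi 0) := fun t ht => by simp only [h t ht]
  exact ⟨hf.1.congr_fun e measurableSet_Ioi,
    (setIntegral_congr_fun measurableSet_Ioi e).symm.trans hf.2⟩

theorem hasMellin_sum {ι : Type*} (A : Finset ι) {f : ι → ℝ → ℂ} {s : ℂ} {m : ι → ℂ}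
    (h : ∀ i ∈ A, HasMellin (f i) s (m i)) :
    HasMellin (fun t => ∑ i ∈ A, f i t) s (∑ i ∈ A, m i) := by
  classical
  induction A using Finset.induction_on with
  | empty => simp [HasMellin, MellinConvergent, mellin]
  | insert i A hi ih =>
    have h1 := h i (Finset.mem_insert_self i A)
    have h2 := ih fun j hj => h j (Finset.mem_insert_of_mem hj)
    simp only [Finset.sum_insert hi]
    rw [← h1.2, ← h2.2]
    exact hasMellin_add h1.1 h2.1

theorem hasMellin_const_mul {f : ℝ → ℂ} {s m : ℂ} (hf : HasMellin f s m) (c : ℂ) :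
    HasMellin (fun t => c * f t) s (c * m) := by
  have := hasMellin_const_smul hf.1 c
  rwa [hf.2] at this

theorem hasMellin_cpow_mul {f : ℝ → ℂ} {s a m : ℂ} (hf : HasMellin f (s + a) m) :
    HasMellin (fun t => (t : ℂ) ^ a * f t) s m :=
  ⟨MellinConvergent.cpow_smul.mpr hf.1, (mellin_cpow_smul f s a).trans hf.2⟩

theorem hasMellin_profile {μ : ℝ} (hμ : 0 ≤ μ) {s : ℂ} (hs : 0 < s.re) :
    HasMellin (fun u => ((profile (u * μ) : ℝ) : ℂ)) s (Complex.Gamma (s + 1) * (μ : ℂ) ^ (-s)) := by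
  rcases hμ.eq_or_lt with rfl | hμ
  · have hs0 : s ≠ 0 := by rintro rfl; simp at hs
    rw [Complex.ofReal_zero, Complex.zero_cpow (neg_ne_zero.mpr hs0)]
    simp [HasMellin, MellinConvergent, mellin, profile]
  · have h := hasMellin_exp_neg_mul (α := s + 1) (by simp; linarith) hμ
    have hμ' : (μ : ℂ) ≠ 0 := by exact_mod_cast hμ.ne'
    have h2 := hasMellin_const_mul (hasMellin_cpow_mul h) (μ : ℂ)
    have e : (μ : ℂ) * (Complex.Gamma (s + 1) * (μ : ℂ) ^ (-(s + 1))) =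
        Complex.Gamma (s + 1) * (μ : ℂ) ^ (-s) := by
      rw [neg_add, Complex.cpow_add _ _ hμ', Complex.cpow_neg_one]
      field_simp
    rw [e] at h2
    refine hasMellin_congr h2 fun t ht => ?_
    rw [Complex.cpow_one, profile, mul_comm μ t]
    push_cast
    ring

/-- Up to a Gamma factor, the spectral zeta function is the Mellin transform of the sum of the
profile over the spectrum. -/
theorem hasMellin_torusRem {l : ℝ} (hl : l ≤ 2 * Real.pi ^ 2 / 3) (n : ℕ)
    [NeZero n] {s : ℂ} (h0 : 0 < s.re) (h1 : s.re < 1) :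
    HasMellin (fun u => ((torusRem l n u : ℝ) : ℂ)) s
      (Complex.Gamma (s + 1) * spectralZeta (starLaplacian l n) s -
        (n : ℂ) ^ (2 - 2 * s) * mellin (fun t => ((profileMean l t : ℝ) : ℂ)) s) := by
  have hs0 : s ≠ 0 := by rintro rfl; simp at h0
  have hn : (0 : ℝ) < n := by exact_mod_cast Nat.pos_of_ne_zero (NeZero.ne n)
  have hnc : (n : ℂ) ≠ 0 := by exact_mod_cast NeZero.ne n
  have hμ (j : ZMod n × ZMod n) : 0 ≤ eigenvalue l n j :=
    mul_nonneg (by positivity) (symb_nonneg hl _ _)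
  have hA := hasMellin_sum Finset.univ fun j (_ : j ∈ Finset.univ) =>
    hasMellin_profile (hμ j) h0
  rw [← Finset.mul_sum, ← spectralZeta_starLaplacian l hs0] at hA
  have hc := mellinConvergent_profileMean hl h0 h1
  have hn2 : (0 : ℝ) < (n : ℝ) ^ 2 := by positivity
  have hB : HasMellin (fun u : ℝ => ((profileMean l ((n : ℝ) ^ 2 * u) : ℝ) : ℂ)) s
      ((((n : ℝ) ^ 2 : ℝ) : ℂ) ^ (-s) * mellin (fun t => ((profileMean l t : ℝ) : ℂ)) s) :=
    ⟨(MellinConvergent.comp_mul_left hn2).mpr hc,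
      mellin_comp_mul_left (fun t => ((profileMean l t : ℝ) : ℂ)) s hn2⟩
  have hB' := hasMellin_const_mul hB ((n : ℂ) ^ 2)
  have e : (n : ℂ) ^ 2 * ((((n : ℝ) ^ 2 : ℝ) : ℂ) ^ (-s) *
      mellin (fun t => ((profileMean l t : ℝ) : ℂ)) s) =
      (n : ℂ) ^ (2 - 2 * s) * mellin (fun t => ((profileMean l t : ℝ) : ℂ)) s := by
    rw [← mul_assoc]
    congr 1
    rw [sub_eq_add_neg, Complex.cpow_add _ _ hnc, Complex.cpow_ofNat, ← mul_neg, Complex.cpow_mul]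
    · push_cast; norm_cast
    all_goals
      rw [← Complex.natCast_log, ← Complex.ofReal_ofNat, ← Complex.ofReal_mul, Complex.ofReal_im]
      first | exact neg_lt_zero.mpr Real.pi_pos | exact Real.pi_pos.le
  rw [e] at hB'
  have := hasMellin_sub hA.1 hB'.1
  rw [hA.2, hB'.2] at this
  refine hasMellin_congr this fun u _ => ?_
  rw [torusRem]
  push_cast
  congr 1
  refine Finset.sum_congr rfl fun j _ => ?_
  rw [eigenvalue]
  congr 2
  ring

theorem mellinConvergent_polyRem {q : MvPolynomial (Fin 2) ℝ}
    (hq : MvPolynomial.constantCoeff q = 0) {s : ℂ} (hs : s.re < 1) :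
    MellinConvergent (fun u => ((polyRem q u : ℝ) : ℂ)) s := by
  have h (d : Fin 2 →₀ ℕ) (hd : d ∈ q.support) : HasMellin
      (fun u : ℝ => ((q.coeff d : ℝ) : ℂ) * ((u : ℂ) ^ ((d 0 + d 1 : ℕ) : ℂ) *
        ((latticeRem (d 0) (d 1) u : ℝ) : ℂ))) s (((q.coeff d : ℝ) : ℂ) *
          mellin (fun u => ((latticeRem (d 0) (d 1) u : ℝ) : ℂ)) (s + ((d 0 + d 1 : ℕ) : ℂ))) := by
    refine hasMellin_const_mul (hasMellin_cpow_mul ⟨mellinConvergent_latticeRem ?_ ?_, rfl⟩) _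
    · intro h0
      have hd0 : d = 0 := by
        ext i
        fin_cases i <;> simp <;> omega
      rw [MvPolynomial.mem_support_iff, hd0] at hd
      exact hd hq
    · rw [Complex.add_re, Complex.natCast_re]; push_cast; linarith
  refine (hasMellin_congr (hasMellin_sum q.support h) fun u _ => ?_).1
  simp only [polyRem, Complex.cpow_natCast]
  push_cast
  rfl

/-! ### The complete asymptotic expansion -/

/-- The coefficient of `n ^ (-2 m)` in the expansion of `Γ(s + 1) ζ(starLaplacian l n, s)`. -/
noncomputable def mellinCoeff (l : ℝ) (m : ℕ) (s : ℂ) : ℂ :=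
  mellin (fun u => ((polyRem (PowerSeries.coeff m (profileSeries l)) u : ℝ) : ℂ)) (s - m)

/-- The remainder of the expansion of `torusRem`. -/
noncomputable def expansionRem (l : ℝ) (n : ℕ) [NeZero n] (M : ℕ) (u : ℝ) : ℝ :=
  torusRem l n u - ∑ m ∈ Finset.range M, (n ^ 2 * u)⁻¹ ^ m *
    polyRem (PowerSeries.coeff m (profileSeries l)) u

theorem hasMellin_expansionRem {l : ℝ} (hl : l ≤ 2 * Real.pi ^ 2 / 3) (n : ℕ) [NeZero n] (M : ℕ)
    {s : ℂ} (h0 : 0 < s.re) (h1 : s.re < 1) :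
    HasMellin (fun u => ((expansionRem l n M u : ℝ) : ℂ)) s
      (Complex.Gamma (s + 1) * spectralZeta (starLaplacian l n) s -
        (n : ℂ) ^ (2 - 2 * s) * mellin (fun t => ((profileMean l t : ℝ) : ℂ)) s -
        ∑ m ∈ Finset.range M, (n : ℂ) ^ (-2 * (m : ℤ)) * mellinCoeff l m s) := by
  have hA := hasMellin_torusRem hl n h0 h1
  have hB := hasMellin_sum (Finset.range M) fun m (_ : m ∈ Finset.range M) =>
    hasMellin_const_mul (hasMellin_cpow_mul (s := s) (a := -(m : ℂ))
      ⟨mellinConvergent_polyRem (constantCoeff_coeff_profileSeries l m) (by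
        rw [Complex.add_re, Complex.neg_re, Complex.natCast_re]
        have : (0 : ℝ) ≤ m := Nat.cast_nonneg m
        linarith), rfl⟩) ((n : ℂ) ^ (-2 * (m : ℤ)))
  have := hasMellin_sub hA.1 hB.1
  rw [hA.2, hB.2] at this
  refine hasMellin_congr this fun u hu => ?_
  rw [expansionRem]
  push_cast
  congr 1
  refine Finset.sum_congr rfl fun m _ => ?_
  rw [Complex.cpow_neg, Complex.cpow_natCast, ← mul_assoc]
  congr 1
  rw [neg_mul, zpow_neg, zpow_mul, mul_inv, mul_pow, zpow_natCast, inv_pow, inv_pow]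
  norm_cast

/-- The remainder of the expansion is of the expected order, uniformly in the time variable: for
`u ≤ 1 / n` all terms are small, for `u ≥ 1 / n` the expansion of the profile applies. -/
theorem abs_expansionRem_le {l : ℝ} (hl0 : 0 ≤ l) (hl : l ≤ 2 * Real.pi ^ 2 / 3) (M : ℕ) :
    ∃ C, 0 ≤ C ∧ ∀ (n : ℕ) [NeZero n] (u : ℝ), 0 < u →
      |expansionRem l n (M + 2) u| ≤ C * ((n : ℝ) ^ M)⁻¹ * min 1 u⁻¹ := by
  obtain ⟨C₀, hC₀, h0⟩ := exists_pow_mul_geometric_le (M + 2)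
  obtain ⟨C₁, hC₁, h1⟩ := torusRem_expansion hl (M + 2)
  choose C hC h using fun m : ℕ =>
    (flat_polyRem (PowerSeries.coeff m (profileSeries l))).exists_le
      (continuousOn_polyRem _) (M + 2 + m)
  have hS : 0 ≤ ∑ m ∈ Finset.range (M + 2), C m := Finset.sum_nonneg fun m _ => hC m
  refine ⟨C₀ + ∑ m ∈ Finset.range (M + 2), C m + C₁ * 4, by positivity, fun n _ u hu => ?_⟩
  have hn : (1 : ℝ) ≤ n := by exact_mod_cast Nat.one_le_iff_ne_zero.mpr (NeZero.ne n)
  have hn0 : (0 : ℝ) < n := by linarith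
  rcases le_total (n * u) 1 with hnu | hnu
  · have hu1 : u ≤ 1 := by nlinarith
    have hmin : min 1 u⁻¹ = 1 := min_eq_left ((one_le_inv₀ hu).mpr hu1)
    rw [hmin, mul_one]
    have hun : u ≤ (n : ℝ)⁻¹ := by rw [le_inv_comm₀ hu hn0, ← one_div, le_div_iff₀ hu]; exact hnu
    have hT : |torusRem l n u| ≤ C₀ * ((n : ℝ) ^ (M + 2))⁻¹ :=
      (abs_sum_profile_sub_le hl0 hl (τ := n ^ 2 * u) (by positivity) (by nlinarith)).trans
        (h0 n (NeZero.ne n))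
    have hterm (m : ℕ) : |(n ^ 2 * u)⁻¹ ^ m * polyRem (PowerSeries.coeff m (profileSeries l)) u| ≤
        C m * ((n : ℝ) ^ (M + 2))⁻¹ := by
      rw [abs_mul, abs_of_nonneg (by positivity)]
      calc (n ^ 2 * u)⁻¹ ^ m * |polyRem (PowerSeries.coeff m (profileSeries l)) u| ≤
          (n ^ 2 * u)⁻¹ ^ m * (C m * u ^ (M + 2 + m)) := by gcongr; exact h m u hu hu1
        _ = C m * ((((n : ℝ) ^ 2)⁻¹) ^ m * u ^ (M + 2)) := by
            rw [pow_add u, mul_inv, mul_pow, inv_pow u]; field_simp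
        _ ≤ C m * (1 * ((n : ℝ)⁻¹) ^ (M + 2)) := by
            have := hC m
            gcongr
            exact pow_le_one₀ (by positivity) (inv_le_one_of_one_le₀ (one_le_pow₀ hn))
        _ = _ := by rw [one_mul, inv_pow]
    have hpow : ((n : ℝ) ^ (M + 2))⁻¹ ≤ ((n : ℝ) ^ M)⁻¹ := by
      gcongr
      omega
    have hpow0 : 0 ≤ ((n : ℝ) ^ M)⁻¹ := by positivity
    calc |expansionRem l n (M + 2) u| ≤ |torusRem l n u| + ∑ m ∈ Finset.range (M + 2),
          |(n ^ 2 * u)⁻¹ ^ m * polyRem (PowerSeries.coeff m (profileSeries l)) u| :=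
          (abs_sub _ _).trans (by gcongr; exact Finset.abs_sum_le_sum_abs _ _)
      _ ≤ C₀ * ((n : ℝ) ^ (M + 2))⁻¹ + ∑ m ∈ Finset.range (M + 2), C m * ((n : ℝ) ^ (M + 2))⁻¹ := by
          gcongr with m _
          exact hterm m
      _ = (C₀ + ∑ m ∈ Finset.range (M + 2), C m) * ((n : ℝ) ^ (M + 2))⁻¹ := by
          rw [← Finset.sum_mul]; ring
      _ ≤ (C₀ + ∑ m ∈ Finset.range (M + 2), C m + C₁ * 4) * ((n : ℝ) ^ M)⁻¹ := by
          refine mul_le_mul ?_ hpow (by positivity) (by positivity)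
          linarith [show 0 ≤ C₁ * 4 by positivity]
  · have hτ : (n : ℝ) ≤ n ^ 2 * u := by nlinarith
    have hτ0 : 0 < (n : ℝ) ^ 2 * u := by positivity
    have hui : u⁻¹ ≤ n := by rw [inv_le_comm₀ hu hn0, inv_le_iff_one_le_mul₀ hn0]; linarith
    have hui0 : 0 < u⁻¹ := by positivity
    -- the factor `(1 + u⁻¹)²` costs at most two powers of `n`
    have key : (n ^ 2 * u)⁻¹ ^ (M + 2) * (1 + u⁻¹) ^ 2 ≤ 4 * ((n : ℝ) ^ M)⁻¹ * min 1 u⁻¹ := by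
      have e1 : (n ^ 2 * u)⁻¹ ^ M ≤ ((n : ℝ) ^ M)⁻¹ := by
        rw [← inv_pow]
        gcongr
      have e2 : (n ^ 2 * u)⁻¹ ^ 2 * (1 + u⁻¹) ^ 2 ≤ 4 * min 1 u⁻¹ := by
        rw [← mul_pow]
        have e3 : (n ^ 2 * u)⁻¹ ≤ 1 := inv_le_one_of_one_le₀ (hn.trans hτ)
        have e4 : (n ^ 2 * u)⁻¹ ≤ u⁻¹ := by
          gcongr
          have : (1 : ℝ) ≤ (n : ℝ) ^ 2 := one_le_pow₀ hn
          nlinarith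
        have e5 : (n ^ 2 * u)⁻¹ * u⁻¹ ≤ 1 := by
          calc (n ^ 2 * u)⁻¹ * u⁻¹ ≤ (n : ℝ)⁻¹ * n := by gcongr
            _ = 1 := inv_mul_cancel₀ hn0.ne'
        have e6 : (n ^ 2 * u)⁻¹ * u⁻¹ ≤ u⁻¹ := by nlinarith
        have e7 : (n ^ 2 * u)⁻¹ * (1 + u⁻¹) ≤ 2 * min 1 u⁻¹ := by
          rw [mul_min_of_nonneg _ _ (by norm_num : (0 : ℝ) ≤ 2)]
          refine le_min ?_ ?_ <;> linarith
        have e8 : 0 < min 1 u⁻¹ := lt_min one_pos hui0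
        have e9 : min 1 u⁻¹ ≤ 1 := min_le_left _ _
        have e10 : 0 ≤ (n ^ 2 * u)⁻¹ * (1 + u⁻¹) := by positivity
        nlinarith
      calc (n ^ 2 * u)⁻¹ ^ (M + 2) * (1 + u⁻¹) ^ 2 =
          (n ^ 2 * u)⁻¹ ^ M * ((n ^ 2 * u)⁻¹ ^ 2 * (1 + u⁻¹) ^ 2) := by ring
        _ ≤ ((n : ℝ) ^ M)⁻¹ * (4 * min 1 u⁻¹) := by gcongr
        _ = _ := by ring
    have hmin : 0 ≤ min 1 u⁻¹ := le_min zero_le_one hui0.le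
    calc |expansionRem l n (M + 2) u| ≤ C₁ * (n ^ 2 * u)⁻¹ ^ (M + 2) * (1 + u⁻¹) ^ 2 :=
          h1 n u hu (hn.trans hτ)
      _ = C₁ * ((n ^ 2 * u)⁻¹ ^ (M + 2) * (1 + u⁻¹) ^ 2) := by ring
      _ ≤ C₁ * (4 * ((n : ℝ) ^ M)⁻¹ * min 1 u⁻¹) := by gcongr
      _ = C₁ * 4 * ((n : ℝ) ^ M)⁻¹ * min 1 u⁻¹ := by ring
      _ ≤ _ := by
          gcongr
          linarith

theorem integrableOn_rpow_mul_min {σ : ℝ} (h0 : 0 < σ) (h1 : σ < 1) :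
    IntegrableOn (fun u : ℝ => u ^ (σ - 1) * min 1 u⁻¹) (Ioi 0) := by
  have hc : ContinuousOn (fun u : ℝ => u ^ (σ - 1) * min 1 u⁻¹) (Ioi 0) := by
    refine ContinuousOn.mul (fun u hu => (Real.continuousAt_rpow_const u _
      (Or.inl (ne_of_gt hu))).continuousWithinAt) (ContinuousOn.inf continuousOn_const
        (continuousOn_inv₀.mono fun u hu => ne_of_gt hu))
  rw [← Ioc_union_Ioi_eq_Ioi zero_le_one]
  refine IntegrableOn.union ?_ ?_
  · have h := (intervalIntegral.intervalIntegrable_rpow' (a := 0) (b := 1)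
      (r := σ - 1) (by linarith)).1
    refine Integrable.mono' h ((hc.mono fun u hu => hu.1).aestronglyMeasurable measurableSet_Ioc) ?_
    refine (ae_restrict_iff' measurableSet_Ioc).mpr (ae_of_all _ fun u hu => ?_)
    have hu0 : 0 < u := hu.1
    have : 0 ≤ min 1 u⁻¹ := le_min zero_le_one (by positivity)
    rw [Real.norm_of_nonneg (by positivity)]
    exact mul_le_of_le_one_right (by positivity) (min_le_left _ _)
  · have h := integrableOn_Ioi_rpow_of_lt (a := σ - 2) (c := 1) (by linarith) one_pos
    refine Integrable.mono' h ((hc.mono (Ioi_subset_Ioi (zero_le_one (α := ℝ)))).aestronglyMeasurable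
      measurableSet_Ioi) ?_
    refine (ae_restrict_iff' measurableSet_Ioi).mpr (ae_of_all _ fun u hu => ?_)
    have hu0 : 0 < u := zero_lt_one.trans hu
    have : 0 ≤ min 1 u⁻¹ := le_min zero_le_one (by positivity)
    rw [Real.norm_of_nonneg (by positivity), show σ - 2 = (σ - 1) + -1 by ring,
      Real.rpow_add hu0, Real.rpow_neg_one]
    exact mul_le_mul_of_nonneg_left (min_le_right _ _) (Real.rpow_nonneg hu0.le _)

theorem norm_mellin_expansionRem_le {l : ℝ} (hl0 : 0 ≤ l) (hl : l ≤ 2 * Real.pi ^ 2 / 3) (M : ℕ)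
    {s : ℂ} (h0 : 0 < s.re) (h1 : s.re < 1) :
    ∃ C, 0 ≤ C ∧ ∀ (n : ℕ) [NeZero n],
      ‖mellin (fun u => ((expansionRem l n (M + 2) u : ℝ) : ℂ)) s‖ ≤ C * ((n : ℝ) ^ M)⁻¹ := by
  obtain ⟨C, hC, h⟩ := abs_expansionRem_le hl0 hl M
  have hI : 0 ≤ ∫ u in Ioi (0 : ℝ), u ^ (s.re - 1) * min 1 u⁻¹ :=
    setIntegral_nonneg measurableSet_Ioi fun u (hu : 0 < u) =>
      mul_nonneg (by positivity) (le_min zero_le_one (by positivity))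
  refine ⟨C * ∫ u in Ioi (0 : ℝ), u ^ (s.re - 1) * min 1 u⁻¹, by positivity, fun n _ => ?_⟩
  have := norm_integral_le_of_norm_le
    (f := fun u : ℝ => (u : ℂ) ^ (s - 1) • ((expansionRem l n (M + 2) u : ℝ) : ℂ))
    ((integrableOn_rpow_mul_min h0 h1).const_mul (C * ((n : ℝ) ^ M)⁻¹))
    ((ae_restrict_iff' measurableSet_Ioi).mpr (ae_of_all _ fun u (hu : 0 < u) => by
      rw [norm_smul, Complex.norm_cpow_eq_rpow_re_of_pos hu, Complex.sub_re, Complex.one_re,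
        Complex.norm_real, Real.norm_eq_abs]
      calc u ^ (s.re - 1) * |expansionRem l n (M + 2) u| ≤
          u ^ (s.re - 1) * (C * ((n : ℝ) ^ M)⁻¹ * min 1 u⁻¹) := by gcongr; exact h n u hu
        _ = _ := by ring))
  rw [integral_const_mul] at this
  refine this.trans (le_of_eq (by ring))

/-- The complete asymptotic expansion of the spectral zeta functions of the star Laplacians. -/
theorem spectralZeta_expansion {l : ℝ} (hl0 : 0 ≤ l) (hl : l ≤ 2 * Real.pi ^ 2 / 3)
    {s : ℂ} (h0 : 0 < s.re) (h1 : s.re < 1) (M : ℕ) :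
    (fun n : ℕ+ => spectralZeta (starLaplacian l n) s -
      (Complex.Gamma (s + 1))⁻¹ * ((n : ℂ) ^ (2 - 2 * s) *
          mellin (fun t => ((profileMean l t : ℝ) : ℂ)) s +
        ∑ m ∈ Finset.range M, (n : ℂ) ^ (-2 * (m : ℤ)) * mellinCoeff l m s))
      =O[atTop] fun n : ℕ+ => (n : ℂ) ^ (-2 * (M : ℂ) - 2 * s + 2) := by
  obtain ⟨C, hC, h⟩ := norm_mellin_expansionRem_le hl0 hl (2 * M) h0 h1
  have hG : Complex.Gamma (s + 1) ≠ 0 := Complex.Gamma_ne_zero_of_re_pos (by simp; linarith)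
  set B := ∑ m ∈ Finset.Ico M (2 * M + 2), ‖mellinCoeff l m s‖
  refine IsBigO.of_bound (‖(Complex.Gamma (s + 1))⁻¹‖ * (C + B)) (Eventually.of_forall fun n => ?_)
  have hn : (1 : ℝ) ≤ (n : ℕ) := by exact_mod_cast NeZero.one_le (n := (n : ℕ))
  have hn0 : (0 : ℝ) < (n : ℕ) := by linarith
  have : NeZero (n : ℕ) := ⟨n.ne_zero⟩
  have hm := hasMellin_expansionRem hl n (2 * M + 2) h0 h1
  have e : spectralZeta (starLaplacian l n) s -
      (Complex.Gamma (s + 1))⁻¹ * ((n : ℂ) ^ (2 - 2 * s) *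
          mellin (fun t => ((profileMean l t : ℝ) : ℂ)) s +
        ∑ m ∈ Finset.range M, (n : ℂ) ^ (-2 * (m : ℤ)) * mellinCoeff l m s) =
      (Complex.Gamma (s + 1))⁻¹ *
        (mellin (fun u => ((expansionRem l n (2 * M + 2) u : ℝ) : ℂ)) s +
          ∑ m ∈ Finset.Ico M (2 * M + 2), (n : ℂ) ^ (-2 * (m : ℤ)) * mellinCoeff l m s) := by
    rw [hm.2, ← Finset.sum_range_add_sum_Ico _ (show M ≤ 2 * M + 2 by omega)]
    field_simp
    ring
  have hsmall : ((n : ℕ) : ℝ) ^ (-2 * (M : ℝ)) ≤ ‖(n : ℂ) ^ (-2 * (M : ℂ) - 2 * s + 2)‖ := by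
    rw [show (n : ℂ) = (((n : ℕ) : ℝ) : ℂ) by norm_cast,
      Complex.norm_cpow_eq_rpow_re_of_pos hn0]
    refine Real.rpow_le_rpow_of_exponent_le hn ?_
    simp
    linarith
  have hpow : (((n : ℕ) : ℝ) ^ (2 * M))⁻¹ = ((n : ℕ) : ℝ) ^ (-2 * (M : ℝ)) := by
    rw [neg_mul, Real.rpow_neg hn0.le, ← Real.rpow_natCast]; push_cast; rfl
  rw [e, norm_mul, mul_assoc]
  gcongr
  calc _ ≤ ‖mellin (fun u => ((expansionRem l n (2 * M + 2) u : ℝ) : ℂ)) s‖ +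
        ∑ m ∈ Finset.Ico M (2 * M + 2), ‖(n : ℂ) ^ (-2 * (m : ℤ)) * mellinCoeff l m s‖ :=
        (norm_add_le _ _).trans (by gcongr; exact norm_sum_le _ _)
    _ ≤ C * (((n : ℕ) : ℝ) ^ (2 * M))⁻¹ +
        ∑ m ∈ Finset.Ico M (2 * M + 2), (((n : ℕ) : ℝ) ^ (2 * M))⁻¹ * ‖mellinCoeff l m s‖ := by
        gcongr with m hm
        · exact h n
        · rw [norm_mul]
          gcongr
          rw [neg_mul, zpow_neg, norm_inv, norm_zpow, Complex.norm_natCast]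
          gcongr
          rw [← zpow_natCast]
          refine zpow_le_zpow_right₀ hn ?_
          have := (Finset.mem_Ico.mp hm).1
          push_cast
          omega
    _ = (C + B) * (((n : ℕ) : ℝ) ^ (2 * M))⁻¹ := by rw [← Finset.mul_sum]; ring
    _ ≤ _ := by
        rw [hpow]
        have : 0 ≤ B := Finset.sum_nonneg fun _ _ => norm_nonneg _
        gcongr

/-! ### The zeta function of the torus -/

theorem IsTorusZeta.eqOn {Z₁ Z₂ : ℂ → ℂ} (h₁ : IsTorusZeta Z₁) (h₂ : IsTorusZeta Z₂) :
    EqOn Z₁ Z₂ {1}ᶜ := by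
  have hpre : IsPreconnected ({1}ᶜ : Set ℂ) :=
    (isConnected_compl_singleton_of_one_lt_rank (by simp) 1).isPreconnected
  refine (h₁.1.analyticOnNhd isOpen_compl_singleton).eqOn_of_preconnected_of_eventuallyEq
    (h₂.1.analyticOnNhd isOpen_compl_singleton) hpre (z₀ := 2) (by simp) ?_
  have : {s : ℂ | 1 < s.re} ∈ 𝓝 (2 : ℂ) :=
    (isOpen_lt continuous_const Complex.continuous_re).mem_nhds (by simp)
  filter_upwards [this] with s hs
  exact (h₁.2 s hs).unique (h₂.2 s hs)

/-- The lattice sum `∑ |k|² exp (-u |k|²)`. -/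
noncomputable def normTheta (u : ℝ) : ℝ := theta 1 u * theta 0 u + theta 0 u * theta 1 u

/-- The lattice sum `normTheta`, without its singular part on `(0, 1]`. -/
noncomputable def normThetaReg (u : ℝ) : ℂ :=
  (normTheta u : ℂ) - (Real.pi : ℂ) * (Ioc (0 : ℝ) 1).indicator (fun t : ℝ => (t : ℂ) ^ (-2 : ℂ)) u

theorem normTheta_eq (u : ℝ) :
    normTheta u = latticeRem 1 0 u + latticeRem 0 1 u + Real.pi * (u ^ 2)⁻¹ := by
  have h : gaussMoment 0 * gaussMoment 0 = Real.pi := by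
    rw [gaussMoment_zero, Real.mul_self_sqrt Real.pi_pos.le]
  have h1 := gaussMoment_succ 0
  rw [normTheta, latticeRem, latticeRem, ← h]
  simp only [zero_add] at h1
  rw [h1]
  push_cast
  ring

theorem cpow_neg_two (u : ℝ) : (u : ℂ) ^ (-2 : ℂ) = (((u ^ 2)⁻¹ : ℝ) : ℂ) := by
  rw [Complex.cpow_neg, Complex.cpow_ofNat]
  push_cast
  rfl

theorem normThetaReg_eq_of_le {u : ℝ} (h0 : 0 < u) (h1 : u ≤ 1) :
    normThetaReg u = ((latticeRem 1 0 u + latticeRem 0 1 u : ℝ) : ℂ) := by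
  rw [normThetaReg, indicator_of_mem (show u ∈ Ioc (0 : ℝ) 1 from ⟨h0, h1⟩), normTheta_eq,
    cpow_neg_two]
  push_cast
  ring

theorem normThetaReg_eq_of_gt {u : ℝ} (h1 : 1 < u) : normThetaReg u = (normTheta u : ℂ) := by
  rw [normThetaReg, indicator_of_notMem (fun h => h1.not_ge h.2), mul_zero, sub_zero]

theorem continuousOn_normTheta : ContinuousOn normTheta (Ioi 0) := by
  have h (a : ℕ) : ContinuousOn (theta a) (Ioi 0) := fun u hu =>
    (hasDerivAt_theta a hu).continuousAt.continuousWithinAt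
  exact ((h 1).mul (h 0)).add ((h 0).mul (h 1))

theorem locallyIntegrableOn_normThetaReg : LocallyIntegrableOn normThetaReg (Ioi 0) := by
  refine LocallyIntegrableOn.sub ((Complex.continuous_ofReal.comp_continuousOn
    continuousOn_normTheta).locallyIntegrableOn measurableSet_Ioi) ?_
  refine LocallyIntegrableOn.continuousOn_mul ?_ continuousOn_const isOpen_Ioi.isLocallyClosed
  intro x hx
  have hc : LocallyIntegrableOn (fun t : ℝ => (t : ℂ) ^ (-2 : ℂ)) (Ioi 0) := by
    refine ContinuousOn.locallyIntegrableOn (fun t ht => ?_) measurableSet_Ioi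
    exact (Complex.continuousAt_ofReal_cpow_const t _
      (Or.inr (ne_of_gt ht))).continuousWithinAt
  obtain ⟨t, ht, h⟩ := hc x hx
  exact ⟨t, ht, h.indicator measurableSet_Ioc⟩

theorem normThetaReg_isBigO_atTop (r : ℝ) : normThetaReg =O[atTop] fun u : ℝ => u ^ (-r) := by
  have h1 := theta_mul_isBigO_exp_atTop (a := 1) (b := 0) (by simp)
  have h2 := theta_mul_isBigO_exp_atTop (a := 0) (b := 1) (by simp)
  have h := (h1.add h2).trans (isLittleO_exp_neg_mul_rpow_atTop one_pos (-r)).isBigO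
  refine (Complex.isBigO_ofReal_left.mpr h).congr' ?_ EventuallyEq.rfl
  filter_upwards [eventually_gt_atTop 1] with u hu
  exact (normThetaReg_eq_of_gt hu).symm

theorem normThetaReg_isBigO_zero (r : ℝ) : normThetaReg =O[𝓝[>] 0] fun u : ℝ => u ^ (-r) := by
  have h := ((flat_latticeRem 1 0).isBigO_rpow r).add ((flat_latticeRem 0 1).isBigO_rpow r)
  refine (Complex.isBigO_ofReal_left.mpr h).congr' ?_ EventuallyEq.rfl
  filter_upwards [Ioo_mem_nhdsGT (zero_lt_one' ℝ)] with u hu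
  exact (normThetaReg_eq_of_le hu.1 hu.2.le).symm

theorem mellinConvergent_normThetaReg (s : ℂ) : MellinConvergent normThetaReg s :=
  mellinConvergent_of_isBigO_rpow (a := s.re + 1) (b := s.re - 1)
    locallyIntegrableOn_normThetaReg (normThetaReg_isBigO_atTop _) (by linarith)
    (normThetaReg_isBigO_zero _) (by linarith)

theorem differentiable_mellin_normThetaReg : Differentiable ℂ (mellin normThetaReg) := fun s =>
  mellin_differentiableAt_of_isBigO_rpow (a := s.re + 1) (b := s.re - 1)
    locallyIntegrableOn_normThetaReg (normThetaReg_isBigO_atTop _) (by linarith)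
    (normThetaReg_isBigO_zero _) (by linarith)

theorem mellin_normTheta {s : ℂ} (hs : 1 < s.re) :
    mellin (fun u => (normTheta u : ℂ)) (s + 1) =
      mellin normThetaReg (s + 1) + Real.pi / (s - 1) := by
  have h1 := hasMellin_cpow_Ioc (-2) (s := s + 1) (by simp; linarith)
  have h2 := hasMellin_const_mul h1 (Real.pi : ℂ)
  have h3 := hasMellin_add (mellinConvergent_normThetaReg (s + 1)) h2.1
  rw [h2.2] at h3
  have h4 := (hasMellin_congr (g := fun u => (normTheta u : ℂ)) h3 fun u _ => by
    rw [normThetaReg]; ring).2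
  rw [h4]
  congr 1
  rw [mul_one_div]
  congr 1
  ring

/-- The analytic continuation of the zeta function of the torus as a Mellin transform. -/
theorem isTorusZeta_mellin : IsTorusZeta fun s =>
    (Complex.Gamma (s + 1))⁻¹ * (mellin normThetaReg (s + 1) + Real.pi / (s - 1)) := by
  constructor
  · intro s hs
    have hs1 : s - 1 ≠ 0 := sub_ne_zero.mpr hs
    have hG : DifferentiableAt ℂ (fun s : ℂ => (Complex.Gamma (s + 1))⁻¹) s :=
      DifferentiableAt.comp (f := fun s : ℂ => s + 1) (g := fun s : ℂ => (Complex.Gamma s)⁻¹) s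
        (Complex.differentiable_one_div_Gamma (s + 1)) (by fun_prop)
    have hM : DifferentiableAt ℂ (fun s : ℂ => mellin normThetaReg (s + 1)) s :=
      DifferentiableAt.comp (f := fun s : ℂ => s + 1) s
        (differentiable_mellin_normThetaReg (s + 1)) (by fun_prop)
    have hd : DifferentiableAt ℂ (fun s : ℂ => (Real.pi : ℂ) / (s - 1)) s :=
      (differentiableAt_const _).div (by fun_prop) hs1
    exact (hG.mul (hM.add hd)).differentiableWithinAt
  · intro s hs
    have hs0 : 0 < (s + 1).re := by simp; linarith
    have hG : Complex.Gamma (s + 1) ≠ 0 := Complex.Gamma_ne_zero_of_re_pos hs0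
    have hF : ∀ t ∈ Ioi (0 : ℝ), HasSum (fun k : ℤ × ℤ =>
        (((k.1 : ℝ) ^ 2 + (k.2 : ℝ) ^ 2 : ℝ) : ℂ) *
          Real.exp (-((k.1 : ℝ) ^ 2 + (k.2 : ℝ) ^ 2) * t)) ((normTheta t : ℝ) : ℂ) := by
      intro t ht
      have h := Complex.hasSum_ofReal.mpr ((hasSum_theta_mul 1 0 ht).add (hasSum_theta_mul 0 1 ht))
      refine h.congr_fun fun k => ?_
      rw [← Complex.ofReal_mul]
      congr 1
      rw [show -((k.1 : ℝ) ^ 2 + (k.2 : ℝ) ^ 2) * t =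
        -(t * (k.1 : ℝ) ^ 2) + -(t * (k.2 : ℝ) ^ 2) by ring, Real.exp_add]
      ring
    have hsum := hasSum_mellin (fun k : ℤ × ℤ => by
        rcases (show (0 : ℝ) ≤ (k.1 : ℝ) ^ 2 + (k.2 : ℝ) ^ 2 by positivity).eq_or_lt with h | h
        · exact Or.inl (by rw [← h, Complex.ofReal_zero])
        · exact Or.inr h) hs0 hF (by
      refine (summable_lattice hs).congr fun k => ?_
      rw [Complex.norm_real, Real.norm_of_nonneg (by positivity), Complex.add_re, Complex.one_re]
      rcases (show (0 : ℝ) ≤ (k.1 : ℝ) ^ 2 + (k.2 : ℝ) ^ 2 by positivity).eq_or_lt with h | h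
      · rw [← h, Real.zero_rpow (by linarith)]; simp
      · rw [Real.rpow_add_one h.ne']; field_simp)
    rw [mellin_normTheta hs] at hsum
    have hsum2 := hsum.mul_left (Complex.Gamma (s + 1))⁻¹
    rw [← hasSum_subtype_iff_of_support_subset (s := {k : ℤ × ℤ | k ≠ 0})] at hsum2
    · refine hsum2.congr_fun fun k => ?_
      have hk : ((k.1.1 : ℂ) ^ 2 + (k.1.2 : ℂ) ^ 2) ≠ 0 := by
        intro h
        have h' : (k.1.1 : ℝ) ^ 2 + (k.1.2 : ℝ) ^ 2 = 0 := by exact_mod_cast h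
        have h1 : (k.1.1 : ℝ) = 0 := by nlinarith [sq_nonneg (k.1.1 : ℝ), sq_nonneg (k.1.2 : ℝ)]
        have h2 : (k.1.2 : ℝ) = 0 := by nlinarith [sq_nonneg (k.1.1 : ℝ), sq_nonneg (k.1.2 : ℝ)]
        exact k.2 (Prod.ext (by exact_mod_cast h1) (by exact_mod_cast h2))
      simp only [Function.comp_apply]
      push_cast
      rw [Complex.cpow_neg, Complex.cpow_add _ _ hk, Complex.cpow_one]
      field_simp
    · intro k hk hk0
      have hk1 : k = 0 := hk0
      subst hk1
      exact hk (by simp)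

/-- For `-1 < Re s < 1` the continuation of the zeta function is again a Mellin transform, of the
lattice sum with its singular part removed on the whole half-line. -/
theorem mellin_latticeRem_eq {s : ℂ} (h0 : -1 < s.re) (h1 : s.re < 1) :
    mellin (fun u => ((latticeRem 1 0 u + latticeRem 0 1 u : ℝ) : ℂ)) (s + 1) =
      Complex.Gamma (s + 1) * torusZeta s := by
  have hs1 : s ≠ 1 := by rintro rfl; simp at h1
  have hG : Complex.Gamma (s + 1) ≠ 0 := Complex.Gamma_ne_zero_of_re_pos (by simp; linarith)
  rw [torusZeta_spec.eqOn isTorusZeta_mellin hs1, mul_inv_cancel_left₀ hG]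
  -- the tail `-π u⁻²` on `(1, ∞)` accounts for the polar part
  have hint : IntegrableOn (fun u : ℝ => (u : ℂ) ^ (s - 2)) (Ioi 1) :=
    integrableOn_Ioi_cpow_of_lt (by simp; linarith) one_pos
  have hval : ∫ u in Ioi (1 : ℝ), (u : ℂ) ^ (s - 2) = -(1 / (s - 1)) := by
    rw [integral_Ioi_cpow_of_lt (by simp; linarith) one_pos]
    rw [show s - 2 + 1 = s - 1 by ring]
    simp [neg_div]
  have e : EqOn (fun u : ℝ => (u : ℂ) ^ (s + 1 - 1) •
      ((latticeRem 1 0 u + latticeRem 0 1 u : ℝ) : ℂ))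
      (fun u : ℝ => (u : ℂ) ^ (s + 1 - 1) • normThetaReg u -
        (Real.pi : ℂ) * (Ioi (1 : ℝ)).indicator (fun u : ℝ => (u : ℂ) ^ (s - 2)) u) (Ioi 0) := by
    intro u (hu : 0 < u)
    rcases le_or_gt u 1 with h | h
    · simp only
      rw [indicator_of_notMem (show u ∉ Ioi (1 : ℝ) from h.not_gt), normThetaReg_eq_of_le hu h, mul_zero, sub_zero]
    · have hu' : (u : ℂ) ≠ 0 := by exact_mod_cast hu.ne'
      simp only
      rw [indicator_of_mem (show u ∈ Ioi (1 : ℝ) from h), normThetaReg_eq_of_gt h, normTheta_eq, add_sub_cancel_right,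
        sub_eq_add_neg s 2, Complex.cpow_add _ _ hu', cpow_neg_two]
      simp only [smul_eq_mul]
      push_cast
      ring
  rw [mellin, setIntegral_congr_fun measurableSet_Ioi e, integral_sub
    (mellinConvergent_normThetaReg (s + 1)), integral_const_mul,
    setIntegral_indicator measurableSet_Ioi, Ioi_inter_Ioi, sup_of_le_right zero_le_one, hval, mellin]
  · ring
  · exact ((hint.integrable_indicator measurableSet_Ioi).integrableOn).const_mul _

/-! ### The first coefficients -/

theorem polyRem_eq_sum {q : MvPolynomial (Fin 2) ℝ} {A : Finset (Fin 2 →₀ ℕ)} (hA : q.support ⊆ A)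
    (u : ℝ) :
    polyRem q u = ∑ d ∈ A, q.coeff d * (u ^ (d 0 + d 1) * latticeRem (d 0) (d 1) u) :=
  Finset.sum_subset hA fun d _ hd => by
    rw [MvPolynomial.notMem_support_iff.mp hd, zero_mul]

theorem polyRem_add (p q : MvPolynomial (Fin 2) ℝ) (u : ℝ) :
    polyRem (p + q) u = polyRem p u + polyRem q u := by
  classical
  rw [polyRem_eq_sum MvPolynomial.support_add, polyRem_eq_sum Finset.subset_union_left,
    polyRem_eq_sum Finset.subset_union_right, ← Finset.sum_add_distrib]
  exact Finset.sum_congr rfl fun d _ => by rw [MvPolynomial.coeff_add, add_mul]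

theorem polyRem_monomial (a b : ℕ) (c u : ℝ) :
    polyRem (MvPolynomial.C c * (MvPolynomial.X 0 ^ a * MvPolynomial.X 1 ^ b)) u =
      c * (u ^ (a + b) * latticeRem a b u) := by
  rw [MvPolynomial.X_pow_eq_monomial, MvPolynomial.X_pow_eq_monomial, MvPolynomial.monomial_mul,
    MvPolynomial.C_mul_monomial, mul_one, mul_one,
    polyRem_eq_sum MvPolynomial.support_monomial_subset, Finset.sum_singleton]
  simp

theorem mellinCoeff_zero (l : ℝ) {s : ℂ} (h0 : 0 < s.re) (h1 : s.re < 1) :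
    mellinCoeff l 0 s = Complex.Gamma (s + 1) * torusZeta s := by
  rw [mellinCoeff, coeff_zero_profileSeries, Nat.cast_zero, sub_zero,
    ← mellin_latticeRem_eq (by linarith) h1]
  have hc : MellinConvergent
      (fun u => ((latticeRem 1 0 u + latticeRem 0 1 u : ℝ) : ℂ)) (s + 1) := by
    have h2 := mellinConvergent_latticeRem (a := 1) (b := 0) (by simp) (s := s + 1)
      (by simp; linarith)
    have h3 := mellinConvergent_latticeRem (a := 0) (b := 1) (by simp) (s := s + 1)
      (by simp; linarith)
    simpa using (hasMellin_add h2 h3).1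
  refine (hasMellin_congr (hasMellin_cpow_mul (a := 1) ⟨hc, rfl⟩) fun u _ => ?_).2
  have e : (MvPolynomial.X 0 + MvPolynomial.X 1 : MvPolynomial (Fin 2) ℝ) =
      MvPolynomial.C 1 * (MvPolynomial.X 0 ^ 1 * MvPolynomial.X 1 ^ 0) +
        MvPolynomial.C 1 * (MvPolynomial.X 0 ^ 0 * MvPolynomial.X 1 ^ 1) := by simp
  rw [e, polyRem_add, polyRem_monomial, polyRem_monomial, Complex.cpow_one]
  push_cast
  ring

theorem hasMellin_latticeRem {a b : ℕ} (h : a + b ≠ 0) {s : ℂ} (hs : s.re < a + b + 1) :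
    HasMellin (fun u => ((latticeRem a b u : ℝ) : ℂ)) s
      (mellin (fun u => ((latticeRem a b u : ℝ) : ℂ)) s) :=
  ⟨mellinConvergent_latticeRem h hs, rfl⟩

/-- The recurrence between Mellin transforms that results from integration by parts. -/
theorem mellin_latticeRem_add {a b : ℕ} (h : a + b ≠ 0) {s : ℂ} (hs : s.re < a + b + 1) :
    mellin (fun u => ((latticeRem (a + 1) b u : ℝ) : ℂ)) (s + 1) +
      mellin (fun u => ((latticeRem a (b + 1) u : ℝ) : ℂ)) (s + 1) =
      s * mellin (fun u => ((latticeRem a b u : ℝ) : ℂ)) s := by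
  rw [← mellin_latticeRem_succ h hs, ← (hasMellin_add
    (mellinConvergent_latticeRem (a := a + 1) (b := b) (by omega) (s := s + 1)
      (by simp; linarith))
    (mellinConvergent_latticeRem (a := a) (b := b + 1) (by omega) (s := s + 1)
      (by simp; linarith))).2]
  simp only [Complex.ofReal_add]

theorem polyRem_coeff_one (l u : ℝ) :
    polyRem (PowerSeries.coeff 1 (profileSeries l)) u =
      u ^ 2 * (-(Real.pi ^ 2 / 3) * (latticeRem 2 0 u + latticeRem 0 2 u) -
        l * latticeRem 1 1 u) -
      u ^ 3 * (-(Real.pi ^ 2 / 3) * (latticeRem 3 0 u + latticeRem 2 1 u +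
        (latticeRem 1 2 u + latticeRem 0 3 u)) - l * (latticeRem 2 1 u + latticeRem 1 2 u)) := by
  have e : PowerSeries.coeff 1 (profileSeries l) =
      MvPolynomial.C (-(Real.pi ^ 2 / 3)) * (MvPolynomial.X 0 ^ 2 * MvPolynomial.X 1 ^ 0) +
      MvPolynomial.C (-(Real.pi ^ 2 / 3)) * (MvPolynomial.X 0 ^ 0 * MvPolynomial.X 1 ^ 2) +
      MvPolynomial.C (-l) * (MvPolynomial.X 0 ^ 1 * MvPolynomial.X 1 ^ 1) +
      MvPolynomial.C (Real.pi ^ 2 / 3) * (MvPolynomial.X 0 ^ 3 * MvPolynomial.X 1 ^ 0) +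
      MvPolynomial.C (Real.pi ^ 2 / 3 + l) * (MvPolynomial.X 0 ^ 2 * MvPolynomial.X 1 ^ 1) +
      MvPolynomial.C (Real.pi ^ 2 / 3 + l) * (MvPolynomial.X 0 ^ 1 * MvPolynomial.X 1 ^ 2) +
      MvPolynomial.C (Real.pi ^ 2 / 3) * (MvPolynomial.X 0 ^ 0 * MvPolynomial.X 1 ^ 3) := by
    rw [coeff_one_profileSeries, coeff_one_symbSeries]
    simp only [map_neg, map_add]
    ring
  rw [e]
  simp only [polyRem_add, polyRem_monomial]
  ring

/-- The coefficient of order one: the isotropic part is a value of the zeta function of the torus,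
the anisotropic part, which comes from `x₁² x₂²`, vanishes for the 9-point star Laplacian. -/
theorem mellinCoeff_one (l : ℝ) {s : ℂ} (h0 : 0 < s.re) (h1 : s.re < 1) :
    mellinCoeff l 1 s =
      s * (Real.pi : ℂ) ^ 2 / 3 * (Complex.Gamma (s + 1) * torusZeta (s - 1)) -
        (2 * (Real.pi : ℂ) ^ 2 / 3 - l) * s *
          mellin (fun u => ((latticeRem 1 1 u : ℝ) : ℂ)) (s + 1) := by
  have hs0 : s ≠ 0 := by rintro rfl; simp at h0
  have hz := mellin_latticeRem_eq (s := s - 1) (by simp; linarith) (by simp; linarith)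
  rw [sub_add_cancel] at hz
  have c2 (a b : ℕ) (h : a + b = 2) := hasMellin_latticeRem (a := a) (b := b) (by omega)
    (s := s + 1) (by
      have : ((a : ℝ) + b) = 2 := by exact_mod_cast h
      rw [this]; simp; linarith)
  have c3 (a b : ℕ) (h : a + b = 3) := hasMellin_latticeRem (a := a) (b := b) (by omega)
    (s := s + 1 + 1) (by
      have : ((a : ℝ) + b) = 3 := by exact_mod_cast h
      rw [this]; simp; linarith)
  have r1 (a b : ℕ) (h : a + b = 1) := mellin_latticeRem_add (a := a) (b := b) (by omega)
    (s := s) (by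
      have : ((a : ℝ) + b) = 1 := by exact_mod_cast h
      rw [this]; linarith)
  have r2 (a b : ℕ) (h : a + b = 2) := mellin_latticeRem_add (a := a) (b := b) (by omega)
    (s := s + 1) (by
      have : ((a : ℝ) + b) = 2 := by exact_mod_cast h
      rw [this]; simp; linarith)
  have hz' : mellin (fun u => ((latticeRem 1 0 u : ℝ) : ℂ)) s +
      mellin (fun u => ((latticeRem 0 1 u : ℝ) : ℂ)) s = Complex.Gamma s * torusZeta (s - 1) := by
    rw [← hz, ← (hasMellin_add
      (mellinConvergent_latticeRem (a := 1) (b := 0) (by simp) (s := s) (by simp; linarith))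
      (mellinConvergent_latticeRem (a := 0) (b := 1) (by simp) (s := s) (by simp; linarith))).2]
    simp only [Complex.ofReal_add]
  have q1 := r1 1 0 rfl
  have q2 := r1 0 1 rfl
  have q3 := r2 2 0 rfl
  have q4 := r2 0 2 rfl
  have q5 := r2 1 1 rfl
  norm_num at q1 q2 q3 q4 q5
  set N : ℕ → ℕ → ℂ := fun a b => mellin (fun u => ((latticeRem a b u : ℝ) : ℂ)) (s + 1)
  set P : ℕ → ℕ → ℂ := fun a b => mellin (fun u => ((latticeRem a b u : ℝ) : ℂ)) (s + 1 + 1)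
  set c : ℂ := -((Real.pi : ℂ) ^ 2 / 3) with hc
  have hA : HasMellin (fun u : ℝ => c * ((latticeRem 2 0 u : ℝ) : ℂ) +
      c * ((latticeRem 0 2 u : ℝ) : ℂ) + (-l : ℂ) * ((latticeRem 1 1 u : ℝ) : ℂ)) (s + 1)
      (c * N 2 0 + c * N 0 2 + (-l : ℂ) * N 1 1) := by
    have := hasMellin_sum Finset.univ (f := ![fun u : ℝ => c * ((latticeRem 2 0 u : ℝ) : ℂ),
      fun u : ℝ => c * ((latticeRem 0 2 u : ℝ) : ℂ),
      fun u : ℝ => (-l : ℂ) * ((latticeRem 1 1 u : ℝ) : ℂ)]) (s := s + 1)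
      (m := ![c * N 2 0, c * N 0 2, (-l : ℂ) * N 1 1]) (by
        intro i _
        fin_cases i
        · exact hasMellin_const_mul (c2 2 0 rfl) _
        · exact hasMellin_const_mul (c2 0 2 rfl) _
        · exact hasMellin_const_mul (c2 1 1 rfl) _)
    simpa [Fin.sum_univ_three] using this
  have hB : HasMellin (fun u : ℝ => c * ((latticeRem 3 0 u : ℝ) : ℂ) +
      (c - l) * ((latticeRem 2 1 u : ℝ) : ℂ) + (c - l) * ((latticeRem 1 2 u : ℝ) : ℂ) +
      c * ((latticeRem 0 3 u : ℝ) : ℂ)) (s + 1 + 1)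
      (c * P 3 0 + (c - l) * P 2 1 + (c - l) * P 1 2 + c * P 0 3) := by
    have := hasMellin_sum Finset.univ (f := ![fun u : ℝ => c * ((latticeRem 3 0 u : ℝ) : ℂ),
      fun u : ℝ => (c - l) * ((latticeRem 2 1 u : ℝ) : ℂ),
      fun u : ℝ => (c - l) * ((latticeRem 1 2 u : ℝ) : ℂ),
      fun u : ℝ => c * ((latticeRem 0 3 u : ℝ) : ℂ)]) (s := s + 1 + 1)
      (m := ![c * P 3 0, (c - l) * P 2 1, (c - l) * P 1 2, c * P 0 3]) (by
        intro i _
        fin_cases i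
        · exact hasMellin_const_mul (c3 3 0 rfl) _
        · exact hasMellin_const_mul (c3 2 1 rfl) _
        · exact hasMellin_const_mul (c3 1 2 rfl) _
        · exact hasMellin_const_mul (c3 0 3 rfl) _)
    simpa [Fin.sum_univ_four] using this
  have hA' := hasMellin_cpow_mul (s := s - 1) (a := 2) (by
    rw [show s - 1 + 2 = s + 1 by ring]; exact hA)
  have hB' := hasMellin_cpow_mul (s := s - 1) (a := 3) (by
    rw [show s - 1 + 3 = s + 1 + 1 by ring]; exact hB)
  have hsub := hasMellin_sub hA'.1 hB'.1
  rw [hA'.2, hB'.2] at hsub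
  have hval : mellinCoeff l 1 s = (c * N 2 0 + c * N 0 2 + (-l : ℂ) * N 1 1) -
      (c * P 3 0 + (c - l) * P 2 1 + (c - l) * P 1 2 + c * P 0 3) := by
    rw [mellinCoeff, Nat.cast_one]
    refine (hasMellin_congr hsub fun u _ => ?_).2
    rw [polyRem_coeff_one, hc, Complex.cpow_ofNat, Complex.cpow_ofNat]
    push_cast
    ring
  have hN : N 2 0 + N 0 2 = s * (Complex.Gamma s * torusZeta (s - 1)) - 2 * N 1 1 := by
    rw [← hz']
    linear_combination q1 + q2
  rw [hval, Complex.Gamma_add_one _ hs0]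
  change _ = _ - _ * N 1 1
  have e1 : P 3 0 + P 2 1 = (s + 1) * N 2 0 := q3
  have e2 : P 1 2 + P 0 3 = (s + 1) * N 0 2 := q4
  have e3 : P 2 1 + P 1 2 = (s + 1) * N 1 1 := q5
  linear_combination (-c) * e1 - c * e2 + l * e3 - c * s * hN +
    (hc) * (-s * (s * (Complex.Gamma s * torusZeta (s - 1)) - 2 * N 1 1))

/-! ### Regularized integrals -/

theorem integrableOn_Ioi_of_rpow_smul {h : ℝ → ℂ} {δ : ℝ} (hδ : 0 < δ) (hc : ContinuousOn h (Ioi 0))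
    (hi : IntegrableOn (fun x : ℝ => x ^ δ * ‖h x‖) (Ioi 1)) : IntegrableOn h (Ioi 1) := by
  refine Integrable.mono' hi ((hc.mono (Ioi_subset_Ioi zero_le_one)).aestronglyMeasurable
    measurableSet_Ioi) ((ae_restrict_iff' measurableSet_Ioi).mpr (ae_of_all _ fun x hx => ?_))
  exact le_mul_of_one_le_left (norm_nonneg _) (Real.one_le_rpow (le_of_lt hx) hδ.le)

/-- The tail of an integral is `o(R ^ (-δ))` if the integral converges with the weight `x ^ δ`. -/
theorem integral_tail_isLittleO {h : ℝ → ℂ} {δ : ℝ} (hδ : 0 < δ) (hc : ContinuousOn h (Ioi 0))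
    (hi : IntegrableOn (fun x : ℝ => x ^ δ * ‖h x‖) (Ioi 1)) :
    (fun R : ℝ => (∫ x in (1 : ℝ)..R, h x) - ∫ x in Ioi (1 : ℝ), h x)
      =o[atTop] fun R : ℝ => R ^ (-δ) := by
  have h1 := integrableOn_Ioi_of_rpow_smul hδ hc hi
  have htend : Tendsto (fun R : ℝ => ∫ x in Ioi R, x ^ δ * ‖h x‖) atTop (𝓝 0) := by
    have := (intervalIntegral_tendsto_integral_Ioi 1 hi tendsto_id).const_sub
      (∫ x in Ioi (1 : ℝ), x ^ δ * ‖h x‖)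
    rw [sub_self] at this
    refine this.congr' ?_
    filter_upwards [eventually_ge_atTop 1] with R hR
    rw [id, ← intervalIntegral.integral_Ioi_sub_Ioi hi hR, sub_sub_cancel]
  refine IsBigO.trans_isLittleO (g := fun R : ℝ => R ^ (-δ) * ∫ x in Ioi R, x ^ δ * ‖h x‖) ?_ ?_
  · refine IsBigO.of_bound 1 ?_
    filter_upwards [eventually_ge_atTop 1] with R hR
    have hR0 : 0 < R := by linarith
    have hiR := hi.mono_set (Ioi_subset_Ioi hR)
    rw [← intervalIntegral.integral_Ioi_sub_Ioi h1 hR, sub_sub_cancel_left, norm_neg, one_mul,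
      ← integral_const_mul]
    refine (norm_integral_le_of_norm_le (hiR.const_mul _) ?_).trans (Real.le_norm_self _)
    refine (ae_restrict_iff' measurableSet_Ioi).mpr (ae_of_all _ fun x (hx : R < x) => ?_)
    rw [← mul_assoc]
    refine le_mul_of_one_le_left (norm_nonneg _) ?_
    rw [Real.rpow_neg hR0.le, inv_mul_eq_div, one_le_div (by positivity)]
    exact Real.rpow_le_rpow hR0.le hx.le hδ.le
  · simpa using (isBigO_refl (fun R : ℝ => R ^ (-δ)) atTop).mul_isLittleO
      ((isLittleO_one_iff ℝ).mpr htend)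

theorem integrableOn_Ioc_of_rpow_smul {h : ℝ → ℂ} {δ : ℝ} (hδ : 0 < δ) (hc : ContinuousOn h (Ioi 0))
    (hi : IntegrableOn (fun x : ℝ => x ^ (-δ) * ‖h x‖) (Ioc 0 1)) : IntegrableOn h (Ioc 0 1) := by
  refine Integrable.mono' hi ((hc.mono Ioc_subset_Ioi_self).aestronglyMeasurable
    measurableSet_Ioc) ((ae_restrict_iff' measurableSet_Ioc).mpr (ae_of_all _ fun x hx => ?_))
  exact le_mul_of_one_le_left (norm_nonneg _)
    (Real.one_le_rpow_of_pos_of_le_one_of_nonpos hx.1 hx.2 (by linarith))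

theorem integral_head_isLittleO {h : ℝ → ℂ} {δ : ℝ} (hδ : 0 < δ) (hc : ContinuousOn h (Ioi 0))
    (hi : IntegrableOn (fun x : ℝ => x ^ (-δ) * ‖h x‖) (Ioc 0 1)) :
    (fun R : ℝ => (∫ x in R⁻¹..1, h x) - ∫ x in Ioc (0 : ℝ) 1, h x)
      =o[atTop] fun R : ℝ => R ^ (-δ) := by
  have h1 := integrableOn_Ioc_of_rpow_smul hδ hc hi
  have split {E : Type} [NormedAddCommGroup E] [NormedSpace ℝ E] {g : ℝ → E}
      (hg : IntegrableOn g (Ioc 0 1)) {R : ℝ} (hR : 1 ≤ R) :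
      (∫ x in R⁻¹..1, g x) - ∫ x in Ioc (0 : ℝ) 1, g x = -∫ x in Ioc (0 : ℝ) R⁻¹, g x := by
    have hR0 : 0 < R := by linarith
    have hle : R⁻¹ ≤ 1 := inv_le_one_of_one_le₀ hR
    have hR' : 0 ≤ R⁻¹ := by positivity
    rw [← intervalIntegral.integral_of_le zero_le_one, ← intervalIntegral.integral_of_le hR',
      ← intervalIntegral.integral_add_adjacent_intervals (a := 0) (b := R⁻¹) (c := 1)]
    · abel
    · exact (intervalIntegrable_iff_integrableOn_Ioc_of_le hR').mpr
        (hg.mono_set (Ioc_subset_Ioc_right hle))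
    · exact (intervalIntegrable_iff_integrableOn_Ioc_of_le hle).mpr
        (hg.mono_set (Ioc_subset_Ioc_left hR'))
  have htend : Tendsto (fun R : ℝ => ∫ x in Ioc (0 : ℝ) R⁻¹, x ^ (-δ) * ‖h x‖) atTop (𝓝 0) := by
    have hprim := intervalIntegral.continuousOn_primitive_interval' (μ := volume) (a := 0)
      (b₁ := 0) (b₂ := 1) (f := fun x : ℝ => x ^ (-δ) * ‖h x‖)
      ((intervalIntegrable_iff_integrableOn_Ioc_of_le zero_le_one).mpr hi) (by simp)
    have h0 := hprim 0 (by simp)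
    rw [ContinuousWithinAt, intervalIntegral.integral_same] at h0
    have hinv : Tendsto (fun R : ℝ => R⁻¹) atTop (𝓝[uIcc 0 1] 0) := by
      refine tendsto_nhdsWithin_iff.mpr ⟨tendsto_inv_atTop_zero, ?_⟩
      filter_upwards [eventually_ge_atTop 1] with R hR
      rw [uIcc_of_le zero_le_one]
      exact ⟨by positivity, inv_le_one_of_one_le₀ hR⟩
    refine (h0.comp hinv).congr' ?_
    filter_upwards [eventually_ge_atTop 1] with R hR
    exact intervalIntegral.integral_of_le (by positivity)
  refine IsBigO.trans_isLittleO
    (g := fun R : ℝ => R ^ (-δ) * ∫ x in Ioc (0 : ℝ) R⁻¹, x ^ (-δ) * ‖h x‖) ?_ ?_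
  · refine IsBigO.of_bound 1 ?_
    filter_upwards [eventually_ge_atTop 1] with R hR
    have hR0 : 0 < R := by linarith
    have hiR := hi.mono_set (Ioc_subset_Ioc_right (inv_le_one_of_one_le₀ hR))
    rw [split h1 hR, norm_neg, one_mul, ← integral_const_mul]
    refine (norm_integral_le_of_norm_le (hiR.const_mul _) ?_).trans (Real.le_norm_self _)
    refine (ae_restrict_iff' measurableSet_Ioc).mpr (ae_of_all _ fun x hx => ?_)
    have hx0 : 0 < x := hx.1
    rw [← mul_assoc]
    refine le_mul_of_one_le_left (norm_nonneg _) ?_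
    rw [← Real.mul_rpow hR0.le hx0.le]
    refine Real.one_le_rpow_of_pos_of_le_one_of_nonpos (by positivity) ?_ (by linarith)
    calc R * x ≤ R * R⁻¹ := by gcongr; exact hx.2
      _ = 1 := mul_inv_cancel₀ hR0.ne'
  · simpa using (isBigO_refl (fun R : ℝ => R ^ (-δ)) atTop).mul_isLittleO
      ((isLittleO_one_iff ℝ).mpr htend)

theorem integrableOn_rpow_mul_norm {f : ℝ → ℂ} {s : ℂ} {δ : ℝ}
    (h : MellinConvergent f (s + δ)) :
    IntegrableOn (fun x : ℝ => x ^ δ * ‖(x : ℂ) ^ (s - 1) * f x‖) (Ioi 0) := by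
  refine IntegrableOn.congr_fun (Integrable.norm h) (fun x (hx : 0 < x) => ?_) measurableSet_Ioi
  have hx' : (x : ℂ) ≠ 0 := by exact_mod_cast hx.ne'
  simp only [smul_eq_mul]
  rw [show s + δ - 1 = δ + (s - 1) by ring, Complex.cpow_add _ _ hx', mul_assoc, norm_mul,
    Complex.norm_cpow_eq_rpow_re_of_pos hx, Complex.ofReal_re]

/-- If the Mellin transform of `f` converges in a neighbourhood of `s`, then the regularized integral
of `z ^ (s - 1) (f z + c z ^ (-a))`, `a ≠ s`, exists and equals the Mellin transform of `f`. -/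
theorem hasRegIntegral_mellin {f u : ℝ → ℂ} {s a c : ℂ} {δ : ℝ} (hδ : 0 < δ) (ha : s - a ≠ 0)
    (hf : ContinuousOn f (Ioi 0)) (h1 : MellinConvergent f (s + δ))
    (h2 : MellinConvergent f (s + (-δ : ℝ))) (hu : ContinuousOn u (Ioi 0))
    (h : ∀ z, 0 < z → u z = (z : ℂ) ^ (s - 1) * f z + c * (z : ℂ) ^ (s - a - 1)) :
    HasRegIntegral u (mellin f s) := by
  set g : ℝ → ℂ := fun z => (z : ℂ) ^ (s - 1) * f z with hgdef
  have hpow (r : ℂ) : ContinuousOn (fun z : ℝ => (z : ℂ) ^ r) (Ioi 0) := fun z hz =>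
    (Complex.continuousAt_ofReal_cpow_const z _ (Or.inr (ne_of_gt hz))).continuousWithinAt
  have hg : ContinuousOn g (Ioi 0) := (hpow _).mul hf
  have i1 := integrableOn_rpow_mul_norm h1
  have i2 := integrableOn_rpow_mul_norm h2
  have i1' := i1.mono_set (Ioi_subset_Ioi zero_le_one)
  have i2' := i2.mono_set (show Ioc (0 : ℝ) 1 ⊆ Ioi 0 from Ioc_subset_Ioi_self)
  have t1 := integral_tail_isLittleO hδ hg i1'
  have t2 := integral_head_isLittleO hδ hg i2'
  have hne : s - a - 1 ≠ -1 := fun h' => ha (by linear_combination h')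
  have hpq {p q : ℝ} (hp : 0 < p) (hq : 0 < q) : ∫ z in p..q, u z =
      (∫ z in p..q, g z) + c * (((q : ℂ) ^ (s - a) - (p : ℂ) ^ (s - a)) / (s - a)) := by
    have hsub : uIcc p q ⊆ Ioi 0 := fun x hx => lt_of_lt_of_le (lt_min hp hq) hx.1
    have h0 : (0 : ℝ) ∉ uIcc p q := fun h' => lt_irrefl (0 : ℝ) (hsub h')
    have e := integral_cpow (a := p) (b := q) (r := s - a - 1) (Or.inr ⟨hne, h0⟩)
    rw [sub_add_cancel] at e
    rw [intervalIntegral.integral_congr (g := fun z => g z + c * (z : ℂ) ^ (s - a - 1))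
      (fun z hz => h z (hsub hz)), intervalIntegral.integral_add
      (hg.mono hsub).intervalIntegrable (((hpow _).mono hsub).intervalIntegrable.const_mul c),
      intervalIntegral.integral_const_mul, e]
  refine ⟨hu, (∫ z in Ioc (0 : ℝ) 1, g z) + c / (s - a), (∫ z in Ioi (1 : ℝ), g z) - c / (s - a),
    ⟨{(-(s - a), 0)}, fun _ => -(c / (s - a)), δ, ?_, hδ, ?_⟩,
    ⟨{(s - a, 0)}, fun _ => c / (s - a), δ, ?_, hδ, ?_⟩, ?_⟩
  · simpa [Prod.ext_iff, sub_eq_zero, eq_comm] using ha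
  · refine t2.congr' ?_ EventuallyEq.rfl
    filter_upwards [eventually_gt_atTop 0] with R hR
    have hRi : ((R⁻¹ : ℝ) : ℂ) ^ (s - a) = (R : ℂ) ^ (-(s - a)) := by
      rw [Complex.ofReal_inv, Complex.inv_cpow _ _ (by
        rw [Complex.arg_ofReal_of_nonneg hR.le]; exact Real.pi_pos.ne), Complex.cpow_neg]
    rw [hpq (inv_pos.mpr hR) one_pos, hRi]
    simp
    ring
  · simpa [Prod.ext_iff, sub_eq_zero, eq_comm] using ha
  · refine t1.congr' ?_ EventuallyEq.rfl
    filter_upwards [eventually_gt_atTop 0] with R hR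
    rw [hpq one_pos hR]
    simp
    ring
  · have e : mellin f s = ∫ z in Ioi (0 : ℝ), g z := rfl
    rw [e, ← Ioc_union_Ioi_eq_Ioi (zero_le_one' ℝ), setIntegral_union
      (Ioc_disjoint_Ioi le_rfl) measurableSet_Ioi (integrableOn_Ioc_of_rpow_smul hδ hg i2')
      (integrableOn_Ioi_of_rpow_smul hδ hg i1')]
    ring

/-! ### The angular integral -/

/-- The lattice sum in the integrand of the angular integral. -/
noncomputable def angularSum (z : ℝ) : ℝ :=
  ∑' k : ℤ × ℤ, (k.1 : ℝ) ^ 2 * (k.2 : ℝ) ^ 2 / ((k.1 : ℝ) ^ 2 + (k.2 : ℝ) ^ 2 + z ^ 2) ^ 4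

theorem angularSum_term_le (k : ℤ × ℤ) (z : ℝ) :
    (k.1 : ℝ) ^ 2 * (k.2 : ℝ) ^ 2 / ((k.1 : ℝ) ^ 2 + (k.2 : ℝ) ^ 2 + z ^ 2) ^ 4 ≤
      1 / ((k.1 : ℝ) ^ 2 + (k.2 : ℝ) ^ 2) ^ (2 : ℝ) := by
  rw [Real.rpow_ofNat]
  set a := (k.1 : ℝ) ^ 2
  set b := (k.2 : ℝ) ^ 2
  have ha : 0 ≤ a := sq_nonneg _
  have hb : 0 ≤ b := sq_nonneg _
  rcases (add_nonneg ha hb).eq_or_lt with h | h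
  · have : a = 0 := by linarith
    rw [this]; simp; positivity
  · have hz : 0 ≤ z ^ 2 := sq_nonneg z
    calc a * b / (a + b + z ^ 2) ^ 4 ≤ (a + b) ^ 2 / (a + b) ^ 4 := by
          gcongr ?_ / ?_ ^ 4
          · nlinarith
          · exact le_add_of_nonneg_right hz
      _ = 1 / (a + b) ^ 2 := by field_simp

theorem continuousOn_angularSum : ContinuousOn angularSum (Ioi 0) := by
  refine continuousOn_tsum (fun k => ?_) (summable_lattice one_lt_two) fun k z _ => ?_
  · refine ContinuousOn.div (by fun_prop) (by fun_prop) fun z (hz : 0 < z) => ?_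
    positivity
  · rw [Real.norm_of_nonneg (by positivity)]
    exact angularSum_term_le k z

theorem theta_one_sq (t : ℝ) :
    theta 1 t * theta 1 t = Real.pi / 4 * (t ^ 3)⁻¹ + latticeRem 1 1 t := by
  have h : gaussMoment 0 * gaussMoment 0 = Real.pi := by
    rw [gaussMoment_zero, Real.mul_self_sqrt Real.pi_pos.le]
  have h1 := gaussMoment_succ 0
  simp only [zero_add, Nat.cast_zero] at h1
  rw [latticeRem, h1, ← h]
  ring

theorem integrableOn_cpow_latticeRem {α : ℝ} (h : 1 < α) :
    IntegrableOn (fun t : ℝ => t ^ (-α) * (t ^ 3 * latticeRem 1 1 t)) (Ioi 0) := by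
  have h1 := mellinConvergent_latticeRem (a := 1) (b := 1) (by simp) (s := ((4 - α : ℝ) : ℂ))
    (by rw [Complex.ofReal_re]; norm_num; linarith)
  have h2 : IntegrableOn (fun t : ℝ => (((t ^ (-α) * (t ^ 3 * latticeRem 1 1 t)) : ℝ) : ℂ)) (Ioi 0) := by
    refine IntegrableOn.congr_fun h1 (fun t (ht : 0 < t) => ?_) measurableSet_Ioi
    simp only [smul_eq_mul]
    have : (t : ℂ) ^ (((4 - α : ℝ) : ℂ) - 1) = ((t ^ (-α) * t ^ 3 : ℝ) : ℂ) := by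
      rw [← Real.rpow_ofNat t 3, ← Real.rpow_add ht, Complex.ofReal_cpow ht.le]
      congr 1
      push_cast
      ring
    rw [this]
    push_cast
    ring
  have h3 := Integrable.re h2
  simp only [RCLike.re_to_complex, Complex.ofReal_re] at h3
  exact h3

/-- The lattice sum as a Laplace transform. -/
theorem angularSum_eq {z : ℝ} (hz : 0 < z) :
    angularSum z = Real.pi / 24 * (z ^ 2)⁻¹ +
      ∫ t in Ioi (0 : ℝ), Real.exp (-(t * z ^ 2)) * (t ^ 3 * latticeRem 1 1 t / 6) := by
  have hF : ∀ t ∈ Ioi (0 : ℝ), HasSum (fun k : ℤ × ℤ =>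
      (((k.1 : ℝ) ^ 2 * (k.2 : ℝ) ^ 2 : ℝ) : ℂ) *
        Real.exp (-((k.1 : ℝ) ^ 2 + (k.2 : ℝ) ^ 2 + z ^ 2) * t))
      ((Real.exp (-(t * z ^ 2)) * (theta 1 t * theta 1 t) : ℝ) : ℂ) := by
    intro t ht
    have h := Complex.hasSum_ofReal.mpr ((hasSum_theta_mul 1 1 ht).mul_left
      (Real.exp (-(t * z ^ 2))))
    refine h.congr_fun fun k => ?_
    rw [← Complex.ofReal_mul]
    congr 1
    rw [show -((k.1 : ℝ) ^ 2 + (k.2 : ℝ) ^ 2 + z ^ 2) * t =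
      -(t * (k.1 : ℝ) ^ 2) + -(t * (k.2 : ℝ) ^ 2) + -(t * z ^ 2) by ring, Real.exp_add,
      Real.exp_add]
    ring
  have hsum := hasSum_mellin (s := 4) (fun k : ℤ × ℤ => Or.inr (by positivity)) (by simp) hF (by
    refine (summable_lattice one_lt_two).of_nonneg_of_le (fun k => by positivity) fun k => ?_
    refine le_trans (le_of_eq ?_) (angularSum_term_le k z)
    rw [Complex.norm_real, Real.norm_of_nonneg (by positivity),
      show (4 : ℂ).re = ((4 : ℕ) : ℝ) by simp, Real.rpow_natCast])
  have hG : Complex.Gamma 4 = 6 := by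
    rw [show (4 : ℂ) = ((3 : ℕ) : ℂ) + 1 by norm_num, Complex.Gamma_nat_eq_factorial]
    norm_num [Nat.factorial]
  have hS : HasSum (fun k : ℤ × ℤ => (6 : ℂ) * ((((k.1 : ℝ) ^ 2 * (k.2 : ℝ) ^ 2 /
      ((k.1 : ℝ) ^ 2 + (k.2 : ℝ) ^ 2 + z ^ 2) ^ 4 : ℝ)) : ℂ)) (6 * (angularSum z : ℂ)) := by
    refine HasSum.mul_left _ (Complex.hasSum_ofReal.mpr (Summable.hasSum ?_))
    exact (summable_lattice one_lt_two).of_nonneg_of_le (fun k => by positivity)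
      fun k => angularSum_term_le k z
  have heq := hS.unique (hsum.congr_fun fun k => by
    rw [hG, show (4 : ℂ) = ((4 : ℕ) : ℂ) by norm_num, Complex.cpow_natCast]
    push_cast
    ring)
  have hz2 : 0 < z ^ 2 := by positivity
  have hint1 : IntegrableOn (fun t : ℝ => Real.exp (-(t * z ^ 2))) (Ioi 0) := by
    have := integrableOn_exp_mul_Ioi (a := -(z ^ 2)) (by linarith) 0
    refine this.congr_fun (fun t _ => ?_) measurableSet_Ioi
    ring_nf
  have hval1 : ∫ t in Ioi (0 : ℝ), Real.exp (-(t * z ^ 2)) = (z ^ 2)⁻¹ := by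
    have := integral_exp_mul_Ioi (a := -(z ^ 2)) (by linarith) 0
    rw [mul_zero, Real.exp_zero, neg_div_neg_eq, one_div] at this
    rw [← this]
    refine setIntegral_congr_fun measurableSet_Ioi fun t _ => ?_
    congr 1; ring
  have hint2 : IntegrableOn (fun t : ℝ => Real.exp (-(t * z ^ 2)) * (t ^ 3 * latticeRem 1 1 t / 6))
      (Ioi 0) := by
    have h := (integrableOn_cpow_latticeRem (α := 2) one_lt_two).norm.const_mul
      (2 * (z ^ 2)⁻¹ ^ 2)
    have hc := continuousOn_latticeRem 1 1
    refine Integrable.mono' h (ContinuousOn.aestronglyMeasurable (by fun_prop) measurableSet_Ioi)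
      ((ae_restrict_iff' measurableSet_Ioi).mpr (ae_of_all _ fun t (ht : 0 < t) => ?_))
    have hexp := Real.pow_div_factorial_le_exp (t * z ^ 2) (by positivity) 2
    rw [show ((Nat.factorial 2 : ℕ) : ℝ) = 2 by norm_num [Nat.factorial]] at hexp
    have hexp' : Real.exp (-(t * z ^ 2)) ≤ 2 * (z ^ 2)⁻¹ ^ 2 * t ^ (-2 : ℝ) := by
      rw [Real.exp_neg, Real.rpow_neg ht.le, Real.rpow_ofNat]
      calc (Real.exp (t * z ^ 2))⁻¹ ≤ ((t * z ^ 2) ^ 2 / 2)⁻¹ := by gcongr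
        _ = _ := by field_simp
    rw [norm_mul, norm_mul, Real.norm_of_nonneg (Real.exp_pos _).le,
      Real.norm_of_nonneg (Real.rpow_nonneg ht.le _), ← mul_assoc, norm_div]
    refine mul_le_mul hexp' (div_le_self (norm_nonneg _) (by norm_num)) (by positivity)
      (by positivity)
  have hm : mellin (fun t => ((Real.exp (-(t * z ^ 2)) * (theta 1 t * theta 1 t) : ℝ) : ℂ)) 4 =
      ((∫ t in Ioi (0 : ℝ), (Real.pi / 4 * Real.exp (-(t * z ^ 2)) +
        6 * (Real.exp (-(t * z ^ 2)) * (t ^ 3 * latticeRem 1 1 t / 6))) : ℝ) : ℂ) := by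
    rw [mellin, ← integral_complex_ofReal]
    refine setIntegral_congr_fun measurableSet_Ioi fun t (ht : 0 < t) => ?_
    simp only [smul_eq_mul]
    rw [show (4 - 1 : ℂ) = ((3 : ℕ) : ℂ) by norm_num, Complex.cpow_natCast, theta_one_sq]
    have ht' : (t : ℂ) ≠ 0 := by exact_mod_cast ht.ne'
    push_cast
    field_simp
  rw [hm, integral_add (hint1.const_mul _) (hint2.const_mul _), integral_const_mul,
    integral_const_mul, hval1] at heq
  have heq' : 6 * angularSum z = Real.pi / 4 * (z ^ 2)⁻¹ + 6 * ∫ t in Ioi (0 : ℝ),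
      Real.exp (-(t * z ^ 2)) * (t ^ 3 * latticeRem 1 1 t / 6) := by exact_mod_cast heq
  linarith

theorem hasRegIntegral_angularIntegrand {s : ℂ} (h0 : 0 < s.re) (h1 : s.re < 1) :
    HasRegIntegral (angularIntegrand s) (Complex.Gamma (3 - s) / 12 *
      mellin (fun u => ((latticeRem 1 1 u : ℝ) : ℂ)) (s + 1)) := by
  set ρ : ℝ → ℝ := fun z => angularSum z - Real.pi / 24 * (z ^ 2)⁻¹ with hρ
  have hρc : ContinuousOn ρ (Ioi 0) := by
    refine continuousOn_angularSum.sub (continuousOn_const.mul (ContinuousOn.inv₀ (by fun_prop)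
      fun z (hz : 0 < z) => ?_))
    positivity
  have hL {α : ℂ} (hα : 1 < α.re) := hasMellin_congr (g := fun z => ((ρ z : ℝ) : ℂ))
    (mellin_laplace_sq (α := α) (by linarith) (g := fun t => t ^ 3 * latticeRem 1 1 t / 6)
      (((continuousOn_id.pow 3).mul (continuousOn_latticeRem 1 1)).div_const 6)
      (by
        refine IntegrableOn.congr_fun ((integrableOn_cpow_latticeRem hα).div_const 6)
          (fun t _ => ?_) measurableSet_Ioi
        ring))
    fun z hz => by rw [hρ]; simp only; rw [angularSum_eq hz, add_sub_cancel_left]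
  have hM := hL (α := 3 - s) (by simp; linarith)
  have hM1 := hL (α := 3 - s + (1 / 2 : ℝ)) (by simp; linarith)
  have hM2 := hL (α := 3 - s + (-(1 / 2) : ℝ)) (by simp; linarith)
  have hval : mellin (fun z => ((ρ z : ℝ) : ℂ)) (2 * (3 - s)) = Complex.Gamma (3 - s) / 12 *
      mellin (fun u => ((latticeRem 1 1 u : ℝ) : ℂ)) (s + 1) := by
    rw [hM.2, mellin, show Complex.Gamma (3 - s) / 12 = Complex.Gamma (3 - s) / 2 * (1 / 6) by ring,
      mul_assoc, ← integral_const_mul (1 / 6 : ℂ)]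
    congr 1
    refine setIntegral_congr_fun measurableSet_Ioi fun t (ht : 0 < t) => ?_
    have ht' : (t : ℂ) ≠ 0 := by exact_mod_cast ht.ne'
    simp only [smul_eq_mul]
    rw [show s + 1 - 1 = -(3 - s) + (3 : ℕ) by push_cast; ring, Complex.cpow_add _ _ ht',
      Complex.cpow_natCast]
    push_cast
    ring
  rw [← hval]
  have hpow (r : ℂ) : ContinuousOn (fun z : ℝ => (z : ℂ) ^ r) (Ioi 0) := fun z hz =>
    (Complex.continuousAt_ofReal_cpow_const z _ (Or.inr (ne_of_gt hz))).continuousWithinAt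
  refine hasRegIntegral_mellin (δ := 1) (a := 2) (c := Real.pi / 24) one_pos ?_
    (Complex.continuous_ofReal.comp_continuousOn hρc) ?_ ?_
    ((hpow _).mul (Complex.continuous_ofReal.comp_continuousOn continuousOn_angularSum)) ?_
  · intro h
    have := congrArg Complex.re h
    simp at this
    linarith
  · convert! hM1.1 using 1
    push_cast; ring
  · convert! hM2.1 using 1
    push_cast; ring
  · intro z hz
    have hz' : (z : ℂ) ≠ 0 := by exact_mod_cast hz.ne'
    change (z : ℂ) ^ (4 - 2 * s + 1) * ((angularSum z : ℝ) : ℂ) = _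
    rw [show 2 * (3 - s) - 2 - 1 = 4 - 2 * s + 1 + -2 by ring,
      Complex.cpow_add (4 - 2 * s + 1) (-2) hz', cpow_neg_two, show 2 * (3 - s) - 1 = 4 - 2 * s + 1 by ring, hρ]
    push_cast
    ring

/-! ### The normalized coefficients -/

/-- The coefficient of `n ^ (-2 m)` in the normalization by the factor `V 2 s`. -/
noncomputable def expansionCoeff (l : ℝ) (m : ℕ) (s : ℂ) : ℂ :=
  (V 2 s)⁻¹ * ((Complex.Gamma (s + 1))⁻¹ * mellinCoeff l m s)

theorem V_two_ne_zero {s : ℂ} (h0 : 0 < s.re) (h1 : s.re < 1) : V 2 s ≠ 0 := by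
  rw [V_two h0 h1]
  exact div_ne_zero two_ne_zero (mul_ne_zero (Complex.Gamma_ne_zero_of_re_pos h0)
    (Complex.Gamma_ne_zero_of_re_pos (by simp; linarith)))

theorem spectralZeta_isBigO {l : ℝ} (hl0 : 0 ≤ l) (hl : l ≤ 2 * Real.pi ^ 2 / 3)
    {s : ℂ} (h0 : 0 < s.re) (h1 : s.re < 1) (M : ℕ) :
    (fun n : ℕ+ => spectralZeta (starLaplacian l n) s -
      V 2 s * ((∫ z in Ioi 0, leadingIntegrand (symb l) s z) * (n : ℂ) ^ (2 - 2 * s) +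
        ∑ m ∈ Finset.range M, expansionCoeff l m s * (n : ℂ) ^ (-2 * (m : ℤ))))
      =O[atTop] fun n : ℕ+ => (n : ℂ) ^ (-2 * (M : ℂ) - 2 * s + 2) := by
  refine (spectralZeta_expansion hl0 hl h0 h1 M).congr_left fun n => ?_
  have hV := V_two_ne_zero h0 h1
  have hsum : V 2 s * ∑ m ∈ Finset.range M, expansionCoeff l m s * (n : ℂ) ^ (-2 * (m : ℤ)) =
      (Complex.Gamma (s + 1))⁻¹ *
        ∑ m ∈ Finset.range M, (n : ℂ) ^ (-2 * (m : ℤ)) * mellinCoeff l m s := by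
    rw [Finset.mul_sum, Finset.mul_sum]
    refine Finset.sum_congr rfl fun m _ => ?_
    rw [expansionCoeff, ← mul_assoc, mul_inv_cancel_left₀ hV]
    ring
  rw [mul_add, mul_add, hsum, ← mul_assoc (V 2 s), (leadingIntegrand_integral hl0 hl h0 h1).2]
  ring

theorem expansionCoeff_zero (l : ℝ) {s : ℂ} (h0 : 0 < s.re) (h1 : s.re < 1) :
    expansionCoeff l 0 s = (V 2 s)⁻¹ * torusZeta s := by
  have hG : Complex.Gamma (s + 1) ≠ 0 := Complex.Gamma_ne_zero_of_re_pos (by simp; linarith)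
  rw [expansionCoeff, mellinCoeff_zero l h0 h1, inv_mul_cancel_left₀ hG]

theorem expansionCoeff_one (l : ℝ) {s : ℂ} (h0 : 0 < s.re) (h1 : s.re < 1) :
    expansionCoeff l 1 s = s * (Real.pi : ℂ) ^ 2 / 3 * (V 2 s)⁻¹ * torusZeta (s - 1) -
      (2 * (Real.pi : ℂ) ^ 2 / 3 - l) * (6 / (2 - s)) *
        (Complex.Gamma (3 - s) / 12 *
          mellin (fun u => ((latticeRem 1 1 u : ℝ) : ℂ)) (s + 1)) := by
  have hs0 : s ≠ 0 := by rintro rfl; simp at h0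
  have h2 : 2 - s ≠ 0 := by
    intro h
    have := congrArg Complex.re h
    simp at this
    linarith
  have hG := Complex.Gamma_ne_zero_of_re_pos h0
  have hG2 : Complex.Gamma (2 - s) ≠ 0 := Complex.Gamma_ne_zero_of_re_pos (by simp; linarith)
  rw [expansionCoeff, mellinCoeff_one l h0 h1, V_two h0 h1, Complex.Gamma_add_one _ hs0,
    show 3 - s = (2 - s) + 1 by ring, Complex.Gamma_add_one _ h2]
  field_simp
  ring

end DiscreteTorus

theorem theorem1p6 :
    ∃ b b' : ℕ → ℂ → ℂ, ∀ s : ℂ, 0 < s.re → s.re < 1 →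
      -- the leading coefficients are given by absolutely convergent integrals
      IntegrableOn (DiscreteTorus.leadingIntegrand DiscreteTorus.symbol5 s) (Set.Ioi 0) ∧
      IntegrableOn (DiscreteTorus.leadingIntegrand DiscreteTorus.symbol9 s) (Set.Ioi 0) ∧
      -- the complete asymptotic expansion for the 5-point star Laplacian
      (∀ M : ℕ,
        (fun n : ℕ+ =>
          DiscreteTorus.spectralZeta (DiscreteTorus.laplacian5 n) s -
            DiscreteTorus.V 2 s *
              ((∫ z in Set.Ioi 0, DiscreteTorus.leadingIntegrand DiscreteTorus.symbol5 s z) *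
                  (n : ℂ) ^ (2 - 2 * s) +
                ∑ m ∈ Finset.range M, b m s * (n : ℂ) ^ (-2 * (m : ℤ))))
          =O[atTop] fun n : ℕ+ => (n : ℂ) ^ (-2 * (M : ℂ) - 2 * s + 2)) ∧
      -- the complete asymptotic expansion for the 9-point star Laplacian
      (∀ M : ℕ,
        (fun n : ℕ+ =>
          DiscreteTorus.spectralZeta (DiscreteTorus.laplacian9 n) s -
            DiscreteTorus.V 2 s *
              ((∫ z in Set.Ioi 0, DiscreteTorus.leadingIntegrand DiscreteTorus.symbol9 s z) *
                  (n : ℂ) ^ (2 - 2 * s) +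
                ∑ m ∈ Finset.range M, b' m s * (n : ℂ) ^ (-2 * (m : ℤ))))
          =O[atTop] fun n : ℕ+ => (n : ℂ) ^ (-2 * (M : ℂ) - 2 * s + 2)) ∧
      -- the first coefficients
      b 0 s = (DiscreteTorus.V 2 s)⁻¹ * DiscreteTorus.torusZeta s ∧
      b' 0 s = (DiscreteTorus.V 2 s)⁻¹ * DiscreteTorus.torusZeta s ∧
      b' 1 s = s * (Real.pi : ℂ) ^ 2 / 3 * (DiscreteTorus.V 2 s)⁻¹ *
        DiscreteTorus.torusZeta (s - 1) ∧
      ∃ A : ℂ, DiscreteTorus.HasRegIntegral (DiscreteTorus.angularIntegrand s) A ∧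
        b 1 s = s * (Real.pi : ℂ) ^ 2 / 3 * (DiscreteTorus.V 2 s)⁻¹ *
            DiscreteTorus.torusZeta (s - 1) -
          4 * (Real.pi : ℂ) ^ 2 / (2 - s) * A := by
  have h5 : 2 * Real.pi ^ 2 / 3 ≥ 0 := by positivity
  refine ⟨DiscreteTorus.expansionCoeff 0, DiscreteTorus.expansionCoeff (2 * Real.pi ^ 2 / 3),
    fun s h0 h1 => ?_⟩
  rw [DiscreteTorus.symbol5_eq, DiscreteTorus.symbol9_eq]
  refine ⟨(DiscreteTorus.leadingIntegrand_integral le_rfl h5 h0 h1).1,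
    (DiscreteTorus.leadingIntegrand_integral h5 le_rfl h0 h1).1, fun M => ?_, fun M => ?_,
    DiscreteTorus.expansionCoeff_zero _ h0 h1, DiscreteTorus.expansionCoeff_zero _ h0 h1, ?_,
    _, DiscreteTorus.hasRegIntegral_angularIntegrand h0 h1, ?_⟩
  · simp only [DiscreteTorus.laplacian5_eq]
    exact DiscreteTorus.spectralZeta_isBigO le_rfl h5 h0 h1 M
  · simp only [DiscreteTorus.laplacian9_eq]
    exact DiscreteTorus.spectralZeta_isBigO h5 le_rfl h0 h1 M
  · rw [DiscreteTorus.expansionCoeff_one _ h0 h1]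
    push_cast
    ring
  · rw [DiscreteTorus.expansionCoeff_one _ h0 h1]
    push_cast
    ring
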